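/- Let $d\geq 2$ and $n\geq 0$ be integers. Let $M_d=M_d(\mathbb{C})$, let $E:=(M_d)^{n+1}_{\mathrm{sa}}$ be the real vector space of $(n+1)$-tuples of self-adjoint $d\times d$ matrices, and let $G\subseteq E$ be the set of those tuples that generate $M_d$ as a $C^*$-algebra. The projective unitary group $\mathcal{PU}_d=\mathcal{U}_d/(\mathbb{T}1)$ acts on $E$ by $[u]\cdot(a_0,\ldots,a_n)=(ua_0u^*,\ldots,ua_nu^*)$. The orbit-type stratum of $\mathbf{a}\in E$ is the set of all $\mathbf{b}\in E$ whose stabilizer subgroup is conjugate in $\mathcal{PU}_d$ to that of $\mathbf{a}$. A type is a pair $(\mathbf{d},\mathbf{m})=((d_1,\ldots,d_L),(m_1,\ldots,m_L))$ with $L,d_j,m_j\geq 1$ and $\sum_j d_jm_j=d$, considered up to simultaneous permutation of the entries. Let $B(\mathbf{d},\mathbf{m})\subseteq M_d$ be the algebra of block-diagonal matrices with $m_1$ equal blocks of size $d_1$, followed by $m_2$ equal blocks of size $d_2$, and so on, and set \[ E_{[\mathbf{d},\mathbf{m}]} := \big\{ \mathbf{a}\in E : C^*(\mathbf{a},1)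 = u B(\mathbf{d},\mathbf{m}) u^* \text{ for some unitary } u\in M_d \big\}. \] (0) Every $\mathbf{a}\in E$ lies in some $E_{[\mathbf{d},\mathbf{m}]}$, and whenever $\mathbf{a}\in E_{[\mathbf{d},\mathbf{m}]}$, the orbit-type stratum of $\mathbf{a}$ is $E_{[\mathbf{d},\mathbf{m}]}$. Moreover, $E_{[(d),(1)]}=G$. (1) If $[\mathbf{d},\mathbf{m}]\neq[(d),(1)]$, then $E_{[\mathbf{d},\mathbf{m}]}$ is a smooth embedded submanifold of $E$ of dimension at most $(n+1)d^2-2n(d-1)$ (for $n=0$ it may be empty), and it is nonempty and connected if $n\geq 1$. If $n\geq 1$, then $E_{[(d-1,1),(1,1)]}$, the stratum of type $M_{d-1}\oplus\mathbb{C}$, is nonempty and has dimension exactly $(n+1)d^2-2n(d-1)$. (2) For every compact Hausdorff space $X$, the set $C(X,G)$ is dense in $C(X,E)$ (with the topology of uniform convergence) if and only if $\dim(X)<2n(d-1)$, where $\dim$ is the Lebesgue covering dimension, with $\dim(\emptyset)<0$. -/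

import Mathlib

open scoped Matrix.Norms.L2Operator ContDiff

/-! ### Covering dimension and embedded submanifolds -/

/-- The Lebesgue covering dimension of a topological space: the least `m` such that every finite
open cover has an open refinement for which every point lies in at most `m + 1` members.
The empty space has dimension `⊥` (in place of `-1`), and the value is `⊤` if no finite `m` works. -/
noncomputable def coveringDim (X : Type*) [TopologicalSpace X] : WithBot ℕ∞ :=
  sInf {m : WithBot ℕ∞ |
    ∀ 𝓤 : Set (Set X), 𝓤.Finite → (∀ U ∈ 𝓤, IsOpen U) → ⋃₀ 𝓤 = Set.univ →
      ∃ 𝓥 : Set (Set X), (∀ V ∈ 𝓥, IsOpen V) ∧ ⋃₀ 𝓥 = Set.univ ∧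
        (∀ V ∈ 𝓥, ∃ U ∈ 𝓤, V ⊆ U) ∧
        ∀ x : X, (({V ∈ 𝓥 | x ∈ V}.encard : ℕ∞) : WithBot ℕ∞) ≤ m + 1}

/-- `S` is a smooth embedded submanifold of dimension `k` of the finite-dimensional real normed
space `V`: around each of its points there is a smooth chart of `V` that carries `S` to a
`k`-dimensional linear subspace. (The empty set satisfies this for every `k`.) -/
def IsSmoothSubmanifold {V : Type*} [NormedAddCommGroup V] [NormedSpace ℝ V]
    (k : ℕ) (S : Set V) : Prop :=
  ∀ p ∈ S, ∃ (φ : OpenPartialHomeomorph V V) (L : Submodule ℝ V),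
    p ∈ φ.source ∧ ContDiffOn ℝ ∞ φ φ.source ∧ ContDiffOn ℝ ∞ φ.symm φ.target ∧
      Module.finrank ℝ L = k ∧ ∀ x ∈ φ.source, x ∈ S ↔ φ x ∈ L

/-! ### Tuples of self-adjoint matrices and generators -/

/-- The C*-algebra `M_d` of complex `d × d` matrices. -/
abbrev Mat (d : ℕ) : Type := Matrix (Fin d) (Fin d) ℂ

/-- The space of `(n+1)`-tuples of self-adjoint `d × d` matrices. -/
abbrev SATuple (d n : ℕ) : Type := Fin (n + 1) → selfAdjoint (Mat d)

/-- The set of entries of a tuple. -/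
def SATuple.entries {d n : ℕ} (a : SATuple d n) : Set (Mat d) :=
  Set.range fun i => (a i : Mat d)

/-- `C*(a)`, the (not necessarily unital) sub-C*-algebra of `M_d` generated by `a`. -/
noncomputable def SATuple.cstar {d n : ℕ} (a : SATuple d n) : NonUnitalStarSubalgebra ℂ (Mat d) :=
  (NonUnitalStarAlgebra.adjoin ℂ (SATuple.entries a)).topologicalClosure

/-- `C*₁(a) = C*(a, 1)`, the sub-C*-algebra of `M_d` generated by `a` and the unit of `M_d`. -/
noncomputable def SATuple.unitalCstar {d n : ℕ} (a : SATuple d n) : StarSubalgebra ℂ (Mat d) :=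
  (StarAlgebra.adjoin ℂ (SATuple.entries a)).topologicalClosure

/-- The tuples that generate `M_d` as a C*-algebra. -/
def generatingTuples (d n : ℕ) : Set (SATuple d n) :=
  {a | SATuple.cstar a = ⊤}

/-! ### The projective unitary group and its action -/

/-- The subgroup `𝕋 · 1` of scalar unitaries. -/
def scalarUnitaries (d : ℕ) : Subgroup (Matrix.unitaryGroup (Fin d) ℂ) where
  carrier := {u | ∃ z : Circle, (u : Mat d) = (z : ℂ) • (1 : Mat d)}
  one_mem' := ⟨1, by simp⟩
  mul_mem' := by
    rintro u v ⟨z, hz⟩ ⟨w, hw⟩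
    refine ⟨z * w, ?_⟩
    simp [hz, hw, smul_smul, mul_comm]
  inv_mem' := by
    rintro u ⟨z, hz⟩
    refine ⟨z⁻¹, ?_⟩
    change star (u : Mat d) = _
    rw [hz, star_smul, star_one, Circle.coe_inv_eq_conj]
    rfl

instance scalarUnitaries_normal (d : ℕ) : (scalarUnitaries d).Normal where
  conj_mem := by
    rintro u ⟨z, hz⟩ g
    refine ⟨z, ?_⟩
    have h : (g : Mat d) * star (g : Mat d) = 1 := Unitary.coe_mul_star_self g
    change (g : Mat d) * (u : Mat d) * star (g : Mat d) = _
    rw [hz]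
    simp [h]

/-- The projective unitary group `PU_d = U_d / (𝕋 · 1)`. -/
abbrev PU (d : ℕ) : Type := Matrix.unitaryGroup (Fin d) ℂ ⧸ scalarUnitaries d

/-- Conjugation `x ↦ u x u*` on self-adjoint matrices. -/
def conjSA {d : ℕ} (u : Matrix.unitaryGroup (Fin d) ℂ) (x : selfAdjoint (Mat d)) :
    selfAdjoint (Mat d) :=
  ⟨(u : Mat d) * (x : Mat d) * star (u : Mat d), x.2.conjugate (u : Mat d)⟩

theorem conjSA_mul {d : ℕ} (u v : Matrix.unitaryGroup (Fin d) ℂ) (x : selfAdjoint (Mat d)) :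
    conjSA (u * v) x = conjSA u (conjSA v x) := by
  apply Subtype.ext
  simp [conjSA, mul_assoc]

theorem conjSA_scalar {d : ℕ} {u : Matrix.unitaryGroup (Fin d) ℂ} (hu : u ∈ scalarUnitaries d)
    (x : selfAdjoint (Mat d)) : conjSA u x = x := by
  obtain ⟨z, hz⟩ := hu
  have h : (u : Mat d) * star (u : Mat d) = 1 := Unitary.coe_mul_star_self u
  have hc : (u : Mat d) * (x : Mat d) = (x : Mat d) * (u : Mat d) := by
    rw [hz]; simp
  apply Subtype.ext
  change (u : Mat d) * (x : Mat d) * star (u : Mat d) = x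
  rw [hc, mul_assoc, h, mul_one]

/-- The action `[u] · x = u x u*` of `PU_d` on self-adjoint matrices; on tuples it acts entrywise. -/
instance PU.mulAction (d : ℕ) : MulAction (PU d) (selfAdjoint (Mat d)) where
  smul g x := Quotient.liftOn' g (fun u => conjSA u x) (by
    intro u v huv
    have h := QuotientGroup.leftRel_apply.mp huv
    have : v = u * (u⁻¹ * v) := by group
    change conjSA u x = conjSA v x
    rw [this, conjSA_mul, conjSA_scalar h])
  one_smul x := conjSA_scalar (one_mem _) x
  mul_smul g h x := by
    induction g using QuotientGroup.induction_on
    induction h using QuotientGroup.induction_on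
    exact conjSA_mul _ _ x

/-- Conjugacy of subgroups. -/
def ConjSubgroups {G : Type*} [Group G] (H K : Subgroup G) : Prop :=
  ∃ g : G, K = H.map (MulAut.conj g).toMonoidHom

/-- The orbit-type stratum through `a`: all tuples whose stabilizer in `PU_d` is conjugate to the
stabilizer of `a`. -/
def orbitTypeStratum {d n : ℕ} (a : SATuple d n) : Set (SATuple d n) :=
  {b | ConjSubgroups (MulAction.stabilizer (PU d) a) (MulAction.stabilizer (PU d) b)}

/-! ### Types of unital sub-C*-algebras of `M_d` -/

/-- A type `((d₁, …, d_L), (m₁, …, m_L))`, standing for `M_{d₁} ⊕ ⋯ ⊕ M_{d_L}` embedded unitally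
in `M_d` with multiplicities `m₁, …, m_L`. -/
structure BlockType (d : ℕ) where
  L : ℕ
  size : Fin L → ℕ
  mult : Fin L → ℕ
  L_pos : 1 ≤ L
  size_pos : ∀ j, 1 ≤ size j
  mult_pos : ∀ j, 1 ≤ mult j
  sum_eq : ∑ j, mult j * size j = d

namespace BlockType

/-- Types are identified if they agree up to a permutation. -/
def Equivalent {d : ℕ} (s t : BlockType d) : Prop :=
  ∃ σ : Fin s.L ≃ Fin t.L, ∀ j, s.size j = t.size (σ j) ∧ s.mult j = t.mult (σ j)

/-- The generic type `((d), (1))`, that of `M_d` itself. -/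
def generic (d : ℕ) (hd : 2 ≤ d) : BlockType d where
  L := 1
  size := fun _ => d
  mult := fun _ => 1
  L_pos := le_rfl
  size_pos := fun _ => by omega
  mult_pos := fun _ => le_rfl
  sum_eq := by simp

/-- The type `((d-1, 1), (1, 1))`, that of `M_{d-1} ⊕ ℂ`. -/
def corner (d : ℕ) (hd : 2 ≤ d) : BlockType d where
  L := 2
  size := ![d - 1, 1]
  mult := ![1, 1]
  L_pos := by norm_num
  size_pos := by
    intro j
    fin_cases j
    · change 1 ≤ d - 1
      omega
    · exact le_rfl
  mult_pos := by
    intro j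
    fin_cases j <;> exact le_rfl
  sum_eq := by
    simp only [Fin.sum_univ_two, Matrix.cons_val_zero, Matrix.cons_val_one]
    omega

/-- The order-preserving numbering of the diagonal positions: `(j, x, i)` is position `x` in the
`i`-th copy of the `j`-th block. -/
def index {d : ℕ} (t : BlockType d) :
    (Σ j : Fin t.L, Fin (t.size j) × Fin (t.mult j)) ≃ Fin d :=
  (Equiv.sigmaCongrRight fun _ => (Equiv.prodComm _ _).trans finProdFinEquiv).trans
    (finSigmaFinEquiv.trans (finCongr t.sum_eq))

/-- The block-diagonal matrix with `m₁` copies of `b₁`, followed by `m₂` copies of `b₂`, and so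
on. -/
def blockMatrix {d : ℕ} (t : BlockType d) (b : ∀ j : Fin t.L, Mat (t.size j)) : Mat d :=
  Matrix.reindexAlgEquiv ℂ ℂ t.index
    (Matrix.blockDiagonal' fun j => Matrix.blockDiagonal fun _ : Fin (t.mult j) => b j)

/-- The algebra `B(d⃗, m⃗) ⊆ M_d` of block-diagonal matrices with `m₁` equal blocks of size `d₁`,
followed by `m₂` equal blocks of size `d₂`, and so on. -/
def algebra {d : ℕ} (t : BlockType d) : StarSubalgebra ℂ (Mat d) where
  carrier := Set.range t.blockMatrix
  mul_mem' := by
    rintro _ _ ⟨b, rfl⟩ ⟨c, rfl⟩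
    refine ⟨b * c, ?_⟩
    simp only [blockMatrix, ← map_mul, ← Matrix.blockDiagonal'_mul, ← Matrix.blockDiagonal_mul,
      Pi.mul_apply]
  add_mem' := by
    rintro _ _ ⟨b, rfl⟩ ⟨c, rfl⟩
    refine ⟨b + c, ?_⟩
    have h : (fun j => Matrix.blockDiagonal fun _ : Fin (t.mult j) => (b + c) j) =
        (fun j => Matrix.blockDiagonal fun _ : Fin (t.mult j) => b j) +
          fun j => Matrix.blockDiagonal fun _ : Fin (t.mult j) => c j := by
      funext j
      exact Matrix.blockDiagonal_add _ _
    simp only [blockMatrix, ← map_add, h, Matrix.blockDiagonal'_add]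
  algebraMap_mem' := by
    intro r
    refine ⟨fun j => algebraMap ℂ _ r, ?_⟩
    have h : (Matrix.blockDiagonal' fun j => Matrix.blockDiagonal fun _ : Fin (t.mult j) =>
        (algebraMap ℂ (Mat (t.size j)) r)) = algebraMap ℂ _ r := by
      ext ⟨j, x, i⟩ ⟨j', x', i'⟩
      by_cases hj : j = j'
      · subst hj
        simp only [Matrix.blockDiagonal'_apply_eq, Matrix.blockDiagonal_apply,
          Matrix.algebraMap_matrix_apply]
        by_cases hi : i = i' <;> by_cases hx : x = x' <;> simp [hi, hx]
      · simp [Matrix.algebraMap_matrix_apply, Matrix.blockDiagonal'_apply_ne _ _ _ hj, hj]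
    rw [blockMatrix, h]
    exact AlgEquiv.commutes _ r
  star_mem' := by
    rintro _ ⟨b, rfl⟩
    refine ⟨fun j => star (b j), ?_⟩
    simp only [blockMatrix, Matrix.star_eq_conjTranspose, Matrix.coe_reindexAlgEquiv,
      Matrix.conjTranspose_reindex, Matrix.blockDiagonal'_conjTranspose,
      Matrix.blockDiagonal_conjTranspose]

end BlockType

/-- Unitary equivalence of sub-C*-algebras of `M_d`: `B₁ = u B₂ u*` for a unitary `u`. -/
def UnitarilyConj {d : ℕ} (B₁ B₂ : StarSubalgebra ℂ (Mat d)) : Prop :=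
  ∃ u : Matrix.unitaryGroup (Fin d) ℂ,
    (B₁ : Set (Mat d)) = (fun x : Mat d => (u : Mat d) * x * star (u : Mat d)) '' B₂

/-- The stratum of type `t`: all tuples `a` such that `C*₁(a)` is unitarily equivalent to the
block-diagonal algebra of type `t`. -/
def typeStratum {d : ℕ} (n : ℕ) (t : BlockType d) : Set (SATuple d n) :=
  {a | UnitarilyConj (SATuple.unitalCstar a) t.algebra}

section

open scoped Pointwise

/-! ### Covering dimension -/

/-! Orbit types are read off from algebras by the double commutant theorem in `M_d`
(`StarSubalgebra.mem_of_commute_commutant`). The stabilizer of a tuple consists of the unitaries in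
the commutant of `C*(a, 1)`, modulo scalars. These unitaries span the commutant, so conjugate
stabilizers amount to unitarily equivalent algebras (`conjSubgroups_stabilizer_iff`). Complete
reducibility and Schur's lemma bring every such algebra into block form
(`exists_unitarilyConj_algebra`).

For the manifold structure, let `A = C*(a, 1)`. By compactness of the unitary group, a tuple near
`a` of the same type is `w y w*` with `w` near `1` and `y` in `A` (`eventually_exists_conj_near`).
Splitting from `w` the directions that normalize `A` leaves a vector `k` in a complement of the
normalizer `N`, and a tuple in `A`. Conversely, tuples in `A` near `a` still generate `A`. The
inverse function theorem turns this into a chart (`exists_chart_at`), with dimension `d² - dim N +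
(n+1) ∑ d_j²`. Since `N` contains the self-adjoint part of `A`, this is at most `d² + n ∑ d_j²`, and
`∑ d_j² ≤ d² - 2(d-1)` for nongeneric types. Both bounds are equalities for `M_{d-1} ⊕ ℂ`. For
connectedness, diagonalize the blocks of the first entry: the stratum lies between a connected set
of explicit generators, moved by the connected unitary group, and its closure.

For density, put `m = 2n(d-1)`. The non-generating tuples form a cone that is a countable union of
submanifolds of codimension at least `m`. If `dim X < m`, a map is approximated through the nerve of
a fine cover, whose vertices can be moved into general position with respect to that cone
(`dense_avoiding_of_coveringDim_lt`); smallness is measured by Hausdorff dimension. Conversely, a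
chart at a stratum of codimension exactly `m` converts density into the approximability of maps `X →
ℝ^m` by nowhere vanishing ones (`IsSmoothSubmanifold.dense_ne_zero`). This forces `dim X < m`: a
partition of unity can be perturbed so that no `m + 1` coordinates ever agree
(`coveringDim_lt_of_dense_ne_zero`). The case `n = 0` is separate, since one self-adjoint matrix
never generates. -/

theorem isOpen_not_all_equal {ι : Type*} [Finite ι] (s : Finset ι) :
    IsOpen {v : ι → ℝ | ∃ i ∈ s, ∃ j ∈ s, v i ≠ v j} := by
  have : {v : ι → ℝ | ∃ i ∈ s, ∃ j ∈ s, v i ≠ v j} =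
      ⋃ i ∈ s, ⋃ j ∈ s, {v : ι → ℝ | v i ≠ v j} := by
    ext v; simp
  rw [this]
  exact isOpen_biUnion fun i _ => isOpen_biUnion fun j _ =>
    isOpen_ne_fun (continuous_apply i) (continuous_apply j)

/-- The differences to one fixed coordinate `i₀` of `s` form a map to `ℝ^m` that vanishes exactly
where all coordinates in `s` agree. Replacing it by a nearby nonvanishing map, with the `i₀`-th
coordinate kept, gives the approximation. -/
theorem dense_not_all_equal {X : Type*} [TopologicalSpace X] [CompactSpace X] {m : ℕ}
    (hd : Dense {g : C(X, Fin m → ℝ) | ∀ x, g x ≠ 0}) {ι : Type*} [Fintype ι]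
    (s : Finset ι) (hs : s.card = m + 1) :
    Dense {f : C(X, ι → ℝ) | ∀ x, ∃ i ∈ s, ∃ j ∈ s, f x i ≠ f x j} := by
  classical
  obtain ⟨i₀, hi₀⟩ : s.Nonempty := by
    rw [← Finset.card_pos]; omega
  have hcard : (s.erase i₀).card = m := by
    rw [Finset.card_erase_of_mem hi₀]; omega
  let e : Fin m ≃ s.erase i₀ := (Finset.equivFinOfCardEq hcard).symm
  rw [Metric.dense_iff]
  intro ρ ε hε
  let h : C(X, Fin m → ℝ) := ⟨fun x k => ρ x (e k) - ρ x i₀, by fun_prop⟩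
  obtain ⟨g, hgb, hg⟩ := Metric.dense_iff.mp hd h ε hε
  rw [Metric.mem_ball, ContinuousMap.dist_lt_iff hε] at hgb
  have hcont : Continuous fun x : X => fun i : ι =>
      if hi : i ∈ s.erase i₀ then ρ x i₀ + g x (e.symm ⟨i, hi⟩) else ρ x i := by
    refine continuous_pi fun i => ?_
    by_cases hi : i ∈ s.erase i₀
    · simp only [hi, dite_true]; fun_prop
    · simp only [hi, dite_false]; fun_prop
  refine ⟨⟨_, hcont⟩, ?_, ?_⟩
  · rw [Metric.mem_ball, ContinuousMap.dist_lt_iff hε]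
    intro x
    rw [dist_pi_lt_iff hε]
    intro i
    by_cases hi : i ∈ s.erase i₀
    · have := (dist_pi_lt_iff hε).mp (hgb x) (e.symm ⟨i, hi⟩)
      simp only [ContinuousMap.coe_mk, hi, dite_true]
      rw [Real.dist_eq] at this ⊢
      simp only [h, ContinuousMap.coe_mk, Equiv.apply_symm_apply] at this
      convert this using 2
      ring
    · simpa only [ContinuousMap.coe_mk, hi, dite_false, dist_self] using hε
  · intro x
    by_contra! hcon
    apply hg x
    funext k
    have h1 := hcon (e k) (Finset.mem_of_mem_erase (e k).2) i₀ hi₀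
    have h2 : i₀ ∉ s.erase i₀ := Finset.notMem_erase _ _
    simp only [ContinuousMap.coe_mk, (e k).2, dite_true, h2, dite_false, Subtype.coe_eta,
      Equiv.symm_apply_apply] at h1
    simpa using h1

/-- If every map from a compact Hausdorff space to `ℝ^m` can be approximated by maps avoiding the
origin, then the covering dimension is less than `m`. -/
theorem coveringDim_lt_of_dense_ne_zero {X : Type*} [TopologicalSpace X] [CompactSpace X]
    [T2Space X] {m : ℕ} (hm : 1 ≤ m) (hd : Dense {g : C(X, Fin m → ℝ) | ∀ x, g x ≠ 0}) :
    coveringDim X < ((m : ℕ) : WithBot ℕ∞) := by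
  classical
  have hlt : (((m - 1 : ℕ) : ℕ) : WithBot ℕ∞) < ((m : ℕ) : WithBot ℕ∞) := by
    have : m - 1 < m := by omega
    exact_mod_cast this
  refine lt_of_le_of_lt (sInf_le ?_) hlt
  intro 𝓤 hfin hopen hcov
  have := hfin.fintype
  have hcov' : (Set.univ : Set X) ⊆ ⋃ i : 𝓤, (i : Set X) := by
    rw [← hcov, Set.sUnion_eq_iUnion]
  obtain ⟨ρ, hρ⟩ := PartitionOfUnity.exists_isSubordinate isClosed_univ (fun i : 𝓤 => (i : Set X))
    (fun i => hopen i i.2) hcov'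
  have hsum : ∀ x, ∑ i, ρ i x = 1 := fun x => by
    have := ρ.sum_eq_one (Set.mem_univ x)
    rwa [finsum_eq_sum_of_fintype] at this
  let r : C(X, 𝓤 → ℝ) := ⟨fun x i => ρ i x, by fun_prop⟩
  -- The condition is open and dense for each of the finitely many `(m+1)`-subsets, so some
  -- perturbation of the partition of unity never has `m + 1` equal coordinates.
  have hdense : Dense (⋂ s : {s : Finset 𝓤 // s.card = m + 1},
      {f : C(X, 𝓤 → ℝ) | ∀ x, ∃ i ∈ s.1, ∃ j ∈ s.1, f x i ≠ f x j}) := by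
    refine dense_iInter_of_isOpen (fun s => ?_) (fun s => dense_not_all_equal hd s.1 s.2)
    have := ContinuousMap.isOpen_setOfPred_mapsTo (X := X) (isCompact_univ)
      (isOpen_not_all_equal s.1)
    convert this using 1
    ext f
    simp [Set.MapsTo]
  rcases isEmpty_or_nonempty X with hX | ⟨⟨x₀⟩⟩
  · exact ⟨∅, by simp, Subsingleton.elim _ _, by simp, fun x => (hX.false x).elim⟩
  have hk : 0 < Fintype.card 𝓤 := by
    rw [Fintype.card_pos_iff]
    obtain ⟨i, -⟩ := Set.mem_iUnion.mp (hcov' (Set.mem_univ x₀))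
    exact ⟨i⟩
  -- The value serves twice: `f x i > ε` forces `ρ i x ≠ 0`, and if all `f x j` were at most `ε`,
  -- then all `ρ j x < 2ε` and they could not add up to `1`.
  set ε : ℝ := 1 / (2 * Fintype.card 𝓤) with hε
  have hk' : (0 : ℝ) < Fintype.card 𝓤 := by exact_mod_cast hk
  have hε0 : 0 < ε := by positivity
  obtain ⟨f, hfb, hf⟩ := Metric.dense_iff.mp hdense r ε hε0
  rw [Metric.mem_ball, ContinuousMap.dist_lt_iff hε0] at hfb
  have hfb' : ∀ x i, |f x i - ρ i x| < ε := fun x i => by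
    have := (dist_pi_lt_iff hε0).mp (hfb x) i
    rwa [Real.dist_eq] at this
  have hcont : ∀ i, Continuous fun x => f x i := fun i => by fun_prop
  -- The second factor says that at most `m` coordinates, the `i`-th included, are at least as large
  -- as the `i`-th. It is written as a union of finite intersections so that openness is visible.
  let V : 𝓤 → Set X := fun i => {x | ε < f x i} ∩
    ⋃ S : {S : Finset 𝓤 // S.card ≤ m}, ⋂ j ∈ S.1ᶜ, {x | f x j < f x i}
  have hVV : ∀ i x, x ∈ V i → (Finset.univ.filter fun j => f x i ≤ f x j).card ≤ m := by
    intro i x hx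
    obtain ⟨⟨S, hS⟩, hx2⟩ := Set.mem_iUnion.mp hx.2
    refine le_trans (Finset.card_le_card ?_) hS
    intro j hj
    by_contra hjS
    have h3 : f x j < f x i := by
      simpa using Set.mem_iInter₂.mp hx2 j (Finset.mem_compl.mpr hjS)
    exact absurd (Finset.mem_filter.mp hj).2 (not_le.mpr h3)
  refine ⟨Set.range V, ?_, ?_, ?_, ?_⟩
  · rintro _ ⟨i, rfl⟩
    refine (isOpen_lt continuous_const (hcont i)).inter (isOpen_iUnion fun S => ?_)
    exact isOpen_biInter_finset fun j _ => isOpen_lt (hcont j) (hcont i)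
  · refine Set.eq_univ_of_forall fun x => ?_
    have hne : (Finset.univ : Finset 𝓤).Nonempty := Finset.card_pos.mp hk
    obtain ⟨i, -, hi⟩ := Finset.exists_max_image Finset.univ (fun i => f x i) hne
    refine Set.mem_sUnion.mpr ⟨V i, ⟨i, rfl⟩, ?_, ?_⟩
    · change ε < f x i
      by_contra! hle
      have : ∑ j, ρ j x < ∑ j : 𝓤, 2 * ε := by
        refine Finset.sum_lt_sum_of_nonempty hne fun j _ => ?_
        have h1 := hi j (Finset.mem_univ j)
        have h2 := abs_lt.mp (hfb' x j)
        linarith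
      rw [hsum, Finset.sum_const, Finset.card_univ, nsmul_eq_mul, hε] at this
      field_simp at this
      linarith
    · refine Set.mem_iUnion.mpr ⟨⟨Finset.univ.filter fun j => f x i ≤ f x j, ?_⟩, ?_⟩
      -- For a maximal coordinate, the indices counted are those that tie with it; more than `m` of
      -- them would give `m + 1` equal coordinates.
      · by_contra! hlt
        obtain ⟨s, hs, hsc⟩ := Finset.exists_subset_card_eq (Nat.succ_le_of_lt hlt)
        obtain ⟨a, ha, b, hb, hab⟩ := Set.mem_iInter.mp hf ⟨s, hsc⟩ x
        apply hab
        have h1 := (Finset.mem_filter.mp (hs ha)).2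
        have h2 := (Finset.mem_filter.mp (hs hb)).2
        exact le_antisymm ((hi a (Finset.mem_univ a)).trans h2)
          ((hi b (Finset.mem_univ b)).trans h1)
      · refine Set.mem_iInter₂.mpr fun j hj => ?_
        simpa using hj
  · rintro _ ⟨i, rfl⟩
    refine ⟨i, i.2, fun x hx => hρ i (subset_tsupport _ ?_)⟩
    intro h0
    have h1 : ε < f x i := hx.1
    have h2 := abs_lt.mp (hfb' x i)
    have h3 : ρ i x = 0 := h0
    linarith
  · intro x
    have hsub : {W ∈ Set.range V | x ∈ W} ⊆ V '' ({i | x ∈ V i}) := by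
      rintro _ ⟨⟨i, rfl⟩, hx⟩
      exact ⟨i, hx, rfl⟩
    have hcard : ((Finset.univ.filter fun i => x ∈ V i).card) ≤ m := by
      rcases (Finset.univ.filter fun i => x ∈ V i).eq_empty_or_nonempty with h0 | hne
      · rw [h0]; simp
      -- Among the members containing `x`, take the one with the smallest value: all the others are
      -- counted in the bound `hVV` for it.
      · obtain ⟨i, hi, hmin⟩ := Finset.exists_min_image _ (fun i => f x i) hne
        refine le_trans (Finset.card_le_card ?_) (hVV i x (Finset.mem_filter.mp hi).2)
        intro j hj
        exact Finset.mem_filter.mpr ⟨Finset.mem_univ _, hmin j hj⟩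
    have h1 : ({W ∈ Set.range V | x ∈ W}).encard ≤ (m : ℕ∞) := by
      refine (Set.encard_le_encard hsub).trans ((Set.encard_image_le _ _).trans ?_)
      have : {i | x ∈ V i} = ((Finset.univ.filter fun i => x ∈ V i : Finset 𝓤) : Set 𝓤) := by
        ext; simp
      rw [this, Set.encard_coe_eq_coe_finsetCard]
      exact_mod_cast hcard
    have h2 : (((m - 1 : ℕ) : ℕ) : WithBot ℕ∞) + 1 = ((m : ℕ∞) : WithBot ℕ∞) := by
      have : m = (m - 1) + 1 := by omega
      conv_rhs => rw [this]
      push_cast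
      rfl
    rw [h2]
    exact WithBot.coe_le_coe.mpr h1

/-- Some `k < m` is admissible in the infimum, and its multiplicity bound `k + 1` is at most `m`. A
finite subcover, available by compactness, inherits the bound and the subordination. -/
theorem exists_refinement_of_coveringDim_lt {X : Type*} [TopologicalSpace X] [CompactSpace X]
    {m : ℕ} (h : coveringDim X < ((m : ℕ) : WithBot ℕ∞)) (𝓤 : Set (Set X)) (hfin : 𝓤.Finite)
    (hopen : ∀ U ∈ 𝓤, IsOpen U) (hcov : ⋃₀ 𝓤 = Set.univ) :
    ∃ 𝓥 : Set (Set X), 𝓥.Finite ∧ (∀ V ∈ 𝓥, IsOpen V) ∧ ⋃₀ 𝓥 = Set.univ ∧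
      (∀ V ∈ 𝓥, ∃ U ∈ 𝓤, V ⊆ U) ∧ ∀ x : X, ({V ∈ 𝓥 | x ∈ V}).encard ≤ m := by
  obtain ⟨k, hk, hkm⟩ := sInf_lt_iff.mp h
  obtain ⟨𝓥, h1, h2, h3, h4⟩ := hk 𝓤 hfin hopen hcov
  have hc' : (Set.univ : Set X) ⊆ ⋃ V ∈ 𝓥, id V := by
    rw [← h2, Set.sUnion_eq_biUnion]; rfl
  obtain ⟨𝓦, hW, hWf, hWc⟩ := isCompact_univ.elim_finite_subcover_image (c := id) h1 hc'
  refine ⟨𝓦, hWf, fun V hV => h1 V (hW hV), ?_, fun V hV => h3 V (hW hV), fun x => ?_⟩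
  · rw [Set.sUnion_eq_biUnion]
    exact Set.univ_subset_iff.mp hWc
  · have hle : ({V ∈ 𝓦 | x ∈ V}).encard ≤ ({V ∈ 𝓥 | x ∈ V}).encard :=
      Set.encard_le_encard fun V hV => ⟨hW hV.1, hV.2⟩
    have hx := h4 x
    induction k with
    | bot => exact absurd hx (by simp)
    | coe k =>
      have hkm' : k < (m : ℕ∞) := WithBot.coe_lt_coe.mp hkm
      have hx' : ({V ∈ 𝓥 | x ∈ V}).encard ≤ k + 1 := WithBot.coe_le_coe.mp hx
      exact hle.trans (hx'.trans (Order.add_one_le_of_lt hkm'))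

/-! ### General position -/

/-- The vertices are chosen one at a time. The new one must avoid `Z + span` for every set of fewer
than `m` vertices; these finitely many sets have Hausdorff dimension at most `D`, less than that of
`V`, so their union has dense complement. If a combination with nonzero coefficient `t i` lay in the
cone `Z`, dividing by `t i` would put the new vertex into one of these sets. -/
theorem exists_general_position {V : Type*} [NormedAddCommGroup V] [NormedSpace ℝ V]
    [FiniteDimensional ℝ V] {Z : Set V} {m : ℕ} {D : ENNReal}
    (hcone : ∀ (c : ℝ), ∀ z ∈ Z, c • z ∈ Z)
    (hD : D < Module.finrank ℝ V)
    (hdim : ∀ W : Submodule ℝ V, Module.finrank ℝ W < m → dimH (Z + (W : Set V)) ≤ D)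
    {ι : Type*} [Finite ι] (c : ι → V) {δ : ℝ} (hδ : 0 < δ) (F : Finset ι) :
    ∃ v : ι → V, (∀ i, dist (v i) (c i) < δ) ∧
      ∀ s ⊆ F, s.card ≤ m → ∀ t : ι → ℝ, ∑ i ∈ s, t i = 1 → ∑ i ∈ s, t i • v i ∉ Z := by
  classical
  induction F using Finset.induction_on with
  | empty =>
    refine ⟨c, fun i => by simpa using hδ, fun s hs _ t ht => ?_⟩
    rw [Finset.subset_empty.mp hs] at ht
    simp at ht
  | insert i F hi ih =>
    obtain ⟨v, hv, hF⟩ := ih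
    let bad : Set V := ⋃ s : {s : Finset ι // s.card < m},
      (Z + (Submodule.span ℝ (v '' (s.1 : Set ι)) : Set V))
    have hbad : dimH bad < Module.finrank ℝ V := by
      refine lt_of_le_of_lt ?_ hD
      rw [dimH_iUnion]
      refine iSup_le fun s => hdim _ (lt_of_le_of_lt ?_ s.2)
      have h1 := finrank_span_finset_le_card (R := ℝ) (s.1.image v)
      rw [Finset.coe_image] at h1
      exact le_trans h1 Finset.card_image_le
    obtain ⟨w, hw, hwc⟩ := Metric.dense_iff.mp (dense_compl_of_dimH_lt_finrank hbad) (c i) δ hδ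
    refine ⟨Function.update v i w, fun j => ?_, fun s hs hsm t ht => ?_⟩
    · by_cases hj : j = i
      · subst hj; simpa using hw
      · simpa [Function.update_of_ne hj] using hv j
    · have hupd : ∀ s' : Finset ι, i ∉ s' →
          ∑ j ∈ s', t j • Function.update v i w j = ∑ j ∈ s', t j • v j := by
        intro s' hs'
        refine Finset.sum_congr rfl fun j hj => ?_
        rw [Function.update_of_ne]
        rintro rfl; exact hs' hj
      by_cases his : i ∈ s
      · have hsub : s.erase i ⊆ F := fun j hj => by
          have h1 := Finset.mem_erase.mp hj
          exact (Finset.mem_insert.mp (hs h1.2)).resolve_left h1.1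
        have hni : i ∉ s.erase i := Finset.notMem_erase _ _
        have hce : (s.erase i).card + 1 = s.card := Finset.card_erase_add_one his
        rw [← Finset.add_sum_erase s _ his] at ht ⊢
        rw [hupd _ hni, Function.update_self]
        by_cases hti : t i = 0
        · rw [hti, zero_smul, zero_add]
          rw [hti, zero_add] at ht
          exact hF _ hsub (by omega) t ht
        · intro hz
          apply hwc
          refine Set.mem_iUnion.mpr ⟨⟨s.erase i, by omega⟩, ?_⟩
          refine ⟨_, hcone (t i)⁻¹ _ hz, -((t i)⁻¹ • ∑ j ∈ s.erase i, t j • v j), ?_, ?_⟩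
          · refine Submodule.neg_mem _ (Submodule.smul_mem _ _ (Submodule.sum_mem _ fun j hj => ?_))
            exact Submodule.smul_mem _ _ (Submodule.subset_span ⟨j, by simpa [and_comm] using hj, rfl⟩)
          · simp only [smul_add, smul_smul, inv_mul_cancel₀ hti, one_smul]
            abel
      · rw [hupd _ his]
        refine hF s (fun j hj => ?_) hsm t ht
        refine (Finset.mem_insert.mp (hs hj)).resolve_left ?_
        rintro rfl; exact his hj

/-- Maps from a compact Hausdorff space of covering dimension less than `m` into `V` can be
approximated by maps avoiding a cone of codimension at least `m`. -/
theorem dense_avoiding_of_coveringDim_lt {V : Type*} [NormedAddCommGroup V] [NormedSpace ℝ V]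
    [FiniteDimensional ℝ V] {Z : Set V} {m : ℕ} {D : ENNReal}
    (hcone : ∀ (c : ℝ), ∀ z ∈ Z, c • z ∈ Z)
    (hD : D < Module.finrank ℝ V)
    (hdim : ∀ W : Submodule ℝ V, Module.finrank ℝ W < m → dimH (Z + (W : Set V)) ≤ D)
    {X : Type*} [TopologicalSpace X] [CompactSpace X] [T2Space X]
    (hX : coveringDim X < ((m : ℕ) : WithBot ℕ∞)) :
    Dense {f : C(X, V) | ∀ x, f x ∉ Z} := by
  classical
  rw [Metric.dense_iff]
  intro f ε hε
  obtain ⟨T, -, hTf, hT⟩ := (isCompact_univ (X := X)).elim_finite_subcover_image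
    (b := Set.univ) (c := fun x : X => f ⁻¹' Metric.ball (f x) (ε / 4))
    (fun x _ => Metric.isOpen_ball.preimage f.continuous)
    (fun x _ => Set.mem_biUnion (Set.mem_univ x) (Metric.mem_ball_self (by positivity)))
  obtain ⟨𝓥, hVf, hVo, hVc, hVr, hVm⟩ := exists_refinement_of_coveringDim_lt hX
    ((fun x : X => f ⁻¹' Metric.ball (f x) (ε / 4)) '' T) (hTf.image _)
    (by rintro _ ⟨x, -, rfl⟩; exact Metric.isOpen_ball.preimage f.continuous)
    (by rw [Set.sUnion_image]; exact Set.univ_subset_iff.mp hT)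
  have := hVf.fintype
  obtain ⟨ρ, hρ⟩ := PartitionOfUnity.exists_isSubordinate (isClosed_univ (X := X))
    (fun i : 𝓥 => (i : Set X)) (fun i => hVo i i.2) (by rw [← hVc, Set.sUnion_eq_iUnion])
  have hsum : ∀ x, ∑ i, ρ i x = 1 := fun x => by
    have := ρ.sum_eq_one (Set.mem_univ x)
    rwa [finsum_eq_sum_of_fintype] at this
  have hc : ∀ i : 𝓥, ∃ c : V, ∀ x ∈ (i : Set X), dist (f x) c < ε / 4 := by
    intro i
    obtain ⟨_, ⟨y, -, rfl⟩, hy⟩ := hVr i i.2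
    exact ⟨f y, fun x hx => hy hx⟩
  choose c hc using hc
  obtain ⟨v, hv, hgen⟩ := exists_general_position hcone hD hdim c
    (show 0 < ε / 4 by positivity) Finset.univ
  -- This is the map to the nerve of the cover followed by the simplexwise linear map with vertices
  -- in general position. Each value involves at most `m` vertices.
  let g : C(X, V) := ⟨fun x => ∑ i, ρ i x • v i, by fun_prop⟩
  have hmem : ∀ x (i : 𝓥), ρ i x ≠ 0 → x ∈ (i : Set X) := fun x i h =>
    hρ i (subset_tsupport _ h)
  refine ⟨g, ?_, fun x => ?_⟩
  · rw [Metric.mem_ball]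
    refine lt_of_le_of_lt ((ContinuousMap.dist_le (show 0 ≤ ε / 2 by positivity)).mpr fun x => ?_)
      (half_lt_self hε)
    rw [dist_eq_norm]
    have : g x - f x = ∑ i, ρ i x • (v i - f x) := by
      simp only [g, ContinuousMap.coe_mk, smul_sub, Finset.sum_sub_distrib, ← Finset.sum_smul,
        hsum, one_smul]
    rw [this]
    calc ‖∑ i, ρ i x • (v i - f x)‖ ≤ ∑ i, ‖ρ i x • (v i - f x)‖ := norm_sum_le _ _
      _ ≤ ∑ i, ρ i x * (ε / 2) := by
        refine Finset.sum_le_sum fun i _ => ?_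
        rw [norm_smul, Real.norm_of_nonneg (ρ.nonneg i x)]
        by_cases h0 : ρ i x = 0
        · simp [h0]
        · refine mul_le_mul_of_nonneg_left ?_ (ρ.nonneg i x)
          have h1 := hc i x (hmem x i h0)
          have h2 := hv i
          rw [← dist_eq_norm]
          have := dist_triangle_right (v i) (f x) (c i)
          linarith
      _ = ε / 2 := by rw [← Finset.sum_mul, hsum, one_mul]
  · let s := Finset.univ.filter fun i : 𝓥 => ρ i x ≠ 0
    have h1 : ∑ i ∈ s, ρ i x • v i = g x := by
      refine Finset.sum_subset (Finset.subset_univ _) fun i _ hi => ?_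
      have : ρ i x = 0 := by simpa [s] using hi
      rw [this, zero_smul]
    have h2 : ∑ i ∈ s, ρ i x = 1 := by
      rw [← hsum x]
      refine Finset.sum_subset (Finset.subset_univ _) fun i _ hi => ?_
      simpa [s] using hi
    have h3 : s.card ≤ m := by
      have h4 : ((s : Set 𝓥)).encard ≤ m := by
        refine le_trans ?_ (hVm x)
        rw [← Subtype.val_injective.encard_image]
        refine Set.encard_le_encard ?_
        rintro _ ⟨i, hi, rfl⟩
        exact ⟨i.2, hmem x i (Finset.mem_filter.mp hi).2⟩
      rw [Set.encard_coe_eq_coe_finsetCard] at h4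
      exact_mod_cast h4
    rw [← h1]
    exact hgen s (Finset.subset_univ _) h3 _ h2

/-! ### Hausdorff dimension of submanifolds -/

/-- In a chart, `S + W` is the image of a convex piece of `L × W` under the smooth map `(l, w) ↦
φ⁻¹(l) + w`, which does not raise the Hausdorff dimension. Countably many charts cover `S`. -/
theorem IsSmoothSubmanifold.dimH_add_submodule_le {V : Type*} [NormedAddCommGroup V]
    [NormedSpace ℝ V] [FiniteDimensional ℝ V] {k : ℕ} {S : Set V} (hS : IsSmoothSubmanifold k S)
    (W : Submodule ℝ V) : dimH (S + (W : Set V)) ≤ ((k + Module.finrank ℝ W : ℕ) : ENNReal) := by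
  have hloc : ∀ p ∈ S, ∃ U ∈ nhdsWithin p S,
      dimH (U ∩ S + (W : Set V)) ≤ ((k + Module.finrank ℝ W : ℕ) : ENNReal) := by
    intro p hp
    obtain ⟨φ, L, hps, -, hφ', hL, hφS⟩ := hS p hp
    obtain ⟨r, hr, hball⟩ := Metric.isOpen_iff.mp φ.open_target _ (φ.map_source hps)
    have hU : φ.source ∩ φ ⁻¹' Metric.ball (φ p) r ∈ nhds p :=
      Filter.inter_mem (φ.open_source.mem_nhds hps)
        ((φ.continuousAt hps).preimage_mem_nhds (Metric.ball_mem_nhds _ hr))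
    refine ⟨_, mem_nhdsWithin_of_mem_nhds hU, ?_⟩
    let F : L × W → V := fun q => φ.symm (q.1 : V) + (q.2 : V)
    let s : Set (L × W) := {q | (q.1 : V) ∈ Metric.ball (φ p) r}
    have hconv : Convex ℝ s := by
      have := (convex_ball (φ p) r).linear_preimage
        (L.subtype.comp (LinearMap.fst ℝ L W))
      exact this
    have hF : ContDiffOn ℝ 1 F s := by
      refine ContDiffOn.add ?_ ?_
      · refine ((hφ'.of_le (by exact_mod_cast le_top)).mono hball).comp
          (t := Metric.ball (φ p) r) (g := φ.symm) (f := fun q : L × W => (q.1 : V)) ?_ ?_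
        · exact (L.subtypeL.contDiff.comp contDiff_fst).contDiffOn
        · exact fun q hq => hq
      · exact (W.subtypeL.contDiff.comp contDiff_snd).contDiffOn
    have hsub : φ.source ∩ φ ⁻¹' Metric.ball (φ p) r ∩ S + (W : Set V) ⊆ F '' s := by
      rintro _ ⟨x, ⟨⟨hx, hxb⟩, hxS⟩, w, hw, rfl⟩
      refine ⟨(⟨φ x, (hφS x hx).mp hxS⟩, ⟨w, hw⟩), hxb, ?_⟩
      simp [F, φ.left_inv hx]
    refine (dimH_mono hsub).trans ((hF.dimH_image_le hconv le_rfl).trans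
      ((dimH_mono (Set.subset_univ _)).trans ?_))
    rw [Real.dimH_univ_eq_finrank, Module.finrank_prod, hL]
  choose! U hU hUd using hloc
  obtain ⟨T, hTS, hTc, hT⟩ := TopologicalSpace.countable_cover_nhdsWithin hU
  have hsub : S + (W : Set V) ⊆ ⋃ p ∈ T, (U p ∩ S + (W : Set V)) := by
    rintro _ ⟨x, hx, w, hw, rfl⟩
    obtain ⟨p, hpT, hxp⟩ := Set.mem_iUnion₂.mp (hT hx)
    exact Set.mem_iUnion₂.mpr ⟨p, hpT, x, ⟨hxp, hx⟩, w, hw, rfl⟩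
  refine (dimH_mono hsub).trans ?_
  rw [dimH_bUnion hTc]
  exact iSup₂_le fun p hp => hUd p (hTS hp)

/-- If maps into `V` can be approximated by maps avoiding a nonempty submanifold of codimension
`m`, then maps into `ℝ^m` can be approximated by maps avoiding the origin. -/
theorem IsSmoothSubmanifold.dense_ne_zero {V : Type*} [NormedAddCommGroup V]
    [NormedSpace ℝ V] [FiniteDimensional ℝ V] {k m : ℕ} {S : Set V} (hS : IsSmoothSubmanifold k S)
    (hne : S.Nonempty) (hkm : k + m = Module.finrank ℝ V)
    {X : Type*} [TopologicalSpace X] [CompactSpace X] [T2Space X]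
    (hX : Dense {f : C(X, V) | ∀ x, f x ∉ S}) :
    Dense {g : C(X, Fin m → ℝ) | ∀ x, g x ≠ 0} := by
  obtain ⟨p, hp⟩ := hne
  obtain ⟨φ, L, hps, -, -, hL, hφS⟩ := hS p hp
  obtain ⟨C, hC⟩ := Submodule.exists_isCompl L
  have hCm : Module.finrank ℝ C = m := by
    have := Submodule.finrank_add_eq_of_isCompl hC
    omega
  let e : C ≃L[ℝ] (Fin m → ℝ) := ContinuousLinearEquiv.ofFinrankEq (by simp [hCm])
  let P : V →L[ℝ] C := (Submodule.projectionOnto C L hC.symm).toContinuousLinearMap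
  have hP0 : ∀ v, P v = 0 ↔ v ∈ L := fun v => by
    simp [P]
  have hPC : ∀ c : C, P (c : V) = c := fun c => by simp [P]
  rw [Metric.dense_iff]
  intro h ε hε
  have hpL : φ p ∈ L := (hφS p hps).mp hp
  -- a uniform bound for `h`
  let H : C(X, V) := ⟨fun x => (e.symm (h x) : V), by fun_prop⟩
  obtain ⟨r, hr, hball⟩ := Metric.isOpen_iff.mp φ.open_target _ (φ.map_source hps)
  -- `H` is bounded because `X` is compact, so a small multiple of it, based at `φ p`, stays in the
  -- target of the chart.
  obtain ⟨η, hη, hηr⟩ : ∃ η : ℝ, 0 < η ∧ ∀ x, η * ‖H x‖ < r := by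
    refine ⟨r / (‖H‖ + 1), by positivity, fun x => ?_⟩
    have h1 := H.norm_coe_le_norm x
    have h2 := norm_nonneg H
    rw [div_mul_eq_mul_div, div_lt_iff₀ (by positivity)]
    nlinarith
  have hin : ∀ x, φ p + η • H x ∈ φ.target := fun x => hball (by
    rw [Metric.mem_ball, dist_eq_norm, add_sub_cancel_left, norm_smul, Real.norm_of_nonneg hη.le]
    exact hηr x)
  let f : C(X, V) := ⟨fun x => φ.symm (φ p + η • H x), by
    refine φ.continuousOn_symm.comp_continuous (by fun_prop) hin⟩
  -- `Q` is the rescaled normal coordinate: inside the chart it vanishes exactly on `S`, and it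
  -- takes `f` back to `h`.
  let Q : V → (Fin m → ℝ) := fun v => η⁻¹ • e (P (φ v))
  have hQ : ContinuousOn Q φ.source := by
    have : Continuous fun v : V => η⁻¹ • e (P v) := by fun_prop
    exact this.comp_continuousOn φ.continuousOn
  have hfs : ∀ x, f x ∈ φ.source := fun x => φ.map_target (hin x)
  have hQf : ∀ x, Q (f x) = h x := fun x => by
    have : φ (f x) = φ p + η • H x := φ.right_inv (hin x)
    simp only [Q, this, map_add, map_smul, (hP0 _).mpr hpL, zero_add]
    have h2 : P (H x) = e.symm (h x) := hPC _
    rw [h2, smul_smul, inv_mul_cancel₀ hη.ne', one_smul, e.apply_symm_apply]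
  -- `Q` is continuous only on the chart domain, so closeness of `Q ∘ g` to `h` is expressed as an
  -- open condition on the graph of `g`.
  have hopen : IsOpen {y : X × V | y.2 ∈ φ.source ∧ dist (Q y.2) (h y.1) < ε} := by
    have h1 : IsOpen {y : X × V | y.2 ∈ φ.source} := φ.open_source.preimage continuous_snd
    have h2 : ContinuousOn (fun y : X × V => dist (Q y.2) (h y.1)) {y : X × V | y.2 ∈ φ.source} :=
      continuous_dist.comp_continuousOn ((hQ.comp continuousOn_snd fun y hy => hy).prodMk
        (h.continuous.comp continuous_fst).continuousOn)
    exact h2.isOpen_inter_preimage h1 isOpen_Iio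
  have hopen2 : IsOpen {g : C(X, V) | ∀ x, g x ∈ φ.source ∧ dist (Q (g x)) (h x) < ε} := by
    have h3 : Continuous fun g : C(X, V) => (ContinuousMap.id X).prodMk g :=
      ContinuousMap.continuous_of_continuous_uncurry _
        (continuous_snd.prodMk ContinuousEval.continuous_eval)
    have h4 := (ContinuousMap.isOpen_setOfPred_mapsTo (isCompact_univ (X := X)) hopen).preimage h3
    convert h4 using 1
    ext g
    simp [Set.MapsTo]
  obtain ⟨g, hg1, hg2⟩ := hX.inter_open_nonempty _ hopen2
    ⟨f, fun x => ⟨hfs x, by rw [hQf, dist_self]; exact hε⟩⟩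
  refine ⟨⟨fun x => Q (g x), hQ.comp_continuous g.continuous fun x => (hg1 x).1⟩, ?_, fun x h0 => ?_⟩
  · rw [Metric.mem_ball, ContinuousMap.dist_lt_iff hε]
    exact fun x => (hg1 x).2
  · apply hg2 x
    rw [hφS _ (hg1 x).1, ← hP0]
    have : η⁻¹ • e (P (φ (g x))) = 0 := h0
    simpa [hη.ne'] using this

/-! ### The double commutant theorem in `M_d` -/

open Matrix ComplexOrder in
-- The trace form is nondegenerate on `A` because `A` is closed under adjoints, so there is a
-- projection `P` of `M_d` onto `A` along the orthogonal complement, and `P` commutes with left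
-- multiplication by `A`. The coefficients of `P` therefore assemble into matrices in the commutant.
-- As `T` commutes with these, `P T = T (P 1) = T`, so `T` lies in `A`.
theorem StarSubalgebra.mem_of_commute_commutant {d : ℕ} (A : StarSubalgebra ℂ (Mat d)) {T : Mat d}
    (hT : ∀ c : Mat d, (∀ a ∈ A, c * a = a * c) → c * T = T * c) : T ∈ A := by
  let B : LinearMap.BilinForm ℂ (Mat d) :=
    (LinearMap.mul ℂ (Mat d)).compr₂ (Matrix.traceLinearMap (Fin d) ℂ ℂ)
  have hB : ∀ x y, B x y = (x * y).trace := fun x y => rfl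
  have hrefl : B.IsRefl := fun x y h => by
    rw [hB] at h ⊢
    rwa [Matrix.trace_mul_comm]
  let W : Submodule ℂ (Mat d) := Subalgebra.toSubmodule A.toSubalgebra
  have hW : ∀ x, x ∈ W ↔ x ∈ A := fun x => Iff.rfl
  have hsep : ∀ x ∈ W, (∀ y ∈ W, B y x = 0) → x = 0 := fun x hx h => by
    have := h (star x) ((hW _).mpr (star_mem ((hW _).mp hx)))
    rw [hB, Matrix.star_eq_conjTranspose] at this
    exact Matrix.trace_conjTranspose_mul_self_eq_zero_iff.mp this
  have hnd : (B.restrict W).Nondegenerate := by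
    refine ⟨fun x h => ?_, fun x h => ?_⟩
    · refine Subtype.ext (hsep x x.2 fun y hy => ?_)
      rw [hB, Matrix.trace_mul_comm]
      exact h ⟨y, hy⟩
    · exact Subtype.ext (hsep x x.2 fun y hy => h ⟨y, hy⟩)
  have hcompl := LinearMap.BilinForm.isCompl_orthogonal_of_restrict_nondegenerate hrefl hnd
  set Q := B.orthogonal W
  have hQ : ∀ a ∈ A, ∀ q ∈ Q, a * q ∈ Q := fun a ha q hq => by
    intro y hy
    have := hq (y * a) ((hW _).mpr (mul_mem ((hW _).mp hy) ha))
    change B (y * a) q = 0 at this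
    change B y (a * q) = 0
    rwa [hB, ← mul_assoc, ← hB]
  let P : Mat d →ₗ[ℂ] Mat d := W.subtype ∘ₗ Submodule.projectionOnto W Q hcompl
  have hPW : ∀ x ∈ W, P x = x := fun x hx => by
    have := Submodule.projectionOnto_apply_left hcompl ⟨x, hx⟩
    simp only [P, LinearMap.comp_apply, Submodule.subtype_apply] 
    rw [this]
  have hPQ : ∀ x ∈ Q, P x = 0 := fun x hx => by
    have := (Submodule.projectionOnto_apply_eq_zero_iff hcompl).mpr hx
    simp only [P, LinearMap.comp_apply, this, map_zero]
  have hP : ∀ a ∈ A, ∀ x, P (a * x) = a * P x := fun a ha x => by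
    obtain ⟨w, hw, q, hq, rfl⟩ := Submodule.mem_sup.mp
      (show x ∈ W ⊔ Q by rw [hcompl.sup_eq_top]; trivial)
    rw [mul_add, map_add, map_add, hPW w hw, hPQ q hq, hPQ _ (hQ a ha q hq),
      hPW _ ((hW _).mpr (mul_mem ha ((hW _).mp hw)))]
    simp
  have hPT : P T = T * P 1 := by
    have hlin : ∀ (X : Mat d) (l i j : Fin d),
        P (X * single l l 1) i j = ∑ k, P (single k l 1) i j * X k l := fun X l i j => by
      have : X * single l l (1 : ℂ) = ∑ k, X k l • single k l (1 : ℂ) := by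
        ext r s
        simp [Matrix.sum_apply, Matrix.mul_apply, Matrix.single_apply, ite_and]
      rw [this, map_sum, Matrix.sum_apply]
      simp [mul_comm, -smul_single]
    have hcol : ∀ l, P (T * single l l 1) = T * P (single l l 1) := fun l => by
      ext i j
      -- With the columns `l` and `j` fixed, this is the matrix by which `P` sends the `l`-th column
      -- of its argument to the `j`-th column of the result; left `A`-linearity of `P` says that it
      -- commutes with `A`.
      let c : Mat d := Matrix.of fun i k => P (single k l 1) i j
      have hc : ∀ a ∈ A, c * a = a * c := fun a ha => by
        ext r s
        have h1 : a * single s l (1 : ℂ) = ∑ k, a k s • single k l (1 : ℂ) := by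
          ext r s'
          simp [Matrix.sum_apply, Matrix.mul_apply, Matrix.single_apply, ite_and]
        have h2 := congrFun₂ (hP a ha (single s l 1)) r j
        rw [h1, map_sum, Matrix.sum_apply, Matrix.mul_apply] at h2
        rw [Matrix.mul_apply, Matrix.mul_apply]
        simpa [c, mul_comm, -smul_single] using h2
      have h3 := congrFun₂ (hT c hc) i l
      rw [Matrix.mul_apply, Matrix.mul_apply] at h3
      rw [hlin, Matrix.mul_apply]
      exact h3
    have hone : (1 : Mat d) = ∑ l, single l l (1 : ℂ) := by
      ext r s
      simp [Matrix.sum_apply, Matrix.single_apply, Matrix.one_apply, ite_and]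
    have hT1 : T = ∑ l, T * single l l (1 : ℂ) := by rw [← Finset.mul_sum, ← hone, mul_one]
    conv_lhs => rw [hT1]
    rw [map_sum, hone, map_sum, Finset.mul_sum]
    exact Finset.sum_congr rfl fun l _ => hcol l
  rw [hPW 1 ((hW _).mpr (one_mem A)), mul_one] at hPT
  rw [← hW, ← hPT]
  exact Submodule.coe_mem _

/-! ### Decomposition into irreducible pieces -/

open Matrix

/-- An irreducible piece of the representation of `A` on `ℂ^d`, given by the isometry `W`. -/
structure IrrPiece {d : ℕ} (A : StarSubalgebra ℂ (Mat d)) where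
  n : ℕ
  W : Matrix (Fin d) (Fin n) ℂ
  isom : Wᴴ * W = 1
  inv : ∀ a ∈ A, a * W = W * (Wᴴ * a * W)
  irr : ∀ X : Mat n, (∀ a ∈ A, X * (Wᴴ * a * W) = (Wᴴ * a * W) * X) → ∃ z : ℂ, X = z • 1
  pos : 1 ≤ n

/-- The commutant of a self-adjoint set contains adjoints, and `X` is a combination of `X + Xᴴ` and
`i(X - Xᴴ)`, so one of the two is not scalar. -/
theorem exists_selfAdjoint_not_scalar {n : ℕ} {S : Set (Mat n)} (hS : ∀ a ∈ S, aᴴ ∈ S)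
    {X : Mat n} (hX : ∀ a ∈ S, X * a = a * X) (hns : ∀ z : ℂ, X ≠ z • 1) :
    ∃ Y : Mat n, Y.IsHermitian ∧ (∀ a ∈ S, Y * a = a * Y) ∧ ∀ z : ℂ, Y ≠ z • 1 := by
  have hXs : ∀ a ∈ S, Xᴴ * a = a * Xᴴ := fun a ha => by
    have := congrArg conjTranspose (hX _ (hS a ha))
    simpa using this.symm
  by_cases h1 : ∃ z : ℂ, X + Xᴴ = z • 1
  · refine ⟨Complex.I • (X - Xᴴ), ?_, fun a ha => ?_, fun w hw => ?_⟩
    · rw [IsHermitian, conjTranspose_smul, conjTranspose_sub, conjTranspose_conjTranspose]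
      rw [Complex.star_def, Complex.conj_I, neg_smul, ← smul_neg, neg_sub]
    · rw [smul_mul_assoc, sub_mul, hX a ha, hXs a ha, mul_smul_comm, mul_sub]
    · obtain ⟨z, hz⟩ := h1
      apply hns ((z - Complex.I * w) / 2)
      have h2 : X - Xᴴ = (-Complex.I * w) • (1 : Mat n) := by
        rw [mul_smul, ← hw, smul_smul]
        simp
      have h3 : X = (1 / 2 : ℂ) • ((X + Xᴴ) + (X - Xᴴ)) := by
        rw [add_add_sub_cancel, ← two_smul ℂ X, smul_smul]
        norm_num
      rw [h3, hz, h2, ← add_smul, smul_smul]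
      congr 1
      ring
  · refine ⟨X + Xᴴ, ?_, fun a ha => ?_, fun z hz => h1 ⟨z, hz⟩⟩
    · rw [IsHermitian, conjTranspose_add, conjTranspose_conjTranspose, add_comm]
    · rw [add_mul, mul_add, hX a ha, hXs a ha]

/-- In an eigenbasis of `Y`, the elements of `S` have no entries between different eigenvalues. The
eigenvectors for one eigenvalue and the remaining ones thus span two invariant subspaces, both
proper because `Y` is not scalar. -/
theorem exists_split_of_hermitian {n : ℕ} {S : Set (Mat n)} {Y : Mat n} (hY : Y.IsHermitian)
    (hc : ∀ a ∈ S, Y * a = a * Y) (hns : ∀ z : ℂ, Y ≠ z • 1) :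
    ∃ (n₁ n₂ : ℕ) (V₁ : Matrix (Fin n) (Fin n₁) ℂ) (V₂ : Matrix (Fin n) (Fin n₂) ℂ),
      n₁ < n ∧ n₂ < n ∧ V₁ᴴ * V₁ = 1 ∧ V₂ᴴ * V₂ = 1 ∧ V₁ * V₁ᴴ + V₂ * V₂ᴴ = 1 ∧
      (∀ a ∈ S, a * V₁ = V₁ * (V₁ᴴ * a * V₁)) ∧ (∀ a ∈ S, a * V₂ = V₂ * (V₂ᴴ * a * V₂)) := by
  classical
  set U : Mat n := hY.eigenvectorUnitary.1 with hU
  have hUU : U * Uᴴ = 1 := Unitary.coe_mul_star_self hY.eigenvectorUnitary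
  have hUU' : Uᴴ * U = 1 := Unitary.coe_star_mul_self hY.eigenvectorUnitary
  set D : Mat n := diagonal (fun i => ((hY.eigenvalues i : ℝ) : ℂ)) with hD
  have hspec : Y = U * D * Uᴴ := by
    have := hY.spectral_theorem
    rwa [Unitary.conjStarAlgAut_apply] at this
  have hentry : ∀ a ∈ S, ∀ x y, hY.eigenvalues x ≠ hY.eigenvalues y → (Uᴴ * a * U) x y = 0 := by
    intro a ha x y hxy
    have h1 : D * (Uᴴ * a * U) = (Uᴴ * a * U) * D := by
      have h2 : D = Uᴴ * Y * U := by
        rw [hspec]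
        calc D = (Uᴴ * U) * D * (Uᴴ * U) := by rw [hUU', one_mul, mul_one]
          _ = _ := by simp only [Matrix.mul_assoc]
      calc D * (Uᴴ * a * U) = Uᴴ * Y * (U * Uᴴ) * a * U := by rw [h2]; simp only [Matrix.mul_assoc]
        _ = Uᴴ * (a * Y) * U := by rw [hUU, mul_one, Matrix.mul_assoc Uᴴ, hc a ha]
        _ = Uᴴ * a * (U * Uᴴ) * Y * U := by rw [hUU, mul_one]; simp only [Matrix.mul_assoc]
        _ = _ := by rw [h2]; simp only [Matrix.mul_assoc]
    have h3 := congrFun₂ h1 x y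
    rw [hD, diagonal_mul, mul_diagonal] at h3
    have h4 : ((hY.eigenvalues x : ℂ) - hY.eigenvalues y) * (Uᴴ * a * U) x y = 0 := by
      linear_combination h3
    rcases mul_eq_zero.mp h4 with h5 | h5
    · exact absurd (by exact_mod_cast sub_eq_zero.mp h5) hxy
    · exact h5
  have key : ∀ (p : Fin n → Prop) [DecidablePred p] (m : ℕ) (e : Fin m ≃ {x // p x}),
      (∀ x y, p x → ¬ p y → hY.eigenvalues y ≠ hY.eigenvalues x) →
      (U.submatrix id (fun i => (e i : Fin n)))ᴴ * U.submatrix id (fun i => (e i : Fin n)) = 1 ∧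
      U.submatrix id (fun i => (e i : Fin n)) * (U.submatrix id (fun i => (e i : Fin n)))ᴴ =
        U * diagonal (fun x => if p x then (1 : ℂ) else 0) * Uᴴ ∧
      ∀ a ∈ S, a * U.submatrix id (fun i => (e i : Fin n)) =
        U.submatrix id (fun i => (e i : Fin n)) *
          ((U.submatrix id (fun i => (e i : Fin n)))ᴴ * a *
            U.submatrix id (fun i => (e i : Fin n))) := by
    intro p _ m e hp
    set V := U.submatrix id (fun i => (e i : Fin n)) with hV
    have hVV : V * Vᴴ = U * diagonal (fun x => if p x then (1 : ℂ) else 0) * Uᴴ := by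
      ext r s
      rw [Matrix.mul_assoc, Matrix.mul_apply, Matrix.mul_apply]
      simp only [diagonal_mul]
      rw [← Finset.sum_filter_add_sum_filter_not Finset.univ p]
      have h0 : ∑ x with ¬ p x, U r x * ((if p x then (1 : ℂ) else 0) * Uᴴ x s) = 0 := by
        refine Finset.sum_eq_zero fun x hx => ?_
        rw [if_neg (Finset.mem_filter.mp hx).2]; ring
      rw [h0, add_zero, Finset.sum_subtype (p := p) _ (fun x => by simp), ← e.sum_comp]
      refine Finset.sum_congr rfl fun i _ => ?_
      rw [if_pos (e i).2, one_mul]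
      rfl
    refine ⟨?_, hVV, fun a ha => ?_⟩
    · ext i j
      have h1 := congrFun₂ hUU' (e i) (e j)
      have h2 : (Vᴴ * V) i j = (Uᴴ * U) (e i) (e j) := rfl
      rw [h2, h1, Matrix.one_apply, Matrix.one_apply]
      simp [Subtype.val_inj]
    · have h1 : V * (Vᴴ * a * V) = U * (diagonal (fun x => if p x then (1 : ℂ) else 0) *
          (Uᴴ * a * U)).submatrix id (fun i => (e i : Fin n)) := by
        rw [Matrix.mul_assoc, ← Matrix.mul_assoc V, hVV]
        simp only [Matrix.mul_assoc]
        rfl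
      have h2 : a * V = U * (Uᴴ * a * U).submatrix id (fun i => (e i : Fin n)) := by
        have : U * (Uᴴ * a * U).submatrix id (fun i => (e i : Fin n)) = U * (Uᴴ * (a * V)) := by
          rw [Matrix.mul_assoc]; rfl
        rw [this, ← Matrix.mul_assoc, hUU, Matrix.one_mul]
      rw [h1, h2]
      congr 1
      ext x i
      simp only [submatrix_apply, id, diagonal_mul]
      split_ifs with hx
      · rw [one_mul]
      · rw [zero_mul, hentry a ha x (e i) (hp _ _ (e i).2 hx)]
  obtain ⟨x₀, y₀, hxy⟩ : ∃ x y, hY.eigenvalues x ≠ hY.eigenvalues y := by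
    by_contra! hcon
    rcases Nat.eq_zero_or_pos n with h0 | h0
    · subst h0
      exact hns 0 (Subsingleton.elim _ _)
    · apply hns (hY.eigenvalues ⟨0, h0⟩)
      have : D = ((hY.eigenvalues ⟨0, h0⟩ : ℝ) : ℂ) • (1 : Mat n) := by
        rw [hD, smul_one_eq_diagonal]
        congr 1
        funext i
        rw [hcon i ⟨0, h0⟩]
      conv_lhs => rw [hspec, this]
      rw [mul_smul_comm, smul_mul_assoc, mul_one, hUU]
  let p : Fin n → Prop := fun x => hY.eigenvalues x = hY.eigenvalues x₀
  have k1 := key p _ (Fintype.equivFin _).symm (fun x y hx hy h => hy (h.trans hx))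
  have k2 := key (fun x => ¬ p x) _ (Fintype.equivFin _).symm (fun x y hx hy h => by
    exact hx (h.symm.trans (not_not.mp hy)))
  refine ⟨_, _, _, _, ?_, ?_, k1.1, k2.1, ?_, k1.2.2, k2.2.2⟩
  · have := Fintype.card_subtype_lt (p := p) (x := y₀) (fun h => hxy h.symm)
    simpa using this
  · have := Fintype.card_subtype_lt (p := fun x => ¬ p x) (x := x₀) (fun h => h rfl)
    simpa using this
  · rw [k1.2.1, k2.2.1, ← Matrix.add_mul, ← Matrix.mul_add, diagonal_add]
    have : (fun x => (if p x then (1 : ℂ) else 0) + if ¬ p x then (1 : ℂ) else 0) = fun _ => 1 := by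
      funext x; by_cases h : p x <;> simp [h]
    rw [this, diagonal_one, mul_one, hUU]

/-- Complete reducibility, by induction on the dimension: a nonscalar operator commuting with the
compressed representation yields a hermitian one, whose eigenspaces split the subspace. -/
theorem exists_irrPieces_of_isometry {d : ℕ} (A : StarSubalgebra ℂ (Mat d)) (n : ℕ) :
    ∀ W : Matrix (Fin d) (Fin n) ℂ, Wᴴ * W = 1 → (∀ a ∈ A, a * W = W * (Wᴴ * a * W)) →
      ∃ l : List (IrrPiece A), (l.map fun p => p.W * p.Wᴴ).sum = W * Wᴴ := by
  induction n using Nat.strong_induction_on with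
  | _ n ih =>
    intro W hW hinv
    rcases Nat.eq_zero_or_pos n with h0 | h0
    · subst h0
      refine ⟨[], ?_⟩
      ext i j
      simp [Matrix.mul_apply]
    by_cases hirr : ∀ X : Mat n, (∀ a ∈ A, X * (Wᴴ * a * W) = (Wᴴ * a * W) * X) →
        ∃ z : ℂ, X = z • 1
    · exact ⟨[⟨n, W, hW, hinv, hirr, h0⟩], by simp⟩
    push Not at hirr
    obtain ⟨X, hX, hns⟩ := hirr
    let S : Set (Mat n) := (fun a : Mat d => Wᴴ * a * W) '' A
    have hS : ∀ a ∈ S, aᴴ ∈ S := by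
      rintro _ ⟨a, ha, rfl⟩
      refine ⟨aᴴ, star_mem (S := StarSubalgebra ℂ (Mat d)) ha, ?_⟩
      simp [Matrix.mul_assoc]
    obtain ⟨Y, hY, hYc, hYns⟩ := exists_selfAdjoint_not_scalar hS
      (by rintro _ ⟨a, ha, rfl⟩; exact hX a ha) hns
    obtain ⟨n₁, n₂, V₁, V₂, h1, h2, hV1, hV2, hsum, hi1, hi2⟩ :=
      exists_split_of_hermitian hY hYc hYns
    have step : ∀ (m : ℕ) (V : Matrix (Fin n) (Fin m) ℂ), Vᴴ * V = 1 →
        (∀ a ∈ S, a * V = V * (Vᴴ * a * V)) → m < n →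
        ∃ l : List (IrrPiece A), (l.map fun p => p.W * p.Wᴴ).sum = (W * V) * (W * V)ᴴ := by
      intro m V hV hi hm
      refine ih m hm (W * V) ?_ fun a ha => ?_
      · rw [conjTranspose_mul, Matrix.mul_assoc, ← Matrix.mul_assoc Wᴴ, hW, Matrix.one_mul, hV]
      · have h3 := hi _ ⟨a, ha, rfl⟩
        calc a * (W * V) = W * ((Wᴴ * a * W) * V) := by
              rw [← Matrix.mul_assoc, hinv a ha, Matrix.mul_assoc]
          _ = W * (V * (Vᴴ * (Wᴴ * a * W) * V)) := by rw [h3]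
          _ = _ := by rw [conjTranspose_mul]; simp only [Matrix.mul_assoc]
    obtain ⟨l₁, hl₁⟩ := step n₁ V₁ hV1 hi1 h1
    obtain ⟨l₂, hl₂⟩ := step n₂ V₂ hV2 hi2 h2
    refine ⟨l₁ ++ l₂, ?_⟩
    rw [List.map_append, List.sum_append, hl₁, hl₂, conjTranspose_mul, conjTranspose_mul]
    calc W * V₁ * (V₁ᴴ * Wᴴ) + W * V₂ * (V₂ᴴ * Wᴴ) = W * (V₁ * V₁ᴴ + V₂ * V₂ᴴ) * Wᴴ := by
          rw [Matrix.mul_add, Matrix.add_mul]; simp only [Matrix.mul_assoc]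
      _ = W * Wᴴ := by rw [hsum, Matrix.mul_one]

theorem exists_irrPieces {d : ℕ} (A : StarSubalgebra ℂ (Mat d)) :
    ∃ l : List (IrrPiece A), (l.map fun p => p.W * p.Wᴴ).sum = 1 := by
  simpa using exists_irrPieces_of_isometry A d 1 (by simp) (by simp)

/-! ### Blocks with respect to a type -/

namespace BlockType

variable {d : ℕ} (t : BlockType d)

/-- The block of `c` in the row of the `i`-th copy of the `j`-th summand and the column of the
`i'`-th copy of the `j'`-th summand. -/
def block (c : Mat d) (j : Fin t.L) (i : Fin (t.mult j)) (j' : Fin t.L) (i' : Fin (t.mult j')) :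
    Matrix (Fin (t.size j)) (Fin (t.size j')) ℂ :=
  Matrix.of fun x x' => c (t.index ⟨j, (x, i)⟩) (t.index ⟨j', (x', i')⟩)

theorem ext_block {c c' : Mat d} (h : ∀ j i j' i', t.block c j i j' i' = t.block c' j i j' i') :
    c = c' := by
  ext r s
  obtain ⟨⟨j, x, i⟩, rfl⟩ := t.index.surjective r
  obtain ⟨⟨j', x', i'⟩, rfl⟩ := t.index.surjective s
  exact congrFun₂ (h j i j' i') x x'

theorem blockMatrix_index (b : ∀ j : Fin t.L, Mat (t.size j))
    (p q : Σ j : Fin t.L, Fin (t.size j) × Fin (t.mult j)) :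
    t.blockMatrix b (t.index p) (t.index q) =
      Matrix.blockDiagonal' (fun j => Matrix.blockDiagonal fun _ : Fin (t.mult j) => b j) p q := by
  simp [blockMatrix]

theorem block_blockMatrix_self (b : ∀ j : Fin t.L, Mat (t.size j)) (j : Fin t.L)
    (i : Fin (t.mult j)) : t.block (t.blockMatrix b) j i j i = b j := by
  ext x x'
  simp [block, blockMatrix_index, blockDiagonal'_apply_eq, blockDiagonal_apply]

theorem block_blockMatrix_of_ne (b : ∀ j : Fin t.L, Mat (t.size j)) {j j' : Fin t.L}
    (h : j ≠ j') (i : Fin (t.mult j)) (i' : Fin (t.mult j')) :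
    t.block (t.blockMatrix b) j i j' i' = 0 := by
  ext x x'
  simp [block, blockMatrix_index, blockDiagonal'_apply_ne _ _ _ h]

theorem block_blockMatrix_of_ne_copy (b : ∀ j : Fin t.L, Mat (t.size j)) {j : Fin t.L}
    {i i' : Fin (t.mult j)} (h : i ≠ i') : t.block (t.blockMatrix b) j i j i' = 0 := by
  ext x x'
  simp [block, blockMatrix_index, blockDiagonal'_apply_eq, blockDiagonal_apply, h]

theorem sum_index {M : Type*} [AddCommMonoid M] (F : Fin d → M) :
    ∑ r, F r = ∑ j, ∑ i : Fin (t.mult j), ∑ x : Fin (t.size j), F (t.index ⟨j, (x, i)⟩) := by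
  rw [← t.index.sum_comp, Fintype.sum_sigma]
  refine Finset.sum_congr rfl fun j _ => ?_
  rw [Fintype.sum_prod_type, Finset.sum_comm]

theorem block_mul (c c' : Mat d) (j : Fin t.L) (i : Fin (t.mult j)) (j' : Fin t.L)
    (i' : Fin (t.mult j')) :
    t.block (c * c') j i j' i' = ∑ k, ∑ l, t.block c j i k l * t.block c' k l j' i' := by
  ext x x'
  simp only [block, of_apply, Matrix.mul_apply, sum_index t, Matrix.sum_apply]

theorem block_mul_blockMatrix (c : Mat d) (b : ∀ j : Fin t.L, Mat (t.size j)) (j : Fin t.L)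
    (i : Fin (t.mult j)) (j' : Fin t.L) (i' : Fin (t.mult j')) :
    t.block (c * t.blockMatrix b) j i j' i' = t.block c j i j' i' * b j' := by
  rw [block_mul, Finset.sum_eq_single j', Finset.sum_eq_single i', block_blockMatrix_self]
  · intro l _ hl
    rw [block_blockMatrix_of_ne_copy _ _ hl, Matrix.mul_zero]
  · simp
  · intro k _ hk
    exact Finset.sum_eq_zero fun l _ => by rw [block_blockMatrix_of_ne _ _ hk, Matrix.mul_zero]
  · simp

theorem blockMatrix_mul_block (c : Mat d) (b : ∀ j : Fin t.L, Mat (t.size j)) (j : Fin t.L)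
    (i : Fin (t.mult j)) (j' : Fin t.L) (i' : Fin (t.mult j')) :
    t.block (t.blockMatrix b * c) j i j' i' = b j * t.block c j i j' i' := by
  rw [block_mul, Finset.sum_eq_single j, Finset.sum_eq_single i, block_blockMatrix_self]
  · intro l _ hl
    rw [block_blockMatrix_of_ne_copy _ _ hl.symm, Matrix.zero_mul]
  · simp
  · intro k _ hk
    exact Finset.sum_eq_zero fun l _ => by rw [block_blockMatrix_of_ne _ _ hk.symm, Matrix.zero_mul]
  · simp

theorem blockMatrix_injective : Function.Injective t.blockMatrix := by
  intro b b' h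
  funext j
  have i : Fin (t.mult j) := ⟨0, t.mult_pos j⟩
  rw [← t.block_blockMatrix_self b j i, h, block_blockMatrix_self]

/-- If a family of elements of `⊕ M_{d_j}` has only scalar self-intertwiners and no nonzero
intertwiners between different summands, then everything that commutes with the family commutes
with the whole block algebra. -/
theorem commute_blockMatrix {α : Type*} (f : α → ∀ j : Fin t.L, Mat (t.size j))
    (hself : ∀ j (X : Mat (t.size j)), (∀ a, f a j * X = X * f a j) → ∃ z : ℂ, X = z • 1)
    (hne : ∀ j j', j ≠ j' → ∀ X : Matrix (Fin (t.size j)) (Fin (t.size j')) ℂ,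
      (∀ a, f a j * X = X * f a j') → X = 0)
    {c : Mat d} (hc : ∀ a, c * t.blockMatrix (f a) = t.blockMatrix (f a) * c)
    (b : ∀ j : Fin t.L, Mat (t.size j)) : c * t.blockMatrix b = t.blockMatrix b * c := by
  refine t.ext_block fun j i j' i' => ?_
  rw [block_mul_blockMatrix, blockMatrix_mul_block]
  have h : ∀ a, f a j * t.block c j i j' i' = t.block c j i j' i' * f a j' := fun a => by
    rw [← block_mul_blockMatrix, ← blockMatrix_mul_block, hc]
  by_cases hj : j = j'
  · subst hj
    obtain ⟨z, hz⟩ := hself j _ h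
    rw [hz]
    simp
  · rw [hne j j' hj _ h]
    simp

theorem blockMatrix_mem (b : ∀ j : Fin t.L, Mat (t.size j)) : t.blockMatrix b ∈ t.algebra :=
  ⟨b, rfl⟩

end BlockType

/-! ### Every sub-C*-algebra is unitarily equivalent to a block algebra -/

namespace IrrPiece

variable {d : ℕ} {A : StarSubalgebra ℂ (Mat d)}

/-- The representation on an irreducible piece. -/
def rep (p : IrrPiece A) (a : Mat d) : Mat p.n := p.Wᴴ * a * p.W

theorem rep_conjTranspose (p : IrrPiece A) (a : Mat d) : p.rep aᴴ = (p.rep a)ᴴ := by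
  simp [rep, Matrix.mul_assoc]

/-- Unitary equivalence of irreducible pieces. -/
def Equiv (p q : IrrPiece A) : Prop :=
  ∃ Y : Matrix (Fin p.n) (Fin q.n) ℂ, Yᴴ * Y = 1 ∧ Y * Yᴴ = 1 ∧ ∀ a ∈ A, p.rep a * Y = Y * q.rep a

theorem equivalence : Equivalence (Equiv (A := A)) where
  refl p := ⟨1, by simp, by simp, by simp⟩
  symm := by
    rintro p q ⟨Y, h1, h2, h3⟩
    refine ⟨Yᴴ, by simpa using h2, by simpa using h1, fun a ha => ?_⟩
    have := congrArg conjTranspose (h3 _ (star_mem (S := StarSubalgebra ℂ (Mat d)) ha))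
    rw [star_eq_conjTranspose] at this
    simpa [rep_conjTranspose] using this.symm
  trans := by
    rintro p q r ⟨Y, h1, h2, h3⟩ ⟨Z, k1, k2, k3⟩
    refine ⟨Y * Z, ?_, ?_, fun a ha => ?_⟩
    · rw [conjTranspose_mul, Matrix.mul_assoc, ← Matrix.mul_assoc Yᴴ, h1, Matrix.one_mul, k1]
    · rw [conjTranspose_mul, Matrix.mul_assoc, ← Matrix.mul_assoc Z, k2, Matrix.one_mul, h2]
    · rw [← Matrix.mul_assoc, h3 a ha, Matrix.mul_assoc, k3 a ha, Matrix.mul_assoc]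

open ComplexOrder in
-- Schur's lemma: `Xᴴ X` and `X Xᴴ` are self-intertwiners, hence scalar. The two scalars agree and
-- are positive, say `r²`, so `r⁻¹ X` is unitary.
theorem equiv_of_intertwiner {p q : IrrPiece A} {X : Matrix (Fin p.n) (Fin q.n) ℂ} (hX : X ≠ 0)
    (h : ∀ a ∈ A, p.rep a * X = X * q.rep a) : p.Equiv q := by
  have h' : ∀ a ∈ A, q.rep a * Xᴴ = Xᴴ * p.rep a := fun a ha => by
    have := congrArg conjTranspose (h _ (star_mem (S := StarSubalgebra ℂ (Mat d)) ha))
    rw [star_eq_conjTranspose] at this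
    simpa [rep_conjTranspose] using this.symm
  obtain ⟨z, hz⟩ := q.irr (Xᴴ * X) fun a ha => by
    change Xᴴ * X * q.rep a = q.rep a * (Xᴴ * X)
    rw [Matrix.mul_assoc, ← h a ha, ← Matrix.mul_assoc, ← h' a ha, Matrix.mul_assoc]
  obtain ⟨w, hw⟩ := p.irr (X * Xᴴ) fun a ha => by
    change X * Xᴴ * p.rep a = p.rep a * (X * Xᴴ)
    rw [Matrix.mul_assoc, ← h' a ha, ← Matrix.mul_assoc, ← h a ha, Matrix.mul_assoc]
  have hzw : w = z := by
    have h1 : w • X = z • X := by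
      calc w • X = (X * Xᴴ) * X := by rw [hw]; simp
        _ = X * (Xᴴ * X) := Matrix.mul_assoc _ _ _
        _ = z • X := by rw [hz]; simp
    by_contra hne
    have h2 : (w - z) • X = 0 := by rw [sub_smul, h1, sub_self]
    exact (smul_eq_zero.mp h2).elim (sub_ne_zero.mpr hne) hX
  subst hzw
  have hz0 : w ≠ 0 := by
    rintro rfl
    apply hX
    rw [zero_smul] at hz
    exact conjTranspose_mul_self_eq_zero.mp hz
  have hpos : 0 ≤ w := by
    have h1 := (posSemidef_conjTranspose_mul_self X).diag_nonneg (i := ⟨0, q.pos⟩)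
    rw [hz] at h1
    simpa using h1
  obtain ⟨r, hr, hrw⟩ : ∃ r : ℝ, r ≠ 0 ∧ w = (r : ℂ) * r := by
    have hre : w = (w.re : ℂ) := by
      apply Complex.ext
      · simp
      · simpa using (Complex.le_def.mp hpos).2.symm
    have hre0 : 0 ≤ w.re := (Complex.le_def.mp hpos).1
    refine ⟨Real.sqrt w.re, fun h0 => hz0 ?_, ?_⟩
    · rw [hre, (Real.sqrt_eq_zero hre0).mp h0]; simp
    · rw [← Complex.ofReal_mul, Real.mul_self_sqrt hre0, ← hre]
  have hr' : (r : ℂ) ≠ 0 := by exact_mod_cast hr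
  refine ⟨(r : ℂ)⁻¹ • X, ?_, ?_, fun a ha => ?_⟩
  · rw [conjTranspose_smul, Matrix.smul_mul, Matrix.mul_smul, hz, hrw, smul_smul, smul_smul]
    have h1 : (r : ℂ)⁻¹ * (r : ℂ)⁻¹ * (r * r) = 1 := by field_simp
    simp [h1]
  · rw [conjTranspose_smul, Matrix.smul_mul, Matrix.mul_smul, hw, hrw, smul_smul, smul_smul]
    have h1 : (r : ℂ)⁻¹ * (r : ℂ)⁻¹ * (r * r) = 1 := by field_simp
    simp [h1]
  · rw [Matrix.mul_smul, h a ha, Matrix.smul_mul]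

end IrrPiece

/-- The structure theorem, in coordinates. -/
theorem exists_blockType_of_irrPieces {d : ℕ} {A : StarSubalgebra ℂ (Mat d)}
    (l : List (IrrPiece A)) (hl : (l.map fun p => p.W * p.Wᴴ).sum = 1) (hd : 1 ≤ d) :
    ∃ (t : BlockType d) (u : Mat d) (f : Mat d → ∀ j : Fin t.L, Mat (t.size j)),
      u * uᴴ = 1 ∧ (∀ a ∈ A, a * u = u * t.blockMatrix (f a)) ∧
      (∀ j (X : Mat (t.size j)), (∀ a : A, f a j * X = X * f a j) → ∃ z : ℂ, X = z • 1) ∧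
      (∀ j j', j ≠ j' → ∀ X : Matrix (Fin (t.size j)) (Fin (t.size j')) ℂ,
        (∀ a : A, f a j * X = X * f a j') → X = 0) := by
  classical
  let ι := Fin l.length
  let P : ι → IrrPiece A := fun i => l.get i
  have hP : ∑ i, (P i).W * (P i).Wᴴ = 1 := by
    rw [← hl, ← List.sum_ofFn]
    congr 1
    apply List.ext_get <;> simp [P]
  let S : Setoid ι := ⟨fun i j => (P i).Equiv (P j), 
    ⟨fun _ => IrrPiece.equivalence.refl _, fun h => IrrPiece.equivalence.symm h,
      fun h k => IrrPiece.equivalence.trans h k⟩⟩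
  let Q := Quotient S
  let e : Fin (Fintype.card Q) ≃ Q := (Fintype.equivFin Q).symm
  let rp : Fin (Fintype.card Q) → ι := fun j => (e j).out
  let g : ∀ j, Fin (Fintype.card {i : ι // (⟦i⟧ : Q) = e j}) ≃ {i : ι // (⟦i⟧ : Q) = e j} :=
    fun j => (Fintype.equivFin _).symm
  have hY : ∀ j i, (P (g j i)).Equiv (P (rp j)) := fun j i => by
    have h1 : (⟦((g j i : ι))⟧ : Q) = ⟦rp j⟧ := by
      rw [(g j i).2]; exact ((e j).out_eq).symm
    exact Quotient.exact h1
  choose Y hY1 hY2 hY3 using hY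
  -- Composing with `Y` makes all pieces in one class carry literally the same representation, that
  -- of the representative `rp j`. This is what makes the repeated blocks equal.
  let WW : ∀ j (_ : Fin (Fintype.card {i : ι // (⟦i⟧ : Q) = e j})),
      Matrix (Fin d) (Fin (P (rp j)).n) ℂ := fun j i => (P (g j i)).W * Y j i
  have hWW1 : ∀ j i, (WW j i)ᴴ * WW j i = 1 := fun j i => by
    simp only [WW]
    rw [conjTranspose_mul, Matrix.mul_assoc, ← Matrix.mul_assoc (P (g j i)).Wᴴ, (P _).isom,
      Matrix.one_mul, hY1]
  have hWW2 : ∀ j i, WW j i * (WW j i)ᴴ = (P (g j i)).W * (P (g j i)).Wᴴ := fun j i => by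
    simp only [WW]
    rw [conjTranspose_mul, Matrix.mul_assoc, ← Matrix.mul_assoc (Y j i), hY2, Matrix.one_mul]
  have hWW3 : ∀ j i, ∀ a ∈ A, a * WW j i = WW j i * (P (rp j)).rep a := fun j i a ha => by
    simp only [WW]
    rw [← Matrix.mul_assoc, (P (g j i)).inv a ha, Matrix.mul_assoc,
      Matrix.mul_assoc (P (g j i)).W, ← hY3 j i a ha]
    rfl
  have hWW : ∑ j, ∑ i, WW j i * (WW j i)ᴴ = 1 := by
    rw [← hP, ← Fintype.sum_fiberwise (fun i : ι => (⟦i⟧ : Q)), ← e.sum_comp]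
    refine Finset.sum_congr rfl fun j _ => ?_
    rw [← (g j).sum_comp]
    exact Finset.sum_congr rfl fun i _ => hWW2 j i
  let t : BlockType d :=
    { L := Fintype.card Q
      size := fun j => (P (rp j)).n
      mult := fun j => Fintype.card {i : ι // (⟦i⟧ : Q) = e j}
      L_pos := by
        by_contra! h0
        have : IsEmpty (Fin (Fintype.card Q)) := ⟨fun x => by have := x.2; omega⟩
        rw [Finset.univ_eq_empty, Finset.sum_empty] at hWW
        have := congrFun₂ hWW ⟨0, hd⟩ ⟨0, hd⟩
        simp at this
      size_pos := fun j => (P (rp j)).pos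
      mult_pos := fun j => Fintype.card_pos_iff.mpr ⟨⟨(e j).out, (e j).out_eq⟩⟩
      sum_eq := by
        -- Each range projection has trace the size of its block, and together they add up to the
        -- identity.
        have h1 := congrArg trace hWW
        simp only [trace_sum, trace_one, Fintype.card_fin] at h1
        have h2 : ∀ j i, (WW j i * (WW j i)ᴴ).trace = ((P (rp j)).n : ℂ) := fun j i => by
          rw [trace_mul_comm, hWW1, trace_one, Fintype.card_fin]
        simp only [h2, Finset.sum_const, Finset.card_univ, Fintype.card_fin, nsmul_eq_mul] at h1
        exact_mod_cast h1 }
  let u : Mat d := Matrix.of fun r k =>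
    WW (t.index.symm k).1 (t.index.symm k).2.2 r (t.index.symm k).2.1
  have hu : ∀ r j x i, u r (t.index ⟨j, (x, i)⟩) = WW j i r x := fun r j x i => by
    simp only [u, of_apply]
    rw [Equiv.symm_apply_apply]
  refine ⟨t, u, fun a j => (P (rp j)).rep a, ?_, fun a ha => ?_, fun j X hX => ?_,
    fun j j' hj X hX => ?_⟩
  · ext r s
    rw [← hWW, Matrix.mul_apply, t.sum_index]
    simp only [Matrix.sum_apply]
    refine Finset.sum_congr rfl fun j _ => Finset.sum_congr rfl fun i _ => ?_
    rw [Matrix.mul_apply]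
    refine Finset.sum_congr rfl fun x _ => ?_
    simp only [conjTranspose_apply, hu]
  · ext r k
    obtain ⟨⟨j, x, i⟩, rfl⟩ := t.index.surjective k
    have h1 := congrFun₂ (hWW3 j i a ha) r x
    rw [Matrix.mul_apply] at h1
    rw [Matrix.mul_apply]
    simp only [hu]
    rw [h1, Matrix.mul_apply, Matrix.mul_apply, t.sum_index, Finset.sum_eq_single j,
      Finset.sum_eq_single i]
    · refine Finset.sum_congr rfl fun y _ => ?_
      rw [hu]
      congr 1
      exact (congrFun₂ (t.block_blockMatrix_self (fun j => (P (rp j)).rep a) j i) y x).symm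
    · intro i' _ hi'
      refine Finset.sum_eq_zero fun y _ => ?_
      have := congrFun₂ (t.block_blockMatrix_of_ne_copy (fun j => (P (rp j)).rep a) hi') y x
      simp only [BlockType.block, of_apply] at this
      rw [this]; simp
    · simp
    · intro j' _ hj'
      refine Finset.sum_eq_zero fun i' _ => Finset.sum_eq_zero fun y _ => ?_
      have := congrFun₂ (t.block_blockMatrix_of_ne (fun j => (P (rp j)).rep a) hj' i' i) y x
      simp only [BlockType.block, of_apply] at this
      rw [this]; simp
    · simp
  · exact (P (rp j)).irr X fun a ha => (hX ⟨a, ha⟩).symm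
  · by_contra hX0
    have h1 : (P (rp j)).Equiv (P (rp j')) :=
      IrrPiece.equiv_of_intertwiner hX0 fun a ha => hX ⟨a, ha⟩
    have h2 : (⟦rp j⟧ : Q) = ⟦rp j'⟧ := Quotient.sound h1
    apply hj
    apply e.injective
    rw [← (e j).out_eq, ← (e j').out_eq]
    exact h2

/-- Every unital sub-C*-algebra of `M_d` is unitarily equivalent to a block algebra. -/
theorem exists_unitarilyConj_algebra {d : ℕ} (hd : 1 ≤ d) (A : StarSubalgebra ℂ (Mat d)) :
    ∃ t : BlockType d, UnitarilyConj A t.algebra := by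
  obtain ⟨l, hl⟩ := exists_irrPieces A
  obtain ⟨t, u, f, hu, hf, hself, hne⟩ := exists_blockType_of_irrPieces l hl hd
  have hu' : uᴴ * u = 1 := mul_eq_one_comm.mp hu
  refine ⟨t, ⟨u, mem_unitaryGroup_iff.mpr hu⟩, ?_⟩
  ext x
  constructor
  · intro hx
    refine ⟨t.blockMatrix (f x), t.blockMatrix_mem _, ?_⟩
    change u * t.blockMatrix (f x) * uᴴ = x
    rw [← hf x hx, Matrix.mul_assoc, hu, mul_one]
  · rintro ⟨_, ⟨b, rfl⟩, rfl⟩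
    change u * t.blockMatrix b * uᴴ ∈ A
    -- By the double commutant theorem it suffices that whatever commutes with `A` commutes with the
    -- conjugated block matrix; after moving back by `u`, the intertwiner conditions of the blocks
    -- give this.
    refine A.mem_of_commute_commutant fun c hc => ?_
    have h1 : ∀ a : A, (uᴴ * c * u) * t.blockMatrix (f a) = t.blockMatrix (f a) * (uᴴ * c * u) := by
      intro a
      have h2 : t.blockMatrix (f a) = uᴴ * a * u := by
        rw [Matrix.mul_assoc, hf a a.2, ← Matrix.mul_assoc, hu', one_mul]
      rw [h2]
      calc uᴴ * c * u * (uᴴ * a * u) = uᴴ * c * (u * uᴴ) * a * u := by simp only [Matrix.mul_assoc]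
        _ = uᴴ * (c * a) * u := by rw [hu, mul_one, Matrix.mul_assoc uᴴ c]
        _ = uᴴ * a * (u * uᴴ) * c * u := by rw [hc a a.2, hu, mul_one]; simp only [Matrix.mul_assoc]
        _ = _ := by simp only [Matrix.mul_assoc]
    have h3 := t.commute_blockMatrix (fun a : A => f a) hself hne h1 b
    calc c * (u * t.blockMatrix b * uᴴ)
        = (u * uᴴ) * c * u * t.blockMatrix b * uᴴ := by rw [hu, one_mul]; simp only [Matrix.mul_assoc]
      _ = u * (uᴴ * c * u * t.blockMatrix b) * uᴴ := by simp only [Matrix.mul_assoc]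
      _ = u * t.blockMatrix b * uᴴ * c * (u * uᴴ) := by rw [h3]; simp only [Matrix.mul_assoc]
      _ = u * t.blockMatrix b * uᴴ * c := by rw [hu, mul_one]

/-! ### The sub-C*-algebra generated by a tuple -/

namespace SATuple

variable {d n : ℕ}

/-- Subspaces of `M_d` are closed, so the closure adds nothing, and the entries are self-adjoint, so
adjoints add nothing either. -/
theorem mem_unitalCstar {a : SATuple d n} {x : Mat d} :
    x ∈ unitalCstar a ↔ x ∈ Algebra.adjoin ℂ (entries a) := by
  have hclosed : IsClosed (StarAlgebra.adjoin ℂ (entries a) : Set (Mat d)) :=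
    Submodule.closed_of_finiteDimensional
      (Subalgebra.toSubmodule (StarAlgebra.adjoin ℂ (entries a)).toSubalgebra)
  have hstar : star (entries a) = entries a := by
    ext x
    rw [Set.mem_star]
    constructor
    · rintro ⟨i, hi⟩
      refine ⟨i, ?_⟩
      have h1 := congrArg star hi
      rw [star_star] at h1
      rw [← h1]
      exact (a i).2.symm
    · rintro ⟨i, rfl⟩
      exact ⟨i, (a i).2.symm⟩
  have h1 : x ∈ unitalCstar a ↔ x ∈ StarAlgebra.adjoin ℂ (entries a) := by
    rw [← SetLike.mem_coe, unitalCstar, StarSubalgebra.topologicalClosure_coe,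
      hclosed.closure_eq, SetLike.mem_coe]
  rw [h1, ← StarSubalgebra.mem_toSubalgebra, StarAlgebra.adjoin_toSubalgebra, hstar,
    Set.union_self]

theorem apply_mem_unitalCstar (a : SATuple d n) (i : Fin (n + 1)) :
    (a i : Mat d) ∈ unitalCstar a :=
  mem_unitalCstar.mpr (Algebra.subset_adjoin ⟨i, rfl⟩)

theorem unitalCstar_le_iff {a : SATuple d n} {A : StarSubalgebra ℂ (Mat d)} :
    unitalCstar a ≤ A ↔ ∀ i, (a i : Mat d) ∈ A := by
  refine ⟨fun h i => h (apply_mem_unitalCstar a i), fun h x hx => ?_⟩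
  have h1 : Algebra.adjoin ℂ (entries a) ≤ A.toSubalgebra := by
    rw [Algebra.adjoin_le_iff]
    rintro _ ⟨i, rfl⟩
    exact h i
  exact h1 (mem_unitalCstar.mp hx)

theorem commute_unitalCstar {a : SATuple d n} {c : Mat d} (h : ∀ i, c * (a i : Mat d) = a i * c)
    {x : Mat d} (hx : x ∈ unitalCstar a) : c * x = x * c := by
  have h1 : Algebra.adjoin ℂ (entries a) ≤ Subalgebra.centralizer ℂ {c} := by
    rw [Algebra.adjoin_le_iff]
    rintro _ ⟨i, rfl⟩
    rw [SetLike.mem_coe, Subalgebra.mem_centralizer_iff]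
    rintro _ rfl
    exact h i
  exact (Subalgebra.mem_centralizer_iff ℂ).mp (h1 (mem_unitalCstar.mp hx)) c rfl

end SATuple

/-! ### Conjugation by unitaries -/

section conj

variable {d : ℕ} (u : Matrix.unitaryGroup (Fin d) ℂ)

theorem coe_mul_conjTranspose_self : (u : Mat d) * (u : Mat d)ᴴ = 1 := Unitary.coe_mul_star_self u

theorem conjTranspose_coe_mul_self : (u : Mat d)ᴴ * (u : Mat d) = 1 := Unitary.coe_star_mul_self u

theorem conj_mul_conj (x y : Mat d) :
    (u * x * (u : Mat d)ᴴ) * (u * y * (u : Mat d)ᴴ) = u * (x * y) * (u : Mat d)ᴴ := by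
  calc _ = u * x * ((u : Mat d)ᴴ * u) * y * (u : Mat d)ᴴ := by simp only [Matrix.mul_assoc]
    _ = _ := by rw [conjTranspose_coe_mul_self, mul_one]; simp only [Matrix.mul_assoc]

theorem conjTranspose_conj_conj (x : Mat d) :
    (u : Mat d)ᴴ * (u * x * (u : Mat d)ᴴ) * u = x := by
  calc _ = ((u : Mat d)ᴴ * u) * x * ((u : Mat d)ᴴ * u) := by simp only [Matrix.mul_assoc]
    _ = x := by rw [conjTranspose_coe_mul_self, mul_one, one_mul]

theorem conj_conjTranspose_conj (x : Mat d) :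
    (u : Mat d) * ((u : Mat d)ᴴ * x * u) * (u : Mat d)ᴴ = x := by
  calc _ = ((u : Mat d) * (u : Mat d)ᴴ) * x * ((u : Mat d) * (u : Mat d)ᴴ) := by
        simp only [Matrix.mul_assoc]
    _ = x := by rw [coe_mul_conjTranspose_self, mul_one, one_mul]

theorem coe_inv_unitary : ((u⁻¹ : Matrix.unitaryGroup (Fin d) ℂ) : Mat d) = (u : Mat d)ᴴ := rfl

theorem coe_conjSA (x : selfAdjoint (Mat d)) :
    (conjSA u x : Mat d) = u * x * (u : Mat d)ᴴ := rfl

end conj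

theorem unitarilyConj_iff {d : ℕ} {A B : StarSubalgebra ℂ (Mat d)} :
    UnitarilyConj A B ↔ ∃ u : Matrix.unitaryGroup (Fin d) ℂ,
      ∀ x : Mat d, u * x * (u : Mat d)ᴴ ∈ A ↔ x ∈ B := by
  refine exists_congr fun u => ?_
  rw [Set.ext_iff]
  constructor
  · intro h x
    rw [← SetLike.mem_coe, h]
    constructor
    · rintro ⟨y, hy, hyx⟩
      have h1 := congrArg (fun z => (u : Mat d)ᴴ * z * u) hyx
      simp only [star_eq_conjTranspose, conjTranspose_conj_conj] at h1
      rw [← h1]; exact hy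
    · intro hx
      exact ⟨x, hx, rfl⟩
  · intro h x
    constructor
    · intro hx
      refine ⟨(u : Mat d)ᴴ * x * u, ?_, conj_conjTranspose_conj u x⟩
      rw [SetLike.mem_coe, ← h, conj_conjTranspose_conj]
      exact hx
    · rintro ⟨y, hy, rfl⟩
      exact (h y).mpr hy

theorem UnitarilyConj.symm {d : ℕ} {A B : StarSubalgebra ℂ (Mat d)} (h : UnitarilyConj A B) :
    UnitarilyConj B A := by
  rw [unitarilyConj_iff] at h ⊢
  obtain ⟨u, hu⟩ := h
  refine ⟨u⁻¹, fun x => ?_⟩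
  rw [coe_inv_unitary, conjTranspose_conjTranspose, ← hu, conj_conjTranspose_conj]

theorem UnitarilyConj.trans {d : ℕ} {A B C : StarSubalgebra ℂ (Mat d)} (h : UnitarilyConj A B)
    (k : UnitarilyConj B C) : UnitarilyConj A C := by
  rw [unitarilyConj_iff] at h k ⊢
  obtain ⟨u, hu⟩ := h
  obtain ⟨v, hv⟩ := k
  refine ⟨u * v, fun x => ?_⟩
  rw [← hv, ← hu]
  have : ((u * v : Matrix.unitaryGroup (Fin d) ℂ) : Mat d) * x *
      ((u * v : Matrix.unitaryGroup (Fin d) ℂ) : Mat d)ᴴ =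
      u * (v * x * (v : Mat d)ᴴ) * (u : Mat d)ᴴ := by
    rw [Matrix.UnitaryGroup.mul_val, conjTranspose_mul]
    simp only [Matrix.mul_assoc]
  rw [this]

/-- The conjugate `u A u*` of a star subalgebra. -/
def conjStarSubalgebra {d : ℕ} (u : Matrix.unitaryGroup (Fin d) ℂ) (A : StarSubalgebra ℂ (Mat d)) :
    StarSubalgebra ℂ (Mat d) where
  carrier := {x | (u : Mat d)ᴴ * x * u ∈ A}
  mul_mem' := by
    intro x y hx hy
    have h := conj_mul_conj u⁻¹ x y
    rw [coe_inv_unitary, conjTranspose_conjTranspose] at h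
    rw [Set.mem_ofPred_eq, ← h]
    exact mul_mem hx hy
  add_mem' := by
    intro x y hx hy
    rw [Set.mem_ofPred_eq, Matrix.mul_add, Matrix.add_mul]
    exact add_mem hx hy
  algebraMap_mem' := by
    intro r
    rw [Set.mem_ofPred_eq, ← Algebra.commutes, Matrix.mul_assoc, conjTranspose_coe_mul_self, mul_one]
    exact algebraMap_mem A r
  star_mem' := by
    intro x hx
    have : (u : Mat d)ᴴ * star x * u = star ((u : Mat d)ᴴ * x * u) := by
      simp [star_eq_conjTranspose, Matrix.mul_assoc]
    rw [Set.mem_ofPred_eq, this]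
    exact star_mem hx

theorem mem_conjStarSubalgebra {d : ℕ} {u : Matrix.unitaryGroup (Fin d) ℂ}
    {A : StarSubalgebra ℂ (Mat d)} {x : Mat d} :
    x ∈ conjStarSubalgebra u A ↔ (u : Mat d)ᴴ * x * u ∈ A := Iff.rfl

theorem SATuple.mem_unitalCstar_conjSA {d n : ℕ} (u : Matrix.unitaryGroup (Fin d) ℂ)
    (a : SATuple d n) (x : Mat d) :
    x ∈ unitalCstar (fun i => conjSA u (a i)) ↔ (u : Mat d)ᴴ * x * u ∈ unitalCstar a := by
  have h1 : unitalCstar (fun i => conjSA u (a i)) ≤ conjStarSubalgebra u (unitalCstar a) := by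
    rw [unitalCstar_le_iff]
    intro i
    rw [mem_conjStarSubalgebra, coe_conjSA, conjTranspose_conj_conj]
    exact apply_mem_unitalCstar a i
  have h2 : unitalCstar a ≤ conjStarSubalgebra u⁻¹ (unitalCstar fun i => conjSA u (a i)) := by
    rw [unitalCstar_le_iff]
    intro i
    rw [mem_conjStarSubalgebra, coe_inv_unitary, conjTranspose_conjTranspose]
    exact apply_mem_unitalCstar (fun i => conjSA u (a i)) i
  refine ⟨fun h => h1 h, fun h => ?_⟩
  have := h2 h
  rwa [mem_conjStarSubalgebra, coe_inv_unitary, conjTranspose_conjTranspose,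
    conj_conjTranspose_conj] at this

theorem SATuple.unitalCstar_conjSA {d n : ℕ} (u : Matrix.unitaryGroup (Fin d) ℂ)
    (a : SATuple d n) :
    unitalCstar (fun i => conjSA u (a i)) = conjStarSubalgebra u (unitalCstar a) :=
  SetLike.ext (mem_unitalCstar_conjSA u a)

theorem unitarilyConj_conjStarSubalgebra {d : ℕ} (u : Matrix.unitaryGroup (Fin d) ℂ)
    (A : StarSubalgebra ℂ (Mat d)) : UnitarilyConj (conjStarSubalgebra u A) A := by
  rw [unitarilyConj_iff]
  exact ⟨u, fun x => by rw [mem_conjStarSubalgebra, conjTranspose_conj_conj]⟩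

/-! ### Orbit types -/

section stabilizer

variable {d n : ℕ}

/-- Fixing the entries under conjugation means commuting with them, hence with all that they
generate: the stabilizer is the image of the unitary group of the commutant. -/
theorem mem_stabilizer_iff (u : Matrix.unitaryGroup (Fin d) ℂ) (a : SATuple d n) :
    (QuotientGroup.mk u : PU d) ∈ MulAction.stabilizer (PU d) a ↔
      ∀ x ∈ SATuple.unitalCstar a, (u : Mat d) * x = x * u := by
  have h1 : (QuotientGroup.mk u : PU d) ∈ MulAction.stabilizer (PU d) a ↔
      ∀ i, (u : Mat d) * (a i : Mat d) * (u : Mat d)ᴴ = a i := by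
    rw [MulAction.mem_stabilizer_iff, funext_iff]
    exact forall_congr' fun i => Subtype.ext_iff
  rw [h1]
  constructor
  · intro h x hx
    refine SATuple.commute_unitalCstar (fun i => ?_) hx
    conv_rhs => rw [← h i]
    rw [Matrix.mul_assoc _ _ (u : Mat d), conjTranspose_coe_mul_self, mul_one]
  · intro h i
    rw [h _ (SATuple.apply_mem_unitalCstar a i), Matrix.mul_assoc, coe_mul_conjTranspose_self,
      mul_one]

/-- The commutant is itself a C*-algebra and hence spanned by its unitaries, so only these need to
be tested in the double commutant theorem. -/
theorem StarSubalgebra.mem_of_commute_unitary_commutant (A : StarSubalgebra ℂ (Mat d)) {T : Mat d}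
    (hT : ∀ v : Matrix.unitaryGroup (Fin d) ℂ, (∀ a ∈ A, (v : Mat d) * a = a * v) →
      (v : Mat d) * T = T * v) : T ∈ A := by
  refine A.mem_of_commute_commutant fun c hc => ?_
  let C : StarSubalgebra ℂ (Mat d) := StarSubalgebra.centralizer ℂ (A : Set (Mat d))
  have hC : ∀ x, x ∈ C ↔ ∀ a ∈ A, x * a = a * x := fun x => by
    rw [StarSubalgebra.mem_centralizer_iff]
    exact ⟨fun h a ha => (h a ha).1.symm, fun h a ha => ⟨(h a ha).symm, (h _ (star_mem ha)).symm⟩⟩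
  have : IsClosed (C : Set (Mat d)) :=
    Submodule.closed_of_finiteDimensional (Subalgebra.toSubmodule C.toSubalgebra)
  have hspan := CStarAlgebra.span_unitary C
  let D : Submodule ℂ C :=
    { carrier := {x | (x : Mat d) * T = T * x}
      add_mem' := fun {x y} hx hy => by
        simp only [Set.mem_ofPred_eq] at hx hy ⊢
        rw [AddMemClass.coe_add, add_mul, mul_add, hx, hy]
      zero_mem' := by simp
      smul_mem' := fun z x hx => by
        simp only [Set.mem_ofPred_eq] at hx ⊢
        change (z • (x : Mat d)) * T = T * (z • (x : Mat d))
        rw [smul_mul_assoc, hx, mul_smul_comm] }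
  have hD : (⊤ : Submodule ℂ C) ≤ D := by
    rw [← hspan, Submodule.span_le]
    intro v hv
    have hv' : ((v : C) : Mat d) ∈ Matrix.unitaryGroup (Fin d) ℂ := by
      rw [Matrix.mem_unitaryGroup_iff]
      exact congrArg Subtype.val (Unitary.mul_star_self_of_mem hv)
    exact hT ⟨v, hv'⟩ ((hC _).mp v.2)
  exact hD (show (⟨c, (hC c).mpr hc⟩ : C) ∈ ⊤ from trivial)

/-- A unitary `u` conjugates the stabilizers into each other exactly if it conjugates the unitaries
of the two commutants, and the double commutant theorem recovers the algebras from these. -/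
theorem conjSubgroups_stabilizer_iff (a b : SATuple d n) :
    ConjSubgroups (MulAction.stabilizer (PU d) a) (MulAction.stabilizer (PU d) b) ↔
      UnitarilyConj (SATuple.unitalCstar b) (SATuple.unitalCstar a) := by
  have key : ∀ u : Matrix.unitaryGroup (Fin d) ℂ,
      (MulAction.stabilizer (PU d) b = (MulAction.stabilizer (PU d) a).map
        (MulAut.conj (QuotientGroup.mk u : PU d)).toMonoidHom) ↔
      ∀ v : Matrix.unitaryGroup (Fin d) ℂ, (∀ x ∈ SATuple.unitalCstar b, (v : Mat d) * x = x * v) ↔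
        ∀ x ∈ SATuple.unitalCstar a,
          (((u⁻¹ * v * u : Matrix.unitaryGroup (Fin d) ℂ)) : Mat d) * x =
            x * (u⁻¹ * v * u : Matrix.unitaryGroup (Fin d) ℂ) := by
    intro u
    rw [SetLike.ext_iff]
    have h1 : ∀ v : Matrix.unitaryGroup (Fin d) ℂ, ((QuotientGroup.mk v : PU d) ∈
        (MulAction.stabilizer (PU d) a).map
          (MulAut.conj (QuotientGroup.mk u : PU d)).toMonoidHom) ↔
        (QuotientGroup.mk (u⁻¹ * v * u) : PU d) ∈ MulAction.stabilizer (PU d) a := by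
      intro v
      rw [Subgroup.mem_map]
      constructor
      · rintro ⟨g, hg, hgv⟩
        have h2 : (QuotientGroup.mk (u⁻¹ * v * u) : PU d) = g := by
          change (QuotientGroup.mk u : PU d) * g * (QuotientGroup.mk u : PU d)⁻¹ = _ at hgv
          rw [QuotientGroup.mk_mul, QuotientGroup.mk_mul, QuotientGroup.mk_inv, ← hgv]
          group
        rwa [h2]
      · intro h
        refine ⟨_, h, ?_⟩
        change (QuotientGroup.mk u : PU d) * _ * (QuotientGroup.mk u : PU d)⁻¹ = _
        rw [QuotientGroup.mk_mul, QuotientGroup.mk_mul, QuotientGroup.mk_inv]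
        group
    constructor
    · intro h v
      rw [← mem_stabilizer_iff, ← mem_stabilizer_iff, h, h1]
    · intro h g
      induction g using QuotientGroup.induction_on with
      | H v => rw [h1, mem_stabilizer_iff, mem_stabilizer_iff, h]
  have hcomm : ∀ (u v : Matrix.unitaryGroup (Fin d) ℂ) (x : Mat d),
      (((u⁻¹ * v * u : Matrix.unitaryGroup (Fin d) ℂ)) : Mat d) * x =
        x * (u⁻¹ * v * u : Matrix.unitaryGroup (Fin d) ℂ) ↔
      (v : Mat d) * (u * x * (u : Mat d)ᴴ) = (u * x * (u : Mat d)ᴴ) * v := by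
    intro u v x
    have h1 : ((u⁻¹ * v * u : Matrix.unitaryGroup (Fin d) ℂ) : Mat d) = (u : Mat d)ᴴ * v * u := rfl
    rw [h1]
    have h2 := conj_mul_conj u ((u : Mat d)ᴴ * v * u) x
    have h3 := conj_mul_conj u x ((u : Mat d)ᴴ * v * u)
    rw [conj_conjTranspose_conj] at h2 h3
    rw [h2, h3]
    constructor
    · intro h; rw [h]
    · intro h
      have := congrArg (fun z => (u : Mat d)ᴴ * z * u) h
      simpa only [conjTranspose_conj_conj] using this
  rw [unitarilyConj_iff]
  constructor
  · rintro ⟨g, hg⟩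
    induction g using QuotientGroup.induction_on with
    | H u =>
      rw [key] at hg
      refine ⟨u, fun x => ⟨fun hx => ?_, fun hx => ?_⟩⟩
      · refine (SATuple.unitalCstar a).mem_of_commute_unitary_commutant fun v hv => ?_
        have h2 : u⁻¹ * (u * v * u⁻¹) * u = v := by group
        have h3 := hg (u * v * u⁻¹)
        rw [h2] at h3
        have h4 := (hcomm u (u * v * u⁻¹) x).mpr (h3.mpr hv _ hx)
        rwa [h2] at h4
      · refine (SATuple.unitalCstar b).mem_of_commute_unitary_commutant fun v hv => ?_
        exact (hcomm u v x).mp ((hg v).mp hv x hx)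
  · rintro ⟨u, hu⟩
    refine ⟨QuotientGroup.mk u, (key u).mpr fun v => ?_⟩
    simp only [hcomm]
    constructor
    · intro h x hx
      exact h _ ((hu x).mpr hx)
    · intro h x hx
      have h2 := h ((u : Mat d)ᴴ * x * u) (by rwa [← hu, conj_conjTranspose_conj])
      rwa [conj_conjTranspose_conj] at h2

theorem typeStratum_eq_orbitTypeStratum {t : BlockType d} {a : SATuple d n}
    (ha : a ∈ typeStratum n t) : typeStratum n t = orbitTypeStratum a := by
  ext b
  rw [orbitTypeStratum, Set.mem_ofPred_eq, conjSubgroups_stabilizer_iff]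
  exact ⟨fun hb => UnitarilyConj.trans hb (UnitarilyConj.symm ha),
    fun hb => UnitarilyConj.trans hb ha⟩

end stabilizer

/-! ### The generic stratum -/

theorem BlockType.algebra_generic {d : ℕ} (hd : 2 ≤ d) : (generic d hd).algebra = ⊤ := by
  have hs : Subsingleton (Fin (generic d hd).L) := inferInstanceAs (Subsingleton (Fin 1))
  have hs' : ∀ j, Subsingleton (Fin ((generic d hd).mult j)) :=
    fun j => inferInstanceAs (Subsingleton (Fin 1))
  refine eq_top_iff.mpr fun x _ => ?_
  refine ⟨fun j => (generic d hd).block x j (0 : Fin 1) j (0 : Fin 1), ?_⟩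
  refine (generic d hd).ext_block fun j i j' i' => ?_
  obtain rfl := Subsingleton.elim j j'
  obtain rfl := Subsingleton.elim i i'
  rw [block_blockMatrix_self]
  congr 1 <;> exact Subsingleton.elim _ _

theorem mem_typeStratum_generic {d n : ℕ} (hd : 2 ≤ d) (a : SATuple d n) :
    a ∈ typeStratum n (BlockType.generic d hd) ↔ SATuple.unitalCstar a = ⊤ := by
  rw [typeStratum, Set.mem_ofPred_eq, BlockType.algebra_generic, unitarilyConj_iff]
  constructor
  · rintro ⟨u, hu⟩
    refine eq_top_iff.mpr fun x _ => ?_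
    have := (hu ((u : Mat d)ᴴ * x * u)).mpr trivial
    rwa [conj_conjTranspose_conj] at this
  · intro h
    exact ⟨1, fun x => by rw [h]; exact ⟨fun _ => trivial, fun _ => trivial⟩⟩

theorem SATuple.exists_eq_smul_one_add {d n : ℕ} {a : SATuple d n} {x : Mat d}
    (hx : x ∈ unitalCstar a) : ∃ (z : ℂ), ∃ y ∈ cstar a, x = z • 1 + y := by
  have hsub : ∀ i, (a i : Mat d) ∈ cstar a := fun i =>
    subset_closure (NonUnitalStarAlgebra.subset_adjoin ℂ _ ⟨i, rfl⟩)
  rw [mem_unitalCstar] at hx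
  induction hx using Algebra.adjoin_induction with
  | mem x h =>
    obtain ⟨i, rfl⟩ := h
    exact ⟨0, _, hsub i, by simp⟩
  | algebraMap r => exact ⟨r, 0, zero_mem _, by simp [Algebra.algebraMap_eq_smul_one]⟩
  | add x y hx hy ihx ihy =>
    obtain ⟨z, x', hx', rfl⟩ := ihx
    obtain ⟨w, y', hy', rfl⟩ := ihy
    refine ⟨z + w, x' + y', add_mem hx' hy', ?_⟩
    rw [add_smul]; abel
  | mul x y hx hy ihx ihy =>
    obtain ⟨z, x', hx', rfl⟩ := ihx
    obtain ⟨w, y', hy', rfl⟩ := ihy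
    refine ⟨z * w, z • y' + w • x' + x' * y',
      add_mem (add_mem (SMulMemClass.smul_mem _ hy') (SMulMemClass.smul_mem _ hx'))
        (mul_mem hx' hy'), ?_⟩
    simp only [add_mul, mul_add, smul_mul_assoc, mul_smul_comm, one_mul, mul_one, smul_smul,
      smul_add]
    rw [mul_comm w z]
    abel

/-- The point is that the nonunital `C*(a)` contains `1` once `C*(a) + ℂ1 = M_d`. For `i ≠ j` write
`e_ij = z 1 + y` with `y` in `C*(a)`. If `z ≠ 0`, then `e_ij² = 0` expresses `1` through `y` and
`y²`. Otherwise all off-diagonal matrix units lie in `C*(a)`, and so do the products `e_ij e_ji =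
e_ii`; here `d ≥ 2` enters. -/
theorem typeStratum_generic {d : ℕ} (n : ℕ) (hd : 2 ≤ d) :
    typeStratum n (BlockType.generic d hd) = generatingTuples d n := by
  ext a
  rw [mem_typeStratum_generic, generatingTuples, Set.mem_ofPred_eq]
  constructor
  · intro h
    have hdec : ∀ x : Mat d, ∃ (z : ℂ), ∃ y ∈ SATuple.cstar a, x = z • 1 + y := fun x =>
      SATuple.exists_eq_smul_one_add (by rw [h]; trivial)
    have hone : (1 : Mat d) ∈ SATuple.cstar a := by
      by_contra h1
      have hoff : ∀ i j : Fin d, i ≠ j → single i j (1 : ℂ) ∈ SATuple.cstar a := by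
        intro i j hij
        obtain ⟨z, y, hy, hz⟩ := hdec (single i j 1)
        by_cases hz0 : z = 0
        · rwa [hz, hz0, zero_smul, zero_add]
        · exfalso
          apply h1
          have h2 : single i j (1 : ℂ) * single i j 1 = 0 := by
            rw [single_mul_single_of_ne]; exact hij.symm
          rw [hz] at h2
          have h3 : (1 : Mat d) = (-(z⁻¹ * z⁻¹)) • ((2 * z) • y + y * y) := by
            have h4 : (z * z) • (1 : Mat d) = -((2 * z) • y + y * y) := by
              rw [eq_neg_iff_add_eq_zero, ← h2]
              simp only [add_mul, mul_add, smul_mul_assoc, mul_smul_comm, one_mul, mul_one,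
                smul_smul, smul_add]
              rw [two_mul, add_smul]
              abel
            rw [neg_smul, ← smul_neg, ← h4, smul_smul]
            have : z⁻¹ * z⁻¹ * (z * z) = 1 := by field_simp
            rw [this, one_smul]
          rw [h3]
          exact SMulMemClass.smul_mem _ (add_mem (SMulMemClass.smul_mem _ hy) (mul_mem hy hy))
      apply h1
      have hsum : (1 : Mat d) = ∑ i, single i i (1 : ℂ) := by
        ext r s
        simp [Matrix.sum_apply, Matrix.single_apply, Matrix.one_apply, ite_and]
      rw [hsum]
      refine sum_mem fun i _ => ?_
      obtain ⟨j, hj⟩ : ∃ j : Fin d, i ≠ j := by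
        have : Nontrivial (Fin d) := Fin.nontrivial_iff_two_le.mpr hd
        obtain ⟨j, hj⟩ := exists_ne i
        exact ⟨j, hj.symm⟩
      have := mul_mem (hoff i j hj) (hoff j i hj.symm)
      rwa [single_mul_single_same, one_mul] at this
    refine eq_top_iff.mpr fun x _ => ?_
    obtain ⟨z, y, hy, rfl⟩ := hdec x
    exact add_mem (SMulMemClass.smul_mem _ hone) hy
  · intro h
    refine eq_top_iff.mpr fun x _ => ?_
    have hx : x ∈ SATuple.cstar a := by rw [h]; trivial
    have h2 : (SATuple.cstar a : Set (Mat d)) ⊆ SATuple.unitalCstar a :=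
      closure_mono (NonUnitalStarAlgebra.adjoin_le_starAlgebra_adjoin ℂ _)
    exact h2 hx

/-! ### Finite dimension and compactness -/

instance selfAdjoint_finiteDimensional (d : ℕ) : FiniteDimensional ℝ (selfAdjoint (Mat d)) :=
  FiniteDimensional.of_injective (selfAdjoint.submodule ℝ (Mat d)).subtype Subtype.val_injective

instance unitaryGroup_compactSpace (d : ℕ) : CompactSpace (Matrix.unitaryGroup (Fin d) ℂ) := by
  refine isCompact_iff_compactSpace.mp ?_
  have hclosed : IsClosed ((Matrix.unitaryGroup (Fin d) ℂ : Set (Mat d))) := by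
    have : ((Matrix.unitaryGroup (Fin d) ℂ : Set (Mat d))) = {x | x * star x = 1} := by
      ext x
      exact Matrix.mem_unitaryGroup_iff
    rw [this]
    exact isClosed_eq (by fun_prop) continuous_const
  have hbdd : Bornology.IsBounded ((Matrix.unitaryGroup (Fin d) ℂ : Set (Mat d))) := by
    rw [isBounded_iff_forall_norm_le]
    refine ⟨1, fun x hx => ?_⟩
    have h1 : star x * x = 1 := Matrix.mem_unitaryGroup_iff'.mp hx
    have h2 := CStarRing.norm_star_mul_self (x := x)
    rw [h1] at h2
    have h3 : ‖(1 : Mat d)‖ ≤ 1 := by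
      rcases isEmpty_or_nonempty (Fin d) with h | h
      · have : (1 : Mat d) = 0 := Subsingleton.elim _ _
        rw [this, norm_zero]; exact zero_le_one
      · rw [CStarRing.norm_one]
    by_contra! hcon
    nlinarith
  have : ProperSpace (Mat d) := FiniteDimensional.proper ℂ (Mat d)
  exact Metric.isCompact_of_isClosed_isBounded hclosed hbdd

/-! ### Tuples near a given one -/

namespace SATuple

variable {d n : ℕ}

theorem continuous_lift (P : FreeAlgebra ℂ (Fin (n + 1))) :
    Continuous fun b : SATuple d n => FreeAlgebra.lift ℂ (fun i => (b i : Mat d)) P := by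
  induction P using FreeAlgebra.induction with
  | grade0 r => simpa using continuous_const
  | grade1 i =>
    simp only [FreeAlgebra.lift_ι_apply]
    fun_prop
  | mul p q hp hq => simp only [map_mul]; exact hp.mul hq
  | add p q hp hq => simp only [map_add]; exact hp.add hq

theorem mem_unitalCstar_iff_lift {a : SATuple d n} {x : Mat d} :
    x ∈ unitalCstar a ↔ ∃ P, FreeAlgebra.lift ℂ (fun i => (a i : Mat d)) P = x := by
  rw [mem_unitalCstar, entries, Algebra.adjoin_range_eq_range_freeAlgebra_lift]
  rfl

/-- The tuples in a star subalgebra that generate it form a relatively open set. -/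
theorem eventually_unitalCstar_eq (a : SATuple d n) :
    ∀ᶠ b in nhds a, (∀ i, (b i : Mat d) ∈ unitalCstar a) → unitalCstar b = unitalCstar a := by
  let W : Submodule ℂ (Mat d) := Subalgebra.toSubmodule (unitalCstar a).toSubalgebra
  let β := Module.finBasis ℂ W
  have hP : ∀ j, ∃ P, FreeAlgebra.lift ℂ (fun i => (a i : Mat d)) P = (β j : Mat d) := fun j =>
    mem_unitalCstar_iff_lift.mp (β j).2
  choose P hP using hP
  let Φ : SATuple d n → Fin (Module.finrank ℂ W) → Mat d := fun b j =>
    FreeAlgebra.lift ℂ (fun i => (b i : Mat d)) (P j)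
  have hΦ : Continuous Φ := continuous_pi fun j => continuous_lift (P j)
  have hlin : LinearIndependent ℂ (Φ a) := by
    have : Φ a = fun j => (β j : Mat d) := funext hP
    rw [this]
    exact β.linearIndependent.map' W.subtype W.ker_subtype
  -- Linear independence is an open condition: the polynomials that give a basis of the algebra at
  -- `a` stay independent at `b`, so the algebra of `b` has no room to be smaller.
  filter_upwards [hΦ.continuousAt.eventually hlin.eventually] with b hb hmem
  have hle : unitalCstar b ≤ unitalCstar a := unitalCstar_le_iff.mpr hmem
  let W' : Submodule ℂ (Mat d) := Subalgebra.toSubmodule (unitalCstar b).toSubalgebra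
  have hle' : W' ≤ W := hle
  have h1 : LinearIndependent ℂ fun j => (⟨Φ b j, mem_unitalCstar_iff_lift.mpr ⟨P j, rfl⟩⟩ : W') :=
    LinearIndependent.of_comp W'.subtype hb
  have h2 := h1.fintype_card_le_finrank
  rw [Fintype.card_fin] at h2
  have h3 := Submodule.eq_of_le_of_finrank_le hle' h2
  refine le_antisymm hle fun x hx => ?_
  have : x ∈ W' := by rw [h3]; exact hx
  exact this

end SATuple

/-! ### One-parameter unitary groups -/

section exponential

variable {d : ℕ}

local notation "expU" => selfAdjoint.expUnitary (A := Mat d)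

theorem coe_expUnitary_conjTranspose (h : selfAdjoint (Mat d)) :
    (expU h : Mat d)ᴴ = NormedSpace.exp (-(Complex.I • (h : Mat d))) := by
  rw [selfAdjoint.expUnitary_coe, ← star_eq_conjTranspose, NormedSpace.star_exp, star_smul,
    h.2.star_eq, Complex.star_def, Complex.conj_I, neg_smul]

/-- The self-adjoint elements `h` with `[h, A] ⊆ A`. -/
def lieNormalizer (A : StarSubalgebra ℂ (Mat d)) : Submodule ℝ (selfAdjoint (Mat d)) where
  carrier := {h | ∀ x ∈ A, (h : Mat d) * x - x * h ∈ A}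
  add_mem' := by
    intro h k hh hk x hx
    have : ((h + k : selfAdjoint (Mat d)) : Mat d) * x - x * ((h + k : selfAdjoint (Mat d)) : Mat d)
        = (h * x - x * h) + (k * x - x * k) := by
      rw [AddSubgroup.coe_add, add_mul, mul_add]; abel
    rw [this]
    exact add_mem (hh x hx) (hk x hx)
  zero_mem' := by
    intro x hx
    simp
  smul_mem' := by
    intro r h hh x hx
    have : ((r • h : selfAdjoint (Mat d)) : Mat d) * x - x * ((r • h : selfAdjoint (Mat d)) : Mat d)
        = (r : ℂ) • ((h : Mat d) * x - x * h) := by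
      rw [selfAdjoint.val_smul, smul_mul_assoc, mul_smul_comm, ← smul_sub]
      exact (Complex.coe_smul r _).symm
    rw [this]
    exact SMulMemClass.smul_mem _ (hh x hx)

theorem mem_lieNormalizer {A : StarSubalgebra ℂ (Mat d)} {h : selfAdjoint (Mat d)} :
    h ∈ lieNormalizer A ↔ ∀ x ∈ A, (h : Mat d) * x - x * h ∈ A := Iff.rfl

/-- The self-adjoint elements of a star subalgebra. -/
def selfAdjointMem (A : StarSubalgebra ℂ (Mat d)) : Submodule ℝ (selfAdjoint (Mat d)) where
  carrier := {h | (h : Mat d) ∈ A}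
  add_mem' := fun hh hk => add_mem (S := StarSubalgebra ℂ (Mat d)) hh hk
  zero_mem' := zero_mem A
  smul_mem' := by
    intro r h hh
    change ((r • h : selfAdjoint (Mat d)) : Mat d) ∈ A
    rw [selfAdjoint.val_smul, ← Complex.coe_smul]
    exact SMulMemClass.smul_mem _ hh

theorem mem_selfAdjointMem {A : StarSubalgebra ℂ (Mat d)} {h : selfAdjoint (Mat d)} :
    h ∈ selfAdjointMem A ↔ (h : Mat d) ∈ A := Iff.rfl

theorem selfAdjointMem_le_lieNormalizer (A : StarSubalgebra ℂ (Mat d)) :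
    selfAdjointMem A ≤ lieNormalizer A := fun _ hh _ hx =>
  sub_mem (mul_mem hh hx) (mul_mem hx hh)

/-- Conjugation by `exp(ih)` is the exponential of the commutator with `ih`. The latter preserves
the closed subspace `A`, hence so does its exponential series. -/
theorem conj_expUnitary_mem {A : StarSubalgebra ℂ (Mat d)} {h : selfAdjoint (Mat d)}
    (hh : h ∈ lieNormalizer A) {x : Mat d} (hx : x ∈ A) :
    (expU h : Mat d) * x * (expU h : Mat d)ᴴ ∈ A := by
  let J : Mat d := Complex.I • (h : Mat d)
  let T : Mat d →L[ℂ] Mat d :=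
    ((LinearMap.mulLeft ℂ J) - (LinearMap.mulRight ℂ J)).toContinuousLinearMap
  have hT : ∀ y, T y = J * y - y * J := fun y => rfl
  let W : Submodule ℂ (Mat d) := Subalgebra.toSubmodule A.toSubalgebra
  have hTW : ∀ y ∈ W, T y ∈ W := fun y hy => by
    have h1 : T y = Complex.I • ((h : Mat d) * y - y * h) := by
      rw [hT]; simp only [J, smul_mul_assoc, mul_smul_comm, smul_sub]
    rw [h1]
    exact W.smul_mem _ (hh y hy)
  have hclosed : IsClosed (W : Set (Mat d)) := Submodule.closed_of_finiteDimensional W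
  have hpow : ∀ k : ℕ, (T ^ k) x ∈ W := fun k => by
    induction k with
    | zero => exact hx
    | succ k ih =>
      rw [pow_succ']
      exact hTW _ ih
  have hexpW : NormedSpace.exp T x ∈ W := by
    have hs := (NormedSpace.exp_series_hasSum_exp' (𝕂 := ℂ) T).mapL
      (ContinuousLinearMap.apply ℂ (Mat d) x)
    refine hclosed.mem_of_tendsto hs (Filter.Eventually.of_forall fun s => ?_)
    refine Submodule.sum_mem _ fun k _ => ?_
    change (k.factorial : ℂ)⁻¹ • (T ^ k) x ∈ W
    exact Submodule.smul_mem _ _ (hpow k)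
  have key : NormedSpace.exp T x = NormedSpace.exp J * x * NormedSpace.exp (-J) := by
    -- Conjugating the flow of `T` back by `exp(tJ)` gives a curve with zero derivative; its values
    -- at `1` and `0` are compared.
    let g : ℝ → Mat d := fun t =>
      NormedSpace.exp (t • (-J)) * (NormedSpace.exp (t • T) x) * NormedSpace.exp (t • J)
    have hg : ∀ t, HasDerivAt g 0 t := fun t => by
      have h1 := hasDerivAt_exp_smul_const (-J) t
      have h3 := hasDerivAt_exp_smul_const' J t
      have h2 : HasDerivAt (fun t : ℝ => NormedSpace.exp (t • T) x)
          (T (NormedSpace.exp (t • T) x)) t := by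
        have h4 := hasDerivAt_exp_smul_const' T t
        exact ((ContinuousLinearMap.apply ℂ (Mat d) x).restrictScalars ℝ).hasFDerivAt.comp_hasDerivAt
          t h4
      have h5 := (h1.mul h2).mul h3
      have h6 : (NormedSpace.exp (t • -J) * -J * (NormedSpace.exp (t • T)) x +
          NormedSpace.exp (t • -J) * T ((NormedSpace.exp (t • T)) x)) * NormedSpace.exp (t • J) +
          (NormedSpace.exp (t • -J) * (NormedSpace.exp (t • T)) x) *
            (J * NormedSpace.exp (t • J)) = 0 := by
        rw [hT]
        noncomm_ring
      rw [← h6]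
      exact h5
    have hT0 : NormedSpace.exp ((0 : ℝ) • T) x = x := by
      have : (0 : ℝ) • T = 0 := by ext1 y; exact zero_smul ℝ (T y)
      rw [this, NormedSpace.exp_zero]
      rfl
    have hconst := is_const_of_deriv_eq_zero (fun t => (hg t).differentiableAt)
      (fun t => (hg t).deriv) 1 0
    simp only [g, one_smul, zero_smul, NormedSpace.exp_zero, one_mul, mul_one, hT0] at hconst
    have h6 : NormedSpace.exp J * NormedSpace.exp (-J) = 1 := by
      have := coe_mul_conjTranspose_self (expU h)
      rwa [coe_expUnitary_conjTranspose, selfAdjoint.expUnitary_coe] at this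
    calc NormedSpace.exp T x = (NormedSpace.exp J * NormedSpace.exp (-J)) * (NormedSpace.exp T x) *
          (NormedSpace.exp J * NormedSpace.exp (-J)) := by rw [h6, one_mul, mul_one]
      _ = NormedSpace.exp J * (NormedSpace.exp (-J) * (NormedSpace.exp T x) * NormedSpace.exp J) *
          NormedSpace.exp (-J) := by simp only [Matrix.mul_assoc]
      _ = _ := by rw [hconst]
  have h7 : (expU h : Mat d) * x * (expU h : Mat d)ᴴ =
      NormedSpace.exp J * x * NormedSpace.exp (-J) := by
    rw [coe_expUnitary_conjTranspose, selfAdjoint.expUnitary_coe]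
  rw [h7, ← key]
  exact hexpW

/-- For unitary `w`, `(w + w*)² = 4 + (w - w*)²`, so the skew part determines the square of the
hermitian part. Near `1` this square has only one root: with `P` and `Q` the deviations of the
hermitian parts from `2`, one gets `4(P - Q) = Q(Q - P) + (Q - P)P`, and both norms are below `2`.
-/
theorem unitary_eq_of_sub_conjTranspose_eq {u v : Matrix.unitaryGroup (Fin d) ℂ}
    (h : (u : Mat d) - (u : Mat d)ᴴ = v - (v : Mat d)ᴴ) (hu : ‖(u : Mat d) - 1‖ < 1)
    (hv : ‖(v : Mat d) - 1‖ < 1) : u = v := by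
  have h1 : ∀ w : Matrix.unitaryGroup (Fin d) ℂ, ((w : Mat d) + (w : Mat d)ᴴ) *
      ((w : Mat d) + (w : Mat d)ᴴ) =
      (4 : ℂ) • 1 + ((w : Mat d) - (w : Mat d)ᴴ) * ((w : Mat d) - (w : Mat d)ᴴ) := fun w => by
    have h2 := coe_mul_conjTranspose_self w
    have h3 := conjTranspose_coe_mul_self w
    have h4 : (4 : ℂ) • (1 : Mat d) = 2 • ((w : Mat d) * (w : Mat d)ᴴ) +
        2 • ((w : Mat d)ᴴ * (w : Mat d)) := by
      rw [h2, h3, ← add_smul, ← Nat.cast_smul_eq_nsmul ℂ]; norm_num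
    rw [h4]
    noncomm_ring
  set P : Mat d := (u : Mat d) + (u : Mat d)ᴴ - 2 with hP
  set Q : Mat d := (v : Mat d) + (v : Mat d)ᴴ - 2 with hQ
  have hnorm : ∀ w : Matrix.unitaryGroup (Fin d) ℂ, ‖(w : Mat d) - 1‖ < 1 →
      ‖(w : Mat d) + (w : Mat d)ᴴ - 2‖ < 2 := fun w hw => by
    have : (w : Mat d) + (w : Mat d)ᴴ - 2 = ((w : Mat d) - 1) + star ((w : Mat d) - 1) := by
      rw [star_sub, star_one, star_eq_conjTranspose, ← one_add_one_eq_two]; abel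
    rw [this]
    refine lt_of_le_of_lt (norm_add_le _ _) ?_
    rw [norm_star]; linarith
  have hPn := hnorm u hu
  have hQn := hnorm v hv
  have hsq : (4 : ℂ) • (P - Q) = Q * (Q - P) + (Q - P) * P := by
    have h2 := h1 u
    have h3 := h1 v
    rw [h, ← h3] at h2
    have h4 : (u : Mat d) + (u : Mat d)ᴴ = P + 2 := by rw [hP]; abel
    have h5 : (v : Mat d) + (v : Mat d)ᴴ = Q + 2 := by rw [hQ]; abel
    rw [h4, h5] at h2
    have h6 : (4 : ℂ) • (P - Q) = 4 • (P - Q) := by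
      rw [← Nat.cast_smul_eq_nsmul ℂ]; norm_num
    rw [h6, ← sub_eq_zero]
    have h7 : P * P + 4 • P - (Q * Q + 4 • Q) = 0 := by
      rw [← sub_eq_zero] at h2
      rw [← h2]
      noncomm_ring
    rw [← h7]
    noncomm_ring
  have hPQ : P = Q := by
    by_contra hne
    have hpos : 0 < ‖P - Q‖ := norm_pos_iff.mpr (sub_ne_zero.mpr hne)
    have h2 : ‖(4 : ℂ) • (P - Q)‖ = 4 * ‖P - Q‖ := by rw [norm_smul]; norm_num
    rw [hsq] at h2
    have h3 := norm_add_le (Q * (Q - P)) ((Q - P) * P)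
    have h4 := norm_mul_le Q (Q - P)
    have h5 := norm_mul_le (Q - P) P
    rw [norm_sub_rev Q P] at h4 h5
    nlinarith
  have h8 : (u : Mat d) + (u : Mat d)ᴴ = v + (v : Mat d)ᴴ := by
    have := congrArg (· + (2 : Mat d)) hPQ
    simpa [hP, hQ] using this
  have h9 : (2 : ℂ) • (u : Mat d) = (2 : ℂ) • (v : Mat d) := by
    have h10 : ∀ w : Mat d, (2 : ℂ) • w = (w + wᴴ) + (w - wᴴ) := fun w => by
      rw [two_smul]; abel
    rw [h10, h10, h8, h]
  exact Subtype.ext (smul_right_injective _ (two_ne_zero) h9)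

end exponential

/-! ### Exponential coordinates and unitaries near the identity -/

section chart

variable {d n : ℕ}

local notation "expU" => selfAdjoint.expUnitary (A := Mat d)

/-- The map `h ↦ i h` as a continuous real-linear map. -/
noncomputable def smulI (d : ℕ) : selfAdjoint (Mat d) →L[ℝ] Mat d :=
  LinearMap.toContinuousLinearMap
    { toFun := fun h => Complex.I • (h : Mat d)
      map_add' := fun h k => by rw [AddSubgroup.coe_add, smul_add]
      map_smul' := fun r h => by
        rw [selfAdjoint.val_smul, smul_comm]; rfl }

theorem smulI_apply (h : selfAdjoint (Mat d)) : smulI d h = Complex.I • (h : Mat d) := rfl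

theorem coe_expUnitary_eq (h : selfAdjoint (Mat d)) :
    (expU h : Mat d) = NormedSpace.exp (smulI d h) := selfAdjoint.expUnitary_coe h

theorem coe_expUnitary_conjTranspose_eq (h : selfAdjoint (Mat d)) :
    (expU h : Mat d)ᴴ = NormedSpace.exp (-(smulI d h)) := coe_expUnitary_conjTranspose h

/-- The self-adjoint part as a continuous linear map. -/
noncomputable def realPartCLM (d : ℕ) : Mat d →L[ℝ] selfAdjoint (Mat d) :=
  LinearMap.toContinuousLinearMap realPart

theorem realPartCLM_coe (h : selfAdjoint (Mat d)) : realPartCLM d (h : Mat d) = h :=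
  Subtype.ext h.2.coe_realPart

/-- The skew-adjoint part, divided by `i`, as a continuous linear map. -/
noncomputable def imaginaryPartCLM (d : ℕ) : Mat d →L[ℝ] selfAdjoint (Mat d) :=
  LinearMap.toContinuousLinearMap imaginaryPart

theorem imaginaryPartCLM_smulI (h : selfAdjoint (Mat d)) : imaginaryPartCLM d (smulI d h) = h := by
  change imaginaryPart (Complex.I • (h : Mat d)) = h
  rw [imaginaryPart_I_smul]
  exact Subtype.ext h.2.coe_realPart

theorem sub_conjTranspose_eq_of_imaginaryPart_eq {x y : Mat d}
    (h : imaginaryPartCLM d x = imaginaryPartCLM d y) : x - xᴴ = y - yᴴ := by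
  have h1 : ∀ z : Mat d, z - zᴴ = (2 * Complex.I) • (imaginaryPartCLM d z : Mat d) := fun z => by
    have h2 := realPart_add_I_smul_imaginaryPart z
    have h3 := congrArg star h2
    rw [star_add, star_smul, (realPart z).2.star_eq, (imaginaryPart z).2.star_eq,
      Complex.star_def, Complex.conj_I] at h3
    change _ = (2 * Complex.I) • (imaginaryPart z : Mat d)
    calc z - zᴴ = ((realPart z : Mat d) + Complex.I • (imaginaryPart z : Mat d)) -
          ((realPart z : Mat d) + -Complex.I • (imaginaryPart z : Mat d)) := by rw [h2, h3]; rfl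
      _ = _ := by rw [two_mul, add_smul, neg_smul]; abel
  rw [h1, h1, h]

theorem hasStrictFDerivAt_exp_comp {E : Type*} [NormedAddCommGroup E] [NormedSpace ℝ E]
    (L : E →L[ℝ] Mat d) : HasStrictFDerivAt (fun v => NormedSpace.exp (L v)) L 0 := by
  have h1 : HasStrictFDerivAt NormedSpace.exp (1 : Mat d →L[ℝ] Mat d) (L 0) := by
    rw [map_zero]; exact hasStrictFDerivAt_exp_zero
  exact h1.comp 0 L.hasStrictFDerivAt

theorem contDiff_exp_comp {E : Type*} [NormedAddCommGroup E] [NormedSpace ℝ E]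
    (L : E →L[ℝ] Mat d) : ContDiff ℝ ∞ (fun v => NormedSpace.exp (L v)) := by
  have h1 : ContDiff ℝ ∞ (NormedSpace.exp : Mat d → Mat d) :=
    contDiff_iff_contDiffAt.mpr fun x => (NormedSpace.exp_analytic (𝕂 := ℝ) x).contDiffAt
  exact h1.comp L.contDiff

/-- Near the identity, the unitary group is the product of the exponentials of complementary
subspaces. -/
theorem exists_expUnitary_mul_expUnitary {K N : Submodule ℝ (selfAdjoint (Mat d))}
    (hKN : IsCompl K N) {O : Set (selfAdjoint (Mat d))} (hO : O ∈ nhds 0) :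
    ∃ δ > 0, ∀ w : Matrix.unitaryGroup (Fin d) ℂ, ‖(w : Mat d) - 1‖ < δ →
      ∃ k ∈ K, k ∈ O ∧ ∃ h ∈ N, w = expU k * expU h := by
  let πK : selfAdjoint (Mat d) →L[ℝ] selfAdjoint (Mat d) :=
    LinearMap.toContinuousLinearMap (K.subtype ∘ₗ K.projectionOnto N hKN)
  let πN : selfAdjoint (Mat d) →L[ℝ] selfAdjoint (Mat d) :=
    LinearMap.toContinuousLinearMap (N.subtype ∘ₗ N.projectionOnto K hKN.symm)
  have hπ : ∀ z, πK z + πN z = z := fun z =>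
    Submodule.projection_add_projection_eq_self hKN z
  let M : selfAdjoint (Mat d) → Mat d := fun z =>
    NormedSpace.exp ((smulI d).comp πK z) * NormedSpace.exp ((smulI d).comp πN z)
  have hM : ∀ z, M z = ((expU (πK z) * expU (πN z) : Matrix.unitaryGroup (Fin d) ℂ) : Mat d) := by
    intro z
    change _ = (expU (πK z) : Mat d) * (expU (πN z) : Mat d)
    rw [coe_expUnitary_eq, coe_expUnitary_eq]
    rfl
  have hM0 : M 0 = 1 := by simp [M]
  have hMd : HasStrictFDerivAt M (smulI d) 0 := by
    have h1 := (hasStrictFDerivAt_exp_comp ((smulI d).comp πK)).mul'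
      (hasStrictFDerivAt_exp_comp ((smulI d).comp πN))
    refine h1.congr_fderiv ?_
    ext1 z
    simp only [map_zero, NormedSpace.exp_zero]
    change (1 : Mat d) * smulI d (πN z) + smulI d (πK z) * 1 = smulI d z
    rw [one_mul, mul_one, ← map_add, add_comm, hπ]
  have hMc : ContinuousAt M 0 := hMd.continuousAt
  -- The unitary group is not a vector space; its imaginary part lives in one of the right
  -- dimension. There the derivative at `0` is the identity, so `G` is locally onto.
  let G : selfAdjoint (Mat d) → selfAdjoint (Mat d) := fun z => imaginaryPartCLM d (M z)
  have hG : HasStrictFDerivAt G (ContinuousLinearMap.id ℝ (selfAdjoint (Mat d))) 0 := by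
    have h1 := ((imaginaryPartCLM d).hasStrictFDerivAt (x := M 0)).comp (0 : selfAdjoint (Mat d)) hMd
    refine h1.congr_fderiv ?_
    ext1 z
    exact imaginaryPartCLM_smulI z
  have hmap := hG.map_nhds_eq_of_surj (LinearMap.range_id)
  have hG0 : G 0 = imaginaryPartCLM d 1 := by simp only [G, hM0]
  have hN0 : {z | πK z ∈ O ∧ ‖M z - 1‖ < 1} ∈ nhds (0 : selfAdjoint (Mat d)) := by
    refine Filter.inter_mem ?_ ?_
    · have h1 : ContinuousAt πK 0 := πK.continuous.continuousAt
      exact h1.preimage_mem_nhds (by rw [map_zero]; exact hO)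
    · have h1 : ContinuousAt (fun z => ‖M z - 1‖) 0 := by fun_prop
      refine h1.preimage_mem_nhds (Iio_mem_nhds ?_)
      rw [hM0]; simp
  have h2 : G '' {z | πK z ∈ O ∧ ‖M z - 1‖ < 1} ∈ nhds (imaginaryPartCLM d 1) := by
    rw [← hG0, ← hmap]
    exact Filter.image_mem_map hN0
  have h3 := (imaginaryPartCLM d).continuous.continuousAt.preimage_mem_nhds h2
  obtain ⟨δ, hδ, hball⟩ := Metric.mem_nhds_iff.mp h3
  refine ⟨min δ 1, lt_min hδ one_pos, fun w hw => ?_⟩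
  obtain ⟨z, ⟨hzO, hz1⟩, hz⟩ := hball (show (w : Mat d) ∈ Metric.ball 1 δ by
    rw [Metric.mem_ball, dist_eq_norm]
    exact hw.trans_le (min_le_left _ _))
  refine ⟨πK z, Submodule.coe_mem _, hzO, πN z, Submodule.coe_mem _, ?_⟩
  -- So far only the imaginary parts of `w` and of the product of exponentials agree; close to `1`
  -- they determine the unitary.
  refine unitary_eq_of_sub_conjTranspose_eq ?_ (hw.trans_le (min_le_right _ _)) ?_
  · rw [← hM]
    exact sub_conjTranspose_eq_of_imaginaryPart_eq hz.symm
  · rw [← hM]; exact hz1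

/-- If `x` is close to `a` and `C*₁(x)` is unitarily equivalent to `C*₁(a)`, then the equivalence
can be implemented by a unitary close to the identity. -/
theorem eventually_exists_conj_near (a : SATuple d n) {δ : ℝ} (hδ : 0 < δ) :
    ∀ᶠ x in nhds a, UnitarilyConj (SATuple.unitalCstar x) (SATuple.unitalCstar a) →
      ∃ w : Matrix.unitaryGroup (Fin d) ℂ, ‖(w : Mat d) - 1‖ < δ ∧
        ∀ i, (w : Mat d)ᴴ * (x i : Mat d) * w ∈ SATuple.unitalCstar a := by
  set A := SATuple.unitalCstar a with hA
  have hclosed : IsClosed (A : Set (Mat d)) :=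
    Submodule.closed_of_finiteDimensional (Subalgebra.toSubmodule A.toSubalgebra)
  let N : Set (Matrix.unitaryGroup (Fin d) ℂ) :=
    {ν | ∀ y : Mat d, (ν : Mat d)ᴴ * y * ν ∈ A ↔ y ∈ A}
  -- An implementing unitary may be changed on the right by the normalizer `N` of `A`. `T` collects
  -- those that cannot be brought close to `1` in this way.
  let T : Set (Matrix.unitaryGroup (Fin d) ℂ) :=
    {w | ∀ ν ∈ N, δ ≤ ‖((w * ν : Matrix.unitaryGroup (Fin d) ℂ) : Mat d) - 1‖}
  have hT : IsClosed T := by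
    have : T = ⋂ ν ∈ N, {w | δ ≤ ‖((w * ν : Matrix.unitaryGroup (Fin d) ℂ) : Mat d) - 1‖} := by
      ext w; simp [T]
    rw [this]
    refine isClosed_biInter fun ν _ => isClosed_le continuous_const ?_
    fun_prop
  let Y : Set (Matrix.unitaryGroup (Fin d) ℂ × SATuple d n) :=
    {p | p.1 ∈ T} ∩ ⋂ i, {p | (p.1 : Mat d)ᴴ * (p.2 i : Mat d) * p.1 ∈ (A : Set (Mat d))}
  have hY : IsClosed Y := by
    refine (hT.preimage continuous_fst).inter (isClosed_iInter fun i => hclosed.preimage ?_)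
    have h1 : Continuous fun p : Matrix.unitaryGroup (Fin d) ℂ × SATuple d n => (p.1 : Mat d) := by
      fun_prop
    have h2 : Continuous fun p : Matrix.unitaryGroup (Fin d) ℂ × SATuple d n =>
        (p.2 i : Mat d) := by fun_prop
    exact ((continuous_star.comp h1).mul h2).mul h1
  -- As the unitary group is compact, the tuples implemented by a unitary in `T` form a closed set,
  -- and it suffices that `a` is not one of them.
  have hbad : IsClosed (Prod.snd '' Y) := isClosedMap_snd_of_compactSpace _ hY
  have ha : a ∉ Prod.snd '' Y := by
    rintro ⟨⟨w, x⟩, ⟨hwT, hw⟩, rfl⟩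
    have hw' : ∀ i, (w : Mat d)ᴴ * (x i : Mat d) * w ∈ A := fun i => Set.mem_iInter.mp hw i
    -- Conjugation by `w*` maps `A` into itself, hence onto itself by dimension. So `w⁻¹` normalizes
    -- `A`, and `w w⁻¹ = 1` contradicts `w ∈ T`.
    have hle : A ≤ conjStarSubalgebra w A := by
      rw [hA, SATuple.unitalCstar_le_iff]
      exact hw'
    let f : Subalgebra.toSubmodule A.toSubalgebra →ₗ[ℂ] Subalgebra.toSubmodule A.toSubalgebra :=
      (LinearMap.mulRight ℂ (w : Mat d) ∘ₗ LinearMap.mulLeft ℂ (w : Mat d)ᴴ).restrict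
        fun y hy => hle hy
    have hf : Function.Injective f := fun y z hyz => by
      have h1 : (w : Mat d)ᴴ * y * w = (w : Mat d)ᴴ * z * w := congrArg Subtype.val hyz
      have h2 := congrArg (fun t => (w : Mat d) * t * (w : Mat d)ᴴ) h1
      simp only [conj_conjTranspose_conj] at h2
      exact Subtype.ext h2
    have hsurj := LinearMap.injective_iff_surjective.mp hf
    have hN : w⁻¹ ∈ N := by
      intro y
      rw [coe_inv_unitary, conjTranspose_conjTranspose]
      constructor
      · intro h
        have := hle h
        rwa [mem_conjStarSubalgebra, conjTranspose_conj_conj] at this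
      · intro h
        obtain ⟨z, hz⟩ := hsurj ⟨y, h⟩
        have h1 : (w : Mat d)ᴴ * z * w = y := congrArg Subtype.val hz
        rw [← h1, conj_conjTranspose_conj]
        exact z.2
    have := hwT _ hN
    rw [mul_inv_cancel] at this
    simp at this
    linarith
  filter_upwards [hbad.isOpen_compl.mem_nhds ha] with x hx hconj
  obtain ⟨w, hw⟩ := unitarilyConj_iff.mp hconj
  have hw' : ∀ i, (w : Mat d)ᴴ * (x i : Mat d) * w ∈ A := fun i => by
    rw [← hw, conj_conjTranspose_conj]
    exact SATuple.apply_mem_unitalCstar x i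
  have hwT : w ∉ T := fun h => hx ⟨(w, x), ⟨h, Set.mem_iInter.mpr hw'⟩, rfl⟩
  simp only [T, Set.mem_ofPred_eq, not_forall, not_le] at hwT
  obtain ⟨ν, hν, hlt⟩ := hwT
  refine ⟨w * ν, hlt, fun i => ?_⟩
  have h1 := (hν _).mpr (hw' i)
  rw [UnitaryGroup.mul_val, conjTranspose_mul]
  simpa only [Matrix.mul_assoc] using h1

end chart

/-! ### Charts of the strata -/

section chart

variable {d n : ℕ}

local notation "expU" => selfAdjoint.expUnitary (A := Mat d)

/-- The infinitesimal conjugation `x ↦ i [h, x]`, as a bilinear map on self-adjoint matrices. -/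
noncomputable def infConj (d : ℕ) :
    selfAdjoint (Mat d) →ₗ[ℝ] selfAdjoint (Mat d) →ₗ[ℝ] selfAdjoint (Mat d) :=
  LinearMap.mk₂ ℝ
    (fun h x => ⟨Complex.I • ((h : Mat d) * x - x * h), by
      rw [selfAdjoint.mem_iff, star_smul, star_sub, star_mul, star_mul, h.2.star_eq, x.2.star_eq,
        Complex.star_def, Complex.conj_I, neg_smul, ← smul_neg, neg_sub]⟩)
    (fun h k x => Subtype.ext (by
      simp only [AddSubgroup.coe_add, add_mul, mul_add, ← smul_add]; congr 1; abel))
    (fun r h x => Subtype.ext (by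
      simp only [selfAdjoint.val_smul, smul_mul_assoc, mul_smul_comm, ← smul_sub]
      rw [smul_comm]))
    (fun h x y => Subtype.ext (by
      simp only [AddSubgroup.coe_add, add_mul, mul_add, ← smul_add]; congr 1; abel))
    (fun r h x => Subtype.ext (by
      simp only [selfAdjoint.val_smul, smul_mul_assoc, mul_smul_comm, ← smul_sub]
      rw [smul_comm]))

theorem coe_infConj (h x : selfAdjoint (Mat d)) :
    (infConj d h x : Mat d) = Complex.I • ((h : Mat d) * x - x * h) := rfl

theorem coe_infConj_eq (h x : selfAdjoint (Mat d)) :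
    (infConj d h x : Mat d) = smulI d h * x - x * smulI d h := by
  rw [coe_infConj, smulI_apply, smul_mul_assoc, mul_smul_comm, smul_sub]

/-- The set of self-adjoint `h` that map `a` into `A` under the commutator and hence normalize
`A = C*₁(a)`. -/
theorem mem_lieNormalizer_of_infConj_mem {a : SATuple d n} {h : selfAdjoint (Mat d)}
    (hh : ∀ i, (infConj d h (a i) : Mat d) ∈ SATuple.unitalCstar a) :
    h ∈ lieNormalizer (SATuple.unitalCstar a) := by
  have hgen : ∀ i, (h : Mat d) * a i - a i * h ∈ SATuple.unitalCstar a := fun i => by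
    have h1 := SMulMemClass.smul_mem (-Complex.I) (hh i)
    rw [coe_infConj, smul_smul] at h1
    simpa using h1
  intro x hx
  rw [SATuple.mem_unitalCstar] at hx
  induction hx using Algebra.adjoin_induction with
  | mem x h1 =>
    obtain ⟨i, rfl⟩ := h1
    exact hgen i
  | algebraMap r =>
    rw [Algebra.commutes, sub_self]
    exact zero_mem _
  | add x y hx hy ihx ihy =>
    have h1 := add_mem ihx ihy
    convert h1 using 1
    noncomm_ring
  | mul x y hx hy ihx ihy =>
    have hx1 := SATuple.mem_unitalCstar.mpr hx
    have hy1 := SATuple.mem_unitalCstar.mpr hy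
    have h1 := add_mem (mul_mem ihx hy1) (mul_mem hx1 ihy)
    convert h1 using 1
    noncomm_ring

/-- The map in whose coordinates the stratum through `a` becomes linear. -/
noncomputable def stratumParam (a : SATuple d n) (κ : SATuple d n →L[ℝ] selfAdjoint (Mat d)) :
    SATuple d n → SATuple d n :=
  fun v i => conjSA (expU (κ v)) (a i + v i - infConj d (κ v) (a i))

theorem stratumParam_zero (a : SATuple d n) (κ : SATuple d n →L[ℝ] selfAdjoint (Mat d)) :
    stratumParam a κ 0 = a := by
  funext i
  apply Subtype.ext
  rw [stratumParam, coe_conjSA, map_zero, selfAdjoint.expUnitary_zero]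
  simp

/-- The affine inner part of `stratumParam`. -/
noncomputable def stratumParamInner (a : SATuple d n) (κ : SATuple d n →L[ℝ] selfAdjoint (Mat d))
    (i : Fin (n + 1)) : SATuple d n →L[ℝ] Mat d :=
  LinearMap.toContinuousLinearMap
    ((selfAdjoint.submodule ℝ (Mat d)).subtype ∘ₗ
      (LinearMap.proj i - (LinearMap.flip (infConj d) (a i)) ∘ₗ (κ : SATuple d n →ₗ[ℝ] _)))

theorem stratumParamInner_apply (a : SATuple d n) (κ : SATuple d n →L[ℝ] selfAdjoint (Mat d))
    (i : Fin (n + 1)) (v : SATuple d n) :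
    stratumParamInner a κ i v = (v i : Mat d) - infConj d (κ v) (a i) := rfl

/-- This form makes calculus possible: products and exponentials are taken in the algebra `M_d`, and
the linear real part leads back to self-adjoint matrices. -/
theorem stratumParam_apply_eq (a : SATuple d n) (κ : SATuple d n →L[ℝ] selfAdjoint (Mat d))
    (v : SATuple d n) (i : Fin (n + 1)) :
    stratumParam a κ v i = realPartCLM d (NormedSpace.exp (((smulI d).comp κ) v) *
      ((a i : Mat d) + stratumParamInner a κ i v) * NormedSpace.exp ((-((smulI d).comp κ)) v)) := by
  have h : NormedSpace.exp (((smulI d).comp κ) v) *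
      ((a i : Mat d) + stratumParamInner a κ i v) * NormedSpace.exp ((-((smulI d).comp κ)) v) =
      (stratumParam a κ v i : Mat d) := by
    rw [stratumParam, coe_conjSA, coe_expUnitary_conjTranspose_eq, coe_expUnitary_eq,
      stratumParamInner_apply]
    congr 2
    rw [AddSubgroupClass.coe_sub, AddSubgroup.coe_add, add_sub_assoc]
  rw [h, realPartCLM_coe]

theorem contDiff_stratumParam (a : SATuple d n) (κ : SATuple d n →L[ℝ] selfAdjoint (Mat d)) :
    ContDiff ℝ ∞ (stratumParam a κ) := by
  refine contDiff_pi.mpr fun i => ?_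
  have h1 : ContDiff ℝ ∞ fun v => (a i : Mat d) + stratumParamInner a κ i v :=
    contDiff_const.add (by exact ContinuousLinearMap.contDiff (stratumParamInner a κ i))
  have h2 := ((contDiff_exp_comp ((smulI d).comp κ)).mul h1).mul
    (contDiff_exp_comp (-((smulI d).comp κ)))
  have h3 := (realPartCLM d).contDiff.comp h2
  have h4 : (fun v => stratumParam a κ v i) = _ := funext fun v => stratumParam_apply_eq a κ v i
  rw [h4]
  exact h3

theorem hasFDerivAt_const_add_apply {E F : Type*} [NormedAddCommGroup E] [NormedSpace ℝ E]
    [NormedAddCommGroup F] [NormedSpace ℝ F] (c : F) (T : E →L[ℝ] F) (x : E) :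
    HasFDerivAt (fun v => c + T v) T x :=
  T.hasFDerivAt.const_add c

/-- The subtracted commutator cancels the first-order effect of the conjugation on `a`, which leaves
the identity whatever `κ` is. -/
theorem hasFDerivAt_stratumParam (a : SATuple d n)
    (κ : SATuple d n →L[ℝ] selfAdjoint (Mat d)) :
    HasFDerivAt (stratumParam a κ) (ContinuousLinearMap.id ℝ (SATuple d n)) 0 := by
  refine (hasFDerivAt_pi' (𝕜 := ℝ) (Φ := stratumParam a κ)).mpr fun i => ?_
  have h1 := (hasStrictFDerivAt_exp_comp (E := SATuple d n) ((smulI d).comp κ)).hasFDerivAt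
  have h2 := (hasStrictFDerivAt_exp_comp (E := SATuple d n) (-((smulI d).comp κ))).hasFDerivAt
  have h3 : HasFDerivAt (fun v => (a i : Mat d) + stratumParamInner a κ i v)
      (stratumParamInner a κ i) 0 := by
    exact hasFDerivAt_const_add_apply (E := SATuple d n) (F := Mat d) _ _ _
  have h4 := (realPartCLM d).hasFDerivAt.comp (0 : SATuple d n) ((h1.mul' h3).mul' h2)
  have h6 : (fun v => stratumParam a κ v i) = _ := funext fun v => stratumParam_apply_eq a κ v i
  rw [h6]
  refine h4.congr_fderiv ?_
  ext1 v
  simp only [Pi.mul_apply, map_zero, NormedSpace.exp_zero, one_mul, add_zero]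
  change realPartCLM d ((a i : Mat d) * (-(smulI d (κ v))) +
    (1 * (stratumParamInner a κ i v) + smulI d (κ v) * (a i : Mat d)) * 1) = v i
  have h5 : (a i : Mat d) * (-(smulI d (κ v))) +
      (1 * (stratumParamInner a κ i v) + smulI d (κ v) * (a i : Mat d)) * 1 = (v i : Mat d) := by
    rw [stratumParamInner_apply, coe_infConj_eq]
    noncomm_ring
  rw [h5, realPartCLM_coe]

/-- Around `a`, the set of tuples generating a sub-C*-algebra unitarily equivalent to `C*₁(a)` is
a submanifold. -/
theorem exists_chart_at (a : SATuple d n) :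
    ∃ (φ : OpenPartialHomeomorph (SATuple d n) (SATuple d n)) (L : Submodule ℝ (SATuple d n)),
      a ∈ φ.source ∧ ContDiffOn ℝ ∞ φ φ.source ∧ ContDiffOn ℝ ∞ φ.symm φ.target ∧
      Module.finrank ℝ L + Module.finrank ℝ (lieNormalizer (SATuple.unitalCstar a)) =
        Module.finrank ℝ (selfAdjoint (Mat d)) +
          (n + 1) * Module.finrank ℝ (selfAdjointMem (SATuple.unitalCstar a)) ∧
      ∀ x ∈ φ.source, UnitarilyConj (SATuple.unitalCstar x) (SATuple.unitalCstar a) ↔ φ x ∈ L := by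
  set A := SATuple.unitalCstar a with hA
  obtain ⟨K, hNK⟩ := Submodule.exists_isCompl (lieNormalizer A)
  have hKN := hNK.symm
  -- The range of `D` is the tangent space of the stratum: `k` moves `a` along its orbit,
  -- transversally to the normalizer, and `β` moves it within `A`. `D` is injective, since a
  -- commutator of `k` with `a` lying in `A` makes `k` normalize `A`.
  let D : (K × (Fin (n + 1) → selfAdjointMem A)) →ₗ[ℝ] SATuple d n :=
    { toFun := fun q i => infConj d q.1 (a i) + q.2 i
      map_add' := fun q r => by
        funext i
        simp only [Prod.fst_add, Prod.snd_add, Pi.add_apply, Submodule.coe_add, map_add,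
          LinearMap.add_apply]
        abel
      map_smul' := fun c q => by
        funext i
        simp only [Prod.smul_fst, Prod.smul_snd, Pi.smul_apply, Submodule.coe_smul, map_smul,
          LinearMap.smul_apply, RingHom.id_apply, smul_add] }
  have hD : ∀ k β i, D (k, β) i = infConj d k (a i) + β i := fun k β i => rfl
  have hDinj : LinearMap.ker D = ⊥ := by
    rw [LinearMap.ker_eq_bot']
    rintro ⟨k, β⟩ h0
    have h1 : ∀ i, infConj d (k : selfAdjoint (Mat d)) (a i) = -(β i : selfAdjoint (Mat d)) :=
      fun i => eq_neg_of_add_eq_zero_left (congrFun h0 i)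
    have hk : (k : selfAdjoint (Mat d)) ∈ lieNormalizer A := by
      refine mem_lieNormalizer_of_infConj_mem fun i => ?_
      rw [h1]
      exact neg_mem (S := StarSubalgebra ℂ (Mat d)) (β i).2
    have hk0 : (k : selfAdjoint (Mat d)) = 0 := by
      have : (k : selfAdjoint (Mat d)) ∈ K ⊓ lieNormalizer A := ⟨k.2, hk⟩
      rwa [hKN.inf_eq_bot, Submodule.mem_bot] at this
    refine Prod.ext (Subtype.ext hk0) (funext fun i => Subtype.ext ?_)
    have := h1 i
    rw [hk0, map_zero, LinearMap.zero_apply] at this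
    exact neg_eq_zero.mp this.symm
  obtain ⟨g, hg⟩ := LinearMap.exists_leftInverse_of_injective D hDinj
  have hg' : ∀ q, g (D q) = q := fun q => LinearMap.congr_fun hg q
  -- An extension of the `K`-coordinate from the range of `D` to all tuples. With it, `stratumParam`
  -- sends `D (k, β)` to the conjugate of `a + β` by `exp(ik)`.
  let κ : SATuple d n →L[ℝ] selfAdjoint (Mat d) :=
    LinearMap.toContinuousLinearMap (K.subtype ∘ₗ LinearMap.fst ℝ K _ ∘ₗ g)
  have hκ : ∀ k β, κ (D (k, β)) = k := fun k β => by
    change (((g (D (k, β))).1 : K) : selfAdjoint (Mat d)) = k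
    rw [hg']
  let L : Submodule ℝ (SATuple d n) := LinearMap.range D
  let F := stratumParam a κ
  have hF : ContDiff ℝ ∞ F := contDiff_stratumParam a κ
  have hF0 : F 0 = a := stratumParam_zero a κ
  have hFd : HasFDerivAt F ((ContinuousLinearEquiv.refl ℝ (SATuple d n) :
      SATuple d n ≃L[ℝ] SATuple d n) : SATuple d n →L[ℝ] SATuple d n) 0 :=
    hasFDerivAt_stratumParam a κ
  have htop : (∞ : WithTop ℕ∞) ≠ 0 := by simp
  let ψ := hF.contDiffAt.toOpenPartialHomeomorph F hFd htop
  have hψ : ∀ v, ψ v = F v := fun v => rfl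
  have hψ0 : (0 : SATuple d n) ∈ ψ.source :=
    hF.contDiffAt.mem_toOpenPartialHomeomorph_source hFd htop
  -- points of the stratum near `a` lie in the image of `L`
  have hnear : ∀ᶠ x in nhds a, UnitarilyConj (SATuple.unitalCstar x) A →
      ∃ l ∈ L, l ∈ ψ.source ∧ F l = x := by
    -- The parameter that should yield the tuple `q.2` when the unitary is `exp(i q.1)`. Its
    -- continuity keeps the parameters found below inside the domain of `ψ`.
    let R : selfAdjoint (Mat d) × SATuple d n → SATuple d n := fun q i =>
      infConj d q.1 (a i) + (conjSA (expU q.1)⁻¹ (q.2 i) - a i)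
    have hR : ContinuousAt R (0, a) := by
      rw [continuousAt_pi]
      intro i
      have h1 : Continuous fun q : selfAdjoint (Mat d) × SATuple d n => infConj d q.1 (a i) :=
        (LinearMap.continuous_of_finiteDimensional
          (LinearMap.flip (infConj d) (a i))).comp continuous_fst
      have h2 : Continuous fun q : selfAdjoint (Mat d) × SATuple d n =>
          conjSA (expU q.1)⁻¹ (q.2 i) := by
        refine Continuous.subtype_mk ?_ _
        have h3 : Continuous fun q : selfAdjoint (Mat d) × SATuple d n =>
            (((expU q.1)⁻¹ : Matrix.unitaryGroup (Fin d) ℂ) : Mat d) :=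
          continuous_star.comp (continuous_subtype_val.comp
            (selfAdjoint.continuous_expUnitary.comp continuous_fst))
        exact (h3.mul (by fun_prop)).mul (continuous_star.comp h3)
      exact (h1.add (h2.sub continuous_const)).continuousAt
    have hR0 : R (0, a) = 0 := by
      funext i
      simp only [R]
      rw [map_zero, LinearMap.zero_apply, zero_add, Pi.zero_apply, sub_eq_zero]
      apply Subtype.ext
      rw [coe_conjSA, selfAdjoint.expUnitary_zero]
      simp
    have h1 : R ⁻¹' ψ.source ∈ nhds ((0, a) : selfAdjoint (Mat d) × SATuple d n) :=
      hR.preimage_mem_nhds (by rw [hR0]; exact ψ.open_source.mem_nhds hψ0)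
    rw [nhds_prod_eq] at h1
    obtain ⟨O, hO, O', hO', hOO⟩ := Filter.mem_prod_iff.mp h1
    obtain ⟨δ, hδ, hw⟩ := exists_expUnitary_mul_expUnitary hKN hO
    filter_upwards [hO', eventually_exists_conj_near a hδ] with x hx hx2 hconj
    obtain ⟨w, hw1, hwx⟩ := hx2 hconj
    obtain ⟨k, hkK, hkO, h, hhN, rfl⟩ := hw w hw1
    -- The factor `exp(ih)` of `w` preserves `A`, so it can be dropped: undoing `exp(ik)` alone
    -- already brings `x` into `A`.
    have hy : ∀ i, conjSA (expU k)⁻¹ (x i) ∈ selfAdjointMem A := fun i => by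
      rw [mem_selfAdjointMem, coe_conjSA, coe_inv_unitary, conjTranspose_conjTranspose]
      have h2 := conj_expUnitary_mem hhN (hwx i)
      rw [UnitaryGroup.mul_val, conjTranspose_mul] at h2
      have h3 : (expU h : Mat d) * ((expU h : Mat d)ᴴ * (expU k : Mat d)ᴴ * (x i : Mat d) *
          ((expU k : Mat d) * (expU h : Mat d))) * (expU h : Mat d)ᴴ =
          (expU k : Mat d)ᴴ * (x i : Mat d) * (expU k : Mat d) := by
        have h4 := conj_conjTranspose_conj (expU h)
          ((expU k : Mat d)ᴴ * (x i : Mat d) * (expU k : Mat d))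
        simpa only [Matrix.mul_assoc] using h4
      rwa [h3] at h2
    have hai : ∀ i, a i ∈ selfAdjointMem A := fun i => SATuple.apply_mem_unitalCstar a i
    let q : K × (Fin (n + 1) → selfAdjointMem A) :=
      (⟨k, hkK⟩, fun i => ⟨conjSA (expU k)⁻¹ (x i) - a i, Submodule.sub_mem _ (hy i) (hai i)⟩)
    have hqR : D q = R (k, x) := rfl
    refine ⟨D q, ⟨q, rfl⟩, ?_, ?_⟩
    · rw [hqR]
      exact hOO (Set.mk_mem_prod hkO hx)
    · funext i
      have h2 : κ (D q) = k := hκ _ _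
      simp only [F, stratumParam]
      rw [h2, hqR]
      simp only [R]
      have h3 : a i + (infConj d k (a i) + (conjSA (expU k)⁻¹ (x i) - a i)) - infConj d k (a i) =
          conjSA (expU k)⁻¹ (x i) := by abel
      rw [h3, ← conjSA_mul, mul_inv_cancel]
      apply Subtype.ext
      rw [coe_conjSA]
      simp
  -- the image of `L` near `a` lies in the stratum
  have hnear' : ∀ᶠ v in nhds (0 : SATuple d n), v ∈ L →
      UnitarilyConj (SATuple.unitalCstar (F v)) A := by
    -- The tuple before conjugation. On `L` it equals `a + β`, which lies in `A` and is close to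
    -- `a`, hence generates `A`.
    let B : SATuple d n → SATuple d n := fun v i => a i + v i - infConj d (κ v) (a i)
    have hB : ContinuousAt B 0 := by
      rw [continuousAt_pi]
      intro i
      have h1 : Continuous fun v : SATuple d n => infConj d (κ v) (a i) :=
        (LinearMap.continuous_of_finiteDimensional
          (LinearMap.flip (infConj d) (a i))).comp κ.continuous
      exact ((by fun_prop : Continuous fun v : SATuple d n => a i + v i).sub h1).continuousAt
    have hB0 : B 0 = a := by
      funext i
      simp [B]
    have h1 := hB.eventually (by rw [hB0]; exact SATuple.eventually_unitalCstar_eq a)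
    filter_upwards [h1] with v hv hvL
    obtain ⟨⟨k, β⟩, rfl⟩ := hvL
    have h2 : ∀ i, B (D (k, β)) i = a i + β i := fun i => by
      simp only [B]
      rw [hκ, hD]; abel
    have h3 : SATuple.unitalCstar (B (D (k, β))) = A := hv fun i => by
      rw [h2]
      exact add_mem (S := StarSubalgebra ℂ (Mat d)) (SATuple.apply_mem_unitalCstar a i) (β i).2
    have h4 := SATuple.unitalCstar_conjSA (expU (κ (D (k, β)))) (B (D (k, β)))
    change SATuple.unitalCstar (F (D (k, β))) = _ at h4
    rw [h4, h3]
    exact unitarilyConj_conjStarSubalgebra _ _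
  -- the domain of the chart
  have hinv : ∀ᶠ v in nhds (0 : SATuple d n),
      fderiv ℝ F v ∈ Set.range ((↑) : (SATuple d n ≃L[ℝ] SATuple d n) → _) := by
    have h1 : ContinuousAt (fderiv ℝ F) 0 := (hF.continuous_fderiv (by simp)).continuousAt
    exact h1.preimage_mem_nhds ((ContinuousLinearEquiv.isOpen (𝕜 := ℝ)
      (E := SATuple d n) (F := SATuple d n)).mem_nhds
      ⟨ContinuousLinearEquiv.refl ℝ _, hFd.fderiv.symm⟩)
  have hF0' : ContinuousAt F 0 := hF.continuous.continuousAt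
  have hdom : ∀ᶠ v in nhds (0 : SATuple d n),
      (fderiv ℝ F v ∈ Set.range ((↑) : (SATuple d n ≃L[ℝ] SATuple d n) → _)) ∧
      (v ∈ L → UnitarilyConj (SATuple.unitalCstar (F v)) A) ∧
      (UnitarilyConj (SATuple.unitalCstar (F v)) A → ∃ l ∈ L, l ∈ ψ.source ∧ F l = F v) :=
    hinv.and (hnear'.and (hF0'.eventually (by rw [hF0]; exact hnear)))
  obtain ⟨O, hO, hOo, h0O⟩ := eventually_nhds_iff.mp hdom
  let χ := (ψ.restrOpen O hOo).symm
  have hχs : ∀ x ∈ χ.source, χ x ∈ ψ.source ∧ χ x ∈ O := fun x hx => by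
    have := χ.map_source hx
    exact this
  have hχF : ∀ x ∈ χ.source, F (χ x) = x := fun x hx => χ.left_inv hx
  refine ⟨χ, L, ?_, ?_, ?_, ?_, ?_⟩
  · have h1 : (0 : SATuple d n) ∈ (ψ.restrOpen O hOo).source := ⟨hψ0, h0O⟩
    have := (ψ.restrOpen O hOo).map_source h1
    change (ψ.restrOpen O hOo) 0 ∈ _ at this
    have h2 : (ψ.restrOpen O hOo) 0 = a := hF0
    rwa [h2] at this
  · intro x hx
    obtain ⟨e, he⟩ := (hO _ (hχs x hx).2).1
    refine ContDiffAt.contDiffWithinAt ?_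
    refine (ψ.restrOpen O hOo).contDiffAt_symm (f₀' := e) hx ?_ hF.contDiffAt
    rw [he]
    exact (hF.differentiable (by simp)).differentiableAt.hasFDerivAt
  · exact hF.contDiffOn
  · have h1 : Module.finrank ℝ L = Module.finrank ℝ (K × (Fin (n + 1) → selfAdjointMem A)) :=
      LinearMap.finrank_range_of_inj (LinearMap.ker_eq_bot.mp hDinj)
    have h2 := Submodule.finrank_add_eq_of_isCompl hKN
    rw [h1, Module.finrank_prod, Module.finrank_pi_fintype]
    simp only [Finset.sum_const, Finset.card_univ, Fintype.card_fin, smul_eq_mul]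
    omega
  · intro x hx
    obtain ⟨hxs, hxO⟩ := hχs x hx
    have h1 := hO _ hxO
    constructor
    · intro hconj
      rw [← hχF x hx] at hconj
      obtain ⟨l, hlL, hls, hl⟩ := h1.2.2 hconj
      have : l = χ x := ψ.injOn hls hxs hl
      rwa [← this]
    · intro hL
      have := h1.2.1 hL
      rwa [hχF x hx] at this

end chart

/-! ### Dimensions -/

section dimension

variable {d : ℕ}

/-- Conjugation by a unitary, as a linear automorphism of the self-adjoint matrices. -/
def conjSAEquiv (u : Matrix.unitaryGroup (Fin d) ℂ) :
    selfAdjoint (Mat d) ≃ₗ[ℝ] selfAdjoint (Mat d) where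
  toFun := conjSA u
  map_add' := fun x y => Subtype.ext (by
    simp only [coe_conjSA, AddSubgroup.coe_add, mul_add, add_mul])
  map_smul' := fun r x => Subtype.ext (by
    simp only [coe_conjSA, selfAdjoint.val_smul, mul_smul_comm, smul_mul_assoc, RingHom.id_apply])
  invFun := conjSA u⁻¹
  left_inv := fun x => by
    rw [← conjSA_mul, inv_mul_cancel]
    exact conjSA_scalar (one_mem _) x
  right_inv := fun x => by
    rw [← conjSA_mul, mul_inv_cancel]
    exact conjSA_scalar (one_mem _) x

theorem coe_conjSAEquiv (u : Matrix.unitaryGroup (Fin d) ℂ) (x : selfAdjoint (Mat d)) :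
    (conjSAEquiv u x : Mat d) = u * x * (u : Mat d)ᴴ := rfl

theorem finrank_eq_of_conjSAEquiv (u : Matrix.unitaryGroup (Fin d) ℂ)
    {S T : Submodule ℝ (selfAdjoint (Mat d))} (h : ∀ x, conjSAEquiv u x ∈ S ↔ x ∈ T) :
    Module.finrank ℝ S = Module.finrank ℝ T := by
  have : S = T.map (conjSAEquiv u).toLinearMap := by
    ext x
    obtain ⟨y, rfl⟩ := (conjSAEquiv u).surjective x
    rw [h]
    constructor
    · exact fun hy => ⟨y, hy, rfl⟩
    · rintro ⟨z, hz, hzy⟩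
      rwa [← (conjSAEquiv u).injective hzy]
  rw [this]
  exact LinearEquiv.finrank_map_eq _ _

theorem UnitarilyConj.finrank_selfAdjointMem {A B : StarSubalgebra ℂ (Mat d)}
    (h : UnitarilyConj A B) :
    Module.finrank ℝ (selfAdjointMem A) = Module.finrank ℝ (selfAdjointMem B) := by
  obtain ⟨u, hu⟩ := unitarilyConj_iff.mp h
  exact finrank_eq_of_conjSAEquiv u fun x => hu x

theorem UnitarilyConj.finrank_lieNormalizer {A B : StarSubalgebra ℂ (Mat d)}
    (h : UnitarilyConj A B) :
    Module.finrank ℝ (lieNormalizer A) = Module.finrank ℝ (lieNormalizer B) := by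
  obtain ⟨u, hu⟩ := unitarilyConj_iff.mp h
  refine finrank_eq_of_conjSAEquiv u fun x => ?_
  have key : ∀ y : Mat d, (conjSAEquiv u x : Mat d) * (u * y * (u : Mat d)ᴴ) -
      (u * y * (u : Mat d)ᴴ) * (conjSAEquiv u x : Mat d) ∈ A ↔ (x : Mat d) * y - y * x ∈ B := by
    intro y
    rw [coe_conjSAEquiv, conj_mul_conj, conj_mul_conj, ← Matrix.sub_mul, ← Matrix.mul_sub, hu]
  rw [mem_lieNormalizer, mem_lieNormalizer]
  constructor
  · intro hx y hy
    exact (key y).mp (hx _ ((hu y).mpr hy))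
  · intro hx z hz
    rw [← conj_conjTranspose_conj u z] at hz ⊢
    exact (key _).mpr (hx _ ((hu _).mp hz))

/-- As a real space, `A` is the direct sum of its self-adjoint part and `i` times it. -/
theorem finrank_selfAdjointMem (A : StarSubalgebra ℂ (Mat d)) :
    Module.finrank ℝ (selfAdjointMem A) =
      Module.finrank ℂ (Subalgebra.toSubmodule A.toSubalgebra) := by
  let M := Subalgebra.toSubmodule A.toSubalgebra
  let T : (selfAdjointMem A × selfAdjointMem A) →ₗ[ℝ] M :=
    { toFun := fun q => ⟨(q.1 : Mat d) + Complex.I • (q.2 : Mat d),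
        add_mem (S := Submodule ℂ (Mat d)) q.1.2 (Submodule.smul_mem M _ q.2.2)⟩
      map_add' := fun q r => Subtype.ext (by
        simp only [Prod.fst_add, Prod.snd_add, Submodule.coe_add, AddSubgroup.coe_add, smul_add]
        abel)
      map_smul' := fun r q => Subtype.ext (by
        change _ = r • ((q.1 : Mat d) + Complex.I • (q.2 : Mat d))
        simp only [Prod.smul_fst, Prod.smul_snd, Submodule.coe_smul, selfAdjoint.val_smul, smul_add]
        rw [smul_comm]) }
  have hT : Function.Bijective T := by
    constructor
    · rw [← LinearMap.ker_eq_bot, LinearMap.ker_eq_bot']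
      rintro ⟨⟨x, hx⟩, ⟨y, hy⟩⟩ h
      have h1 : (x : Mat d) + Complex.I • (y : Mat d) = 0 := congrArg Subtype.val h
      have h2 := congrArg star h1
      rw [star_add, star_smul, x.2.star_eq, y.2.star_eq, Complex.star_def, Complex.conj_I,
        star_zero] at h2
      have h3 : (x : Mat d) = 0 := by
        have h4 : (2 : ℂ) • (x : Mat d) = 0 := by
          rw [two_smul]
          calc (x : Mat d) + x = (x + Complex.I • (y : Mat d)) + (x + -Complex.I • (y : Mat d)) := by
                rw [neg_smul]; abel
            _ = 0 := by rw [h1, h2, add_zero]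
        exact (smul_eq_zero.mp h4).resolve_left two_ne_zero
      rw [h3, zero_add] at h1
      have h5 : (y : Mat d) = 0 := (smul_eq_zero.mp h1).resolve_left Complex.I_ne_zero
      ext1 <;> exact Subtype.ext (Subtype.ext (by assumption))
    · rintro ⟨x, hx⟩
      have hr : ∀ z : Mat d, z ∈ A → (realPart z : Mat d) ∈ A := fun z hz => by
        rw [realPart_apply_coe, ← Complex.coe_smul]
        exact SMulMemClass.smul_mem _ (add_mem hz (star_mem hz))
      have hi : (imaginaryPart x : Mat d) ∈ A := by
        have h := hr ((-Complex.I) • x) (SMulMemClass.smul_mem _ hx)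
        rwa [neg_smul, map_neg, realPart_I_smul, neg_neg] at h
      exact ⟨(⟨realPart x, hr x hx⟩, ⟨imaginaryPart x, hi⟩),
        Subtype.ext (realPart_add_I_smul_imaginaryPart x)⟩
  have h1 := (LinearEquiv.ofBijective T hT).finrank_eq
  have h2 : Module.finrank ℝ M = 2 * Module.finrank ℂ M := finrank_real_of_complex M
  rw [Module.finrank_prod] at h1
  change _ = Module.finrank ℂ M
  omega

theorem finrank_selfAdjoint (d : ℕ) : Module.finrank ℝ (selfAdjoint (Mat d)) = d ^ 2 := by
  have h1 : selfAdjointMem (⊤ : StarSubalgebra ℂ (Mat d)) = ⊤ := by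
    ext x
    exact ⟨fun _ => trivial, fun _ => trivial⟩
  have h2 := finrank_selfAdjointMem (⊤ : StarSubalgebra ℂ (Mat d))
  have h3 : Subalgebra.toSubmodule (⊤ : StarSubalgebra ℂ (Mat d)).toSubalgebra = ⊤ := by
    ext x
    exact ⟨fun _ => trivial, fun _ => trivial⟩
  rw [h1, h3, finrank_top, finrank_top, Module.finrank_matrix] at h2
  rw [h2]
  simp [sq]

theorem finrank_saTuple (d n : ℕ) : Module.finrank ℝ (SATuple d n) = (n + 1) * d ^ 2 := by
  rw [Module.finrank_pi_fintype, Finset.sum_const, finrank_selfAdjoint]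
  simp

namespace BlockType

/-- The block-diagonal matrix, as a linear function of the blocks. -/
def blockMatrixLin (t : BlockType d) : (∀ j : Fin t.L, Mat (t.size j)) →ₗ[ℂ] Mat d :=
  { toFun := t.blockMatrix
    map_add' := fun b c => by
      refine t.ext_block fun j i j' i' => ?_
      change _ = t.block (t.blockMatrix b) j i j' i' + t.block (t.blockMatrix c) j i j' i'
      by_cases hj : j = j'
      · subst hj
        by_cases hi : i = i'
        · subst hi
          simp only [block_blockMatrix_self, Pi.add_apply]
        · simp only [block_blockMatrix_of_ne_copy _ _ hi, add_zero]
      · simp only [block_blockMatrix_of_ne _ _ hj, add_zero]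
    map_smul' := fun r b => by
      refine t.ext_block fun j i j' i' => ?_
      change _ = r • t.block (t.blockMatrix b) j i j' i'
      by_cases hj : j = j'
      · subst hj
        by_cases hi : i = i'
        · subst hi
          simp only [block_blockMatrix_self, Pi.smul_apply]
        · simp only [block_blockMatrix_of_ne_copy _ _ hi, smul_zero]
      · simp only [block_blockMatrix_of_ne _ _ hj, smul_zero] }

theorem finrank_selfAdjointMem_algebra (t : BlockType d) :
    Module.finrank ℝ (selfAdjointMem t.algebra) = ∑ j, t.size j ^ 2 := by
  have h1 : Subalgebra.toSubmodule t.algebra.toSubalgebra = LinearMap.range t.blockMatrixLin := by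
    ext x
    exact Iff.rfl
  rw [finrank_selfAdjointMem, h1, LinearMap.finrank_range_of_inj t.blockMatrix_injective,
    Module.finrank_pi_fintype]
  refine Finset.sum_congr rfl fun j _ => ?_
  rw [Module.finrank_matrix]
  simp [sq]

/-- If all multiplicities are one, the block algebra is its own normalizer. -/
theorem lieNormalizer_algebra_le (t : BlockType d) (hm : ∀ j, t.mult j = 1) :
    lieNormalizer t.algebra ≤ selfAdjointMem t.algebra := by
  intro h hh
  -- These are the central projections of the block algebra. The commutator of `h` with one of them
  -- lies in the algebra but has vanishing diagonal blocks, so it is zero, and `h` has no blocks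
  -- between different summands.
  let e : Fin t.L → ∀ j : Fin t.L, Mat (t.size j) := fun k j => if j = k then 1 else 0
  have hcomm : ∀ k, (h : Mat d) * t.blockMatrix (e k) = t.blockMatrix (e k) * h := by
    intro k
    obtain ⟨b, hb⟩ := hh _ (t.blockMatrix_mem (e k))
    have hb0 : b = 0 := by
      funext j
      have i : Fin (t.mult j) := ⟨0, t.mult_pos j⟩
      rw [← t.block_blockMatrix_self b j i, hb]
      change t.block ((h : Mat d) * t.blockMatrix (e k)) j i j i -
        t.block (t.blockMatrix (e k) * (h : Mat d)) j i j i = 0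
      rw [block_mul_blockMatrix, blockMatrix_mul_block]
      by_cases hj : j = k <;> simp [e, hj]
    have h0 : t.blockMatrix 0 = 0 := map_zero t.blockMatrixLin
    rw [hb0, h0] at hb
    exact (sub_eq_zero.mp hb.symm)
  have hoff : ∀ j i j' i', j ≠ j' → t.block (h : Mat d) j i j' i' = 0 := by
    intro j i j' i' hj
    have h1 := congrArg (fun c => t.block c j i j' i') (hcomm j)
    simp only [block_mul_blockMatrix, blockMatrix_mul_block, e, if_neg hj.symm, if_true,
      Matrix.mul_zero, Matrix.one_mul] at h1
    exact h1.symm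
  refine ⟨fun j => t.block (h : Mat d) j ⟨0, t.mult_pos j⟩ j ⟨0, t.mult_pos j⟩, ?_⟩
  refine t.ext_block fun j i j' i' => ?_
  have hi : ∀ j (i : Fin (t.mult j)), i = ⟨0, t.mult_pos j⟩ := fun j i => by
    apply Fin.ext
    have := i.2
    have := hm j
    simp only
    omega
  by_cases hj : j = j'
  · subst hj
    rw [hi j i, hi j i', block_blockMatrix_self]
  · rw [block_blockMatrix_of_ne _ _ hj, hoff _ _ _ _ hj]

/-- A single summand of multiplicity at least two has size at most `d/2`. With several summands,
compare the first size `s` with the sum `R` of the others: `s, R ≥ 1`, `s + R ≤ d` and `sR ≥ s + R -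
1`. -/
theorem sum_size_sq_le (hd : 2 ≤ d) (t : BlockType d) (ht : ¬ t.Equivalent (generic d hd)) :
    ∑ j, t.size j ^ 2 + 2 * (d - 1) ≤ d ^ 2 := by
  obtain ⟨L, s, m, hL, hs, hm, hsum⟩ := t
  simp only
  obtain ⟨l, rfl⟩ : ∃ l, L = l + 1 := ⟨L - 1, by omega⟩
  obtain ⟨c, rfl⟩ : ∃ c, d = c + 2 := ⟨d - 2, by omega⟩
  rw [Fin.sum_univ_succ] at hsum ⊢
  have hs0 := hs 0
  have hm0 := hm 0
  have hle : ∀ j : Fin l, s j.succ ≤ m j.succ * s j.succ := fun j =>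
    Nat.le_mul_of_pos_left _ (hm j.succ)
  have h1 : ∑ j : Fin l, s j.succ ≤ ∑ j : Fin l, m j.succ * s j.succ :=
    Finset.sum_le_sum fun j _ => hle j
  have h2 : ∑ j : Fin l, s j.succ ^ 2 ≤ (∑ j : Fin l, s j.succ) ^ 2 :=
    Finset.sum_sq_le_sq_sum_of_nonneg fun j _ => Nat.zero_le _
  have hl : l ≤ ∑ j : Fin l, s j.succ := by
    calc l = ∑ _j : Fin l, 1 := by simp
      _ ≤ _ := Finset.sum_le_sum fun j _ => hs j.succ
  set R := ∑ j : Fin l, s j.succ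
  have hc : c + 2 - 1 = c + 1 := by omega
  rw [hc]
  rcases Nat.eq_zero_or_pos l with rfl | hl0
  · have hR : R = 0 := by simp [R]
    have hms : m 0 * s 0 = c + 2 := by simpa using hsum
    by_cases hm1 : m 0 = 1
    · refine absurd ?_ ht
      refine ⟨Equiv.refl _, fun j => ?_⟩
      change Fin 1 at j
      have hj : j = 0 := Subsingleton.elim _ _
      subst hj
      rw [hm1, one_mul] at hms
      exact ⟨hms, hm1⟩
    · have h3 : 2 * s 0 ≤ c + 2 := by
        rw [← hms]
        exact Nat.mul_le_mul_right _ (by omega)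
      have h4 : ∑ j : Fin 0, s j.succ ^ 2 = 0 := by simp
      rw [h4]
      nlinarith
  · have h3 : s 0 + R ≤ c + 2 := by
      have : s 0 ≤ m 0 * s 0 := Nat.le_mul_of_pos_left _ hm0
      omega
    have hR1 : 1 ≤ R := by omega
    nlinarith [Nat.mul_le_mul hs0 hR1, mul_le_mul h3 h3 (Nat.zero_le _) (Nat.zero_le _)]

theorem sum_size_sq_corner (hd : 2 ≤ d) :
    ∑ j, (corner d hd).size j ^ 2 + 2 * (d - 1) = d ^ 2 := by
  change ∑ j : Fin 2, (![d - 1, 1] : Fin 2 → ℕ) j ^ 2 + 2 * (d - 1) = d ^ 2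
  obtain ⟨c, rfl⟩ : ∃ c, d = c + 2 := ⟨d - 2, by omega⟩
  have hc : c + 2 - 1 = c + 1 := by omega
  rw [Fin.sum_univ_two, hc]
  simp only [Matrix.cons_val_zero, Matrix.cons_val_one]
  ring

theorem corner_mult (hd : 2 ≤ d) (j : Fin (corner d hd).L) : (corner d hd).mult j = 1 := by
  change Fin 2 at j
  fin_cases j <;> rfl

end BlockType

/-- Each stratum is a smooth submanifold. -/
theorem isSmoothSubmanifold_typeStratum (n : ℕ) (t : BlockType d) {k : ℕ}
    (hk : k + Module.finrank ℝ (lieNormalizer t.algebra) =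
      d ^ 2 + (n + 1) * ∑ j, t.size j ^ 2) : IsSmoothSubmanifold k (typeStratum n t) := by
  intro p hp
  obtain ⟨φ, L, hpφ, h1, h2, h3, h4⟩ := exists_chart_at p
  refine ⟨φ, L, hpφ, h1, h2, ?_, fun x hx => ?_⟩
  · rw [UnitarilyConj.finrank_selfAdjointMem hp, UnitarilyConj.finrank_lieNormalizer hp,
      finrank_selfAdjoint, t.finrank_selfAdjointMem_algebra] at h3
    omega
  · rw [← h4 x hx]
    exact ⟨fun h => UnitarilyConj.trans h (UnitarilyConj.symm hp),
      fun h => UnitarilyConj.trans h hp⟩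

/-- The normalizer contains the self-adjoint part of the algebra, so the dimension is at most `d² +
n ∑ d_j²`, and `sum_size_sq_le` bounds the sum. -/
theorem exists_isSmoothSubmanifold_typeStratum (n : ℕ) (hd : 2 ≤ d) (t : BlockType d)
    (ht : ¬ t.Equivalent (BlockType.generic d hd)) :
    ∃ k : ℕ, (k : ℤ) ≤ (n + 1) * d ^ 2 - 2 * n * (d - 1) ∧
      IsSmoothSubmanifold k (typeStratum n t) := by
  have h1 : Module.finrank ℝ (lieNormalizer t.algebra) ≤ d ^ 2 := by
    rw [← finrank_selfAdjoint]
    exact Submodule.finrank_le _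
  have h2 : ∑ j, t.size j ^ 2 ≤ Module.finrank ℝ (lieNormalizer t.algebra) := by
    rw [← t.finrank_selfAdjointMem_algebra]
    exact Submodule.finrank_mono (selfAdjointMem_le_lieNormalizer _)
  obtain ⟨k, hk⟩ : ∃ k, k + Module.finrank ℝ (lieNormalizer t.algebra) =
      d ^ 2 + (n + 1) * ∑ j, t.size j ^ 2 :=
    ⟨d ^ 2 + (n + 1) * ∑ j, t.size j ^ 2 - Module.finrank ℝ (lieNormalizer t.algebra), by
      omega⟩
  refine ⟨k, ?_, isSmoothSubmanifold_typeStratum n t hk⟩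
  have h3 := t.sum_size_sq_le hd ht
  obtain ⟨c, rfl⟩ : ∃ c, d = c + 1 := ⟨d - 1, by omega⟩
  rw [Nat.add_sub_cancel] at h3
  have h4 : k ≤ (c + 1) ^ 2 + n * ∑ j, t.size j ^ 2 := by
    rw [add_mul, one_mul] at hk
    omega
  have h5 := Nat.mul_le_mul_left n h3
  rw [mul_add] at h5
  zify at h4 h5 ⊢
  nlinarith

/-- Both estimates behind the general bound are sharp here: the multiplicities are one, so the
algebra is its own normalizer, and `(d-1)² + 1 = d² - 2(d-1)`. -/
theorem exists_isSmoothSubmanifold_corner (n : ℕ) (hd : 2 ≤ d) :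
    ∃ k : ℕ, k + 2 * n * (d - 1) = (n + 1) * d ^ 2 ∧
      IsSmoothSubmanifold k (typeStratum n (BlockType.corner d hd)) := by
  set t := BlockType.corner d hd with ht
  have h1 : Module.finrank ℝ (lieNormalizer t.algebra) = ∑ j, t.size j ^ 2 := by
    rw [← t.finrank_selfAdjointMem_algebra]
    exact congrArg (fun S : Submodule ℝ (selfAdjoint (Mat d)) => Module.finrank ℝ S)
      (le_antisymm (t.lieNormalizer_algebra_le (BlockType.corner_mult hd))
        (selfAdjointMem_le_lieNormalizer _))
  have h2 := BlockType.sum_size_sq_corner hd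
  rw [← ht] at h2
  refine ⟨d ^ 2 + n * ∑ j, t.size j ^ 2, ?_, isSmoothSubmanifold_typeStratum n t ?_⟩
  · have := congrArg (fun z => n * z) h2
    simp only [mul_add] at this
    rw [mul_comm 2 n, mul_assoc, add_assoc, this]
    ring
  · rw [h1]
    ring

end dimension

/-! ### The unitary group is connected -/

section unitary

variable {d : ℕ}

/-- The scalar unitary `z 1`. -/
def circleUnitary (d : ℕ) (z : Circle) : Matrix.unitaryGroup (Fin d) ℂ :=
  ⟨(z : ℂ) • 1, by
    rw [Matrix.mem_unitaryGroup_iff, star_smul, star_one, smul_mul_smul_comm, one_mul,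
      Complex.star_def, ← Circle.coe_inv_eq_conj, ← Circle.coe_mul, mul_inv_cancel, Circle.coe_one,
      one_smul]⟩

theorem continuous_circleUnitary (d : ℕ) : Continuous (circleUnitary d) :=
  Continuous.subtype_mk ((continuous_subtype_val (p := fun z : ℂ => z ∈ Submonoid.unitSphere ℂ)).smul continuous_const) _

/-- The norm bound says that `-1` is not in the spectrum. The spectrum of `u` is finite, so some `w`
on the circle misses it, and multiplying by `-w⁻¹` rotates this gap to `-1`. -/
theorem exists_circle_norm_smul_sub_one_lt (u : Matrix.unitaryGroup (Fin d) ℂ) :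
    ∃ z : Circle, ‖((circleUnitary d z * u : Matrix.unitaryGroup (Fin d) ℂ) : Mat d) - 1‖ < 2 := by
  have hinf : (Set.univ : Set Circle).Infinite :=
    isPreconnected_univ.infinite_of_nontrivial
      ⟨1, trivial, -1, trivial, fun h => by
        have := congrArg (fun w : Circle => (w : ℂ)) h
        norm_num at this⟩
  have hfin := (Matrix.finite_spectrum (R := ℂ) (u : Mat d)).preimage
    (f := fun z : Circle => (z : ℂ)) Subtype.val_injective.injOn
  obtain ⟨w, -, hw⟩ := hinf.exists_notMem_finite hfin
  refine ⟨-w⁻¹, ?_⟩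
  rw [Unitary.norm_sub_one_lt_two_iff (circleUnitary d (-w⁻¹) * u).2]
  intro h
  apply hw
  have hne : ((-w⁻¹ : Circle) : ℂ) ≠ 0 := Circle.coe_ne_zero _
  have h1 : ((circleUnitary d (-w⁻¹) * u : Matrix.unitaryGroup (Fin d) ℂ) : Mat d) =
      Units.mk0 _ hne • (u : Mat d) := by
    change (((-w⁻¹ : Circle) : ℂ) • (1 : Mat d)) * (u : Mat d) = ((-w⁻¹ : Circle) : ℂ) • (u : Mat d)
    rw [smul_mul_assoc, one_mul]
  have h2 : (-1 : ℂ) = Units.mk0 _ hne • (w : ℂ) := by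
    change _ = ((-w⁻¹ : Circle) : ℂ) • (w : ℂ)
    have h3 : (w : ℂ) ≠ 0 := Circle.coe_ne_zero _
    simp [h3]
  rw [h1, h2, spectrum.smul_mem_smul_iff] at h
  exact h

instance unitaryGroup_pathConnectedSpace (d : ℕ) :
    PathConnectedSpace (Matrix.unitaryGroup (Fin d) ℂ) := by
  have key : ∀ u : Matrix.unitaryGroup (Fin d) ℂ, Joined u 1 := fun u => by
    obtain ⟨z, hz⟩ := exists_circle_norm_smul_sub_one_lt u
    have h1 : Joined (circleUnitary d z * u) 1 := (Unitary.joined 1 _ hz).symm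
    have h2 : Joined (circleUnitary d 1 * u) (circleUnitary d z * u) :=
      (PathConnectedSpace.joined (1 : Circle) z).map
        (f := fun w => circleUnitary d w * u)
        ((continuous_circleUnitary d).mul continuous_const)
    have h3 : circleUnitary d 1 * u = u := by
      apply Subtype.ext
      change (((1 : Circle) : ℂ) • (1 : Mat d)) * (u : Mat d) = u
      simp
    rw [h3] at h2
    exact h2.trans h1
  exact ⟨⟨1⟩, fun u v => (key u).trans (key v).symm⟩

end unitary

/-! ### Normal forms of hermitian matrices -/

section hermitian

/-- The hermitian matrix with the given entries above and real parts of entries on the diagonal. -/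
noncomputable def hermitianOf {s : ℕ} (z : Fin s → Fin s → ℂ) : Mat s :=
  Matrix.of fun x y => if x < y then z x y else if y < x then star (z y x) else ((z x x).re : ℂ)

theorem hermitianOf_isHermitian {s : ℕ} (z : Fin s → Fin s → ℂ) : (hermitianOf z)ᴴ = hermitianOf z := by
  ext x y
  rw [conjTranspose_apply]
  simp only [hermitianOf, of_apply]
  rcases lt_trichotomy x y with h | rfl | h
  · rw [if_neg h.not_gt, if_pos h, if_pos h, star_star]
  · simp
  · rw [if_pos h, if_neg h.not_gt, if_pos h]

theorem hermitianOf_eq {s : ℕ} {b : Mat s} (hb : bᴴ = b) : hermitianOf (fun x y => b x y) = b := by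
  have h : ∀ x y, star (b y x) = b x y := fun x y => congrFun₂ hb x y
  ext x y
  simp only [hermitianOf, of_apply]
  rcases lt_trichotomy x y with hxy | rfl | hxy
  · rw [if_pos hxy]
  · rw [if_neg (lt_irrefl _), if_neg (lt_irrefl _)]
    exact Complex.conj_eq_iff_re.mp (h x x)
  · rw [if_neg hxy.not_gt, if_pos hxy, h]

theorem hermitianOf_ne_zero {s : ℕ} {z : Fin s → Fin s → ℂ} (hz : ∀ x y, x ≠ y → z x y ≠ 0)
    {x y : Fin s} (hxy : x ≠ y) : hermitianOf z x y ≠ 0 := by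
  simp only [hermitianOf, of_apply]
  rcases hxy.lt_or_gt with h | h
  · rw [if_pos h]; exact hz x y hxy
  · rw [if_neg h.not_gt, if_pos h]
    exact star_ne_zero.mpr (hz y x hxy.symm)

theorem trace_hermitianOf {s : ℕ} (z : Fin s → Fin s → ℂ) :
    (hermitianOf z).trace = ((∑ x, (z x x).re : ℝ) : ℂ) := by
  simp [Matrix.trace, hermitianOf]

theorem continuous_hermitianOf {s : ℕ} :
    Continuous (hermitianOf : (Fin s → Fin s → ℂ) → Mat s) := by
  refine continuous_matrix fun x y => ?_
  simp only [hermitianOf, of_apply]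
  split_ifs
  · fun_prop
  · exact continuous_star.comp (by fun_prop)
  · exact Complex.continuous_ofReal.comp (Complex.continuous_re.comp (by fun_prop))

/-- Unitary diagonalization with increasing eigenvalues. -/
theorem exists_unitary_diagonal_monotone {s : ℕ} {b : Mat s} (hb : bᴴ = b) :
    ∃ (v : Matrix.unitaryGroup (Fin s) ℂ) (l : Fin s → ℝ), Monotone l ∧
      b = v * diagonal (fun x => (l x : ℂ)) * (v : Mat s)ᴴ := by
  have hH : b.IsHermitian := hb
  let σ := Tuple.sort hH.eigenvalues
  let U := hH.eigenvectorUnitary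
  have hv : ((U : Mat s).submatrix id σ) ∈ Matrix.unitaryGroup (Fin s) ℂ := by
    rw [Matrix.mem_unitaryGroup_iff, star_eq_conjTranspose, conjTranspose_submatrix,
      Matrix.submatrix_mul_equiv, coe_mul_conjTranspose_self]
    ext x y
    simp [Matrix.one_apply]
  refine ⟨⟨_, hv⟩, hH.eigenvalues ∘ σ, Tuple.monotone_sort _, ?_⟩
  have h1 : diagonal (fun x => (((hH.eigenvalues ∘ σ) x : ℝ) : ℂ)) =
      (diagonal (fun x => (hH.eigenvalues x : ℂ))).submatrix σ σ :=
    (Matrix.submatrix_diagonal_equiv (fun x => (hH.eigenvalues x : ℂ)) σ).symm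
  rw [h1, conjTranspose_submatrix, Matrix.submatrix_mul_equiv, Matrix.submatrix_mul_equiv]
  have h2 := hH.spectral_theorem
  rw [Unitary.conjStarAlgAut_apply] at h2
  exact h2

/-- A matrix that commutes with a diagonal matrix with distinct entries and with a matrix without
vanishing off-diagonal entries is scalar. -/
theorem exists_eq_smul_one {s : ℕ} {l : Fin s → ℝ} (hl : Function.Injective l) {b : Mat s}
    (hb : ∀ x y, x ≠ y → b x y ≠ 0) {X : Mat s}
    (h1 : diagonal (fun x => (l x : ℂ)) * X = X * diagonal (fun x => (l x : ℂ)))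
    (h2 : b * X = X * b) : ∃ z : ℂ, X = z • 1 := by
  have hoff : ∀ x y, x ≠ y → X x y = 0 := fun x y hxy => by
    have h := congrFun₂ h1 x y
    rw [Matrix.diagonal_mul, Matrix.mul_diagonal, mul_comm, ← sub_eq_zero, ← mul_sub] at h
    refine (mul_eq_zero.mp h).resolve_right fun h0 => hxy (hl ?_)
    exact_mod_cast sub_eq_zero.mp h0
  have hdiag : X = diagonal fun x => X x x := by
    ext x y
    by_cases hxy : x = y
    · subst hxy; simp
    · rw [hoff x y hxy, Matrix.diagonal_apply_ne _ hxy]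
  have heq : ∀ x y, X x x = X y y := fun x y => by
    by_cases hxy : x = y
    · rw [hxy]
    · have h := congrFun₂ h2 x y
      rw [hdiag, Matrix.diagonal_mul, Matrix.mul_diagonal, mul_comm (b x y)] at h
      exact (mul_right_cancel₀ (hb x y hxy) h).symm
  rcases isEmpty_or_nonempty (Fin s) with h | ⟨⟨x₀⟩⟩
  · exact ⟨0, Subsingleton.elim _ _⟩
  · refine ⟨X x₀ x₀, ?_⟩
    rw [hdiag]
    ext x y
    by_cases hxy : x = y
    · subst hxy; simpa using heq x x₀
    · simp [hxy]

theorem intertwiner_mul_conjTranspose {s r : ℕ} {b : Mat s} {c : Mat r} (hb : bᴴ = b) (hc : cᴴ = c)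
    {X : Matrix (Fin s) (Fin r) ℂ} (h : b * X = X * c) :
    b * (X * Xᴴ) = X * Xᴴ * b ∧ c * (Xᴴ * X) = Xᴴ * X * c := by
  have h' : Xᴴ * b = c * Xᴴ := by
    have := congrArg conjTranspose h
    rwa [conjTranspose_mul, conjTranspose_mul, hb, hc] at this
  constructor
  · rw [← Matrix.mul_assoc, h, Matrix.mul_assoc, ← h', Matrix.mul_assoc]
  · rw [← Matrix.mul_assoc, ← h', Matrix.mul_assoc, h, Matrix.mul_assoc]

open ComplexOrder in
/-- A nonzero intertwiner of two irreducible families of hermitian matrices preserves the traces. -/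
theorem trace_eq_of_intertwiner {s r : ℕ} {X : Matrix (Fin s) (Fin r) ℂ} (hX : X ≠ 0)
    (h1 : ∃ z : ℂ, X * Xᴴ = z • 1) (h2 : ∃ w : ℂ, Xᴴ * X = w • 1) {b : Mat s} {c : Mat r}
    (h : b * X = X * c) : b.trace = c.trace := by
  obtain ⟨z, hz⟩ := h1
  obtain ⟨w, hw⟩ := h2
  have hzw : z = w := by
    have h3 : z • X = w • X := by
      calc z • X = (X * Xᴴ) * X := by rw [hz, Matrix.smul_mul, Matrix.one_mul]
        _ = w • X := by rw [Matrix.mul_assoc, hw, Matrix.mul_smul, Matrix.mul_one]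
    exact smul_left_injective ℂ hX h3
  have hz0 : z ≠ 0 := by
    rintro rfl
    rw [zero_smul] at hz
    exact hX (Matrix.self_mul_conjTranspose_eq_zero.mp hz)
  have h4 : z * b.trace = z * c.trace := by
    calc z * b.trace = (b * (X * Xᴴ)).trace := by
          rw [hz, Matrix.mul_smul, Matrix.mul_one, Matrix.trace_smul, smul_eq_mul]
      _ = (X * (c * Xᴴ)).trace := by rw [← Matrix.mul_assoc, h, Matrix.mul_assoc]
      _ = (c * (Xᴴ * X)).trace := by
          rw [Matrix.trace_mul_comm, Matrix.mul_assoc]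
      _ = z * c.trace := by
          rw [hw, Matrix.mul_smul, Matrix.mul_one, Matrix.trace_smul, smul_eq_mul, hzw]
  exact mul_left_cancel₀ hz0 h4

end hermitian

/-! ### The strata are connected -/

namespace BlockType

variable {d : ℕ} (t : BlockType d)

theorem conjTranspose_blockMatrix (b : ∀ j : Fin t.L, Mat (t.size j)) :
    (t.blockMatrix b)ᴴ = t.blockMatrix fun j => (b j)ᴴ := by
  simp only [blockMatrix, Matrix.coe_reindexAlgEquiv,
    Matrix.conjTranspose_reindex, Matrix.blockDiagonal'_conjTranspose,
    Matrix.blockDiagonal_conjTranspose]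

theorem blockMatrix_mul (b c : ∀ j : Fin t.L, Mat (t.size j)) :
    t.blockMatrix b * t.blockMatrix c = t.blockMatrix (fun j => b j * c j) := by
  simp only [blockMatrix, ← map_mul, ← Matrix.blockDiagonal'_mul, ← Matrix.blockDiagonal_mul]

theorem blockMatrix_one : t.blockMatrix (fun _ => 1) = 1 := by
  obtain ⟨b, hb⟩ := one_mem t.algebra
  have h := t.blockMatrix_mul (fun _ => 1) b
  simp only [one_mul] at h
  rw [hb, mul_one] at h
  exact h.trans (by rw [← hb])

/-- Parameters for a tuple of hermitian block matrices: the real diagonals of the blocks of the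
first entry, and the upper triangles of the blocks of the others. -/
abbrev Params (n : ℕ) : Type :=
  (∀ j : Fin t.L, Fin (t.size j) → ℝ) ×
    (Fin (n + 1) → ∀ j : Fin t.L, Fin (t.size j) → Fin (t.size j) → ℂ)

variable {t} {n : ℕ}

/-- The blocks with given parameters. -/
noncomputable def Params.blocks (p : t.Params n) (i : Fin (n + 1)) (j : Fin t.L) :
    Mat (t.size j) :=
  if i = 0 then diagonal (fun x => (p.1 j x : ℂ)) else hermitianOf (p.2 i j)

theorem Params.conjTranspose_blocks (p : t.Params n) (i : Fin (n + 1)) (j : Fin t.L) :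
    (p.blocks i j)ᴴ = p.blocks i j := by
  unfold Params.blocks
  split_ifs
  · rw [diagonal_conjTranspose]
    congr 1
    funext x
    exact Complex.conj_ofReal _
  · exact hermitianOf_isHermitian _

/-- The tuple of block matrices with given parameters. -/
noncomputable def Params.tuple (p : t.Params n) : SATuple d n := fun i =>
  ⟨t.blockMatrix (p.blocks i), by
    rw [selfAdjoint.mem_iff, star_eq_conjTranspose, conjTranspose_blockMatrix]
    exact congrArg _ (funext fun j => p.conjTranspose_blocks i j)⟩

theorem Params.continuous_tuple : Continuous (Params.tuple : t.Params n → SATuple d n) := by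
  refine continuous_pi fun i => Continuous.subtype_mk ?_ _
  refine (LinearMap.continuous_of_finiteDimensional t.blockMatrixLin).comp ?_
  refine continuous_pi fun j => ?_
  by_cases hi : i = 0
  · simp only [Params.blocks, if_pos hi]
    exact Continuous.matrix_diagonal (by fun_prop)
  · simp only [Params.blocks, if_neg hi]
    exact continuous_hermitianOf.comp (by fun_prop)

variable (t) in
/-- Increasing diagonals such that different blocks have different traces. -/
noncomputable def standardDiagonal (j : Fin t.L) (x : Fin (t.size j)) : ℝ :=
  (x : ℝ) + ((j : ℝ) - ∑ y : Fin (t.size j), (y : ℝ)) / t.size j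

theorem strictMono_standardDiagonal (j : Fin t.L) : StrictMono (t.standardDiagonal j) := by
  intro x y hxy
  have : (x : ℝ) < y := by exact_mod_cast hxy
  simp only [standardDiagonal]
  linarith

theorem sum_standardDiagonal (j : Fin t.L) : ∑ x, t.standardDiagonal j x = j := by
  have h : (t.size j : ℝ) ≠ 0 := by
    have := t.size_pos j
    positivity
  simp only [standardDiagonal, Finset.sum_add_distrib, Finset.sum_const, Finset.card_univ,
    Fintype.card_fin, nsmul_eq_mul]
  rw [mul_div_cancel₀ _ h]
  ring

/-- The traces of the blocks of the `i`-th entry are pairwise different. -/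
def SeparatedTraces (i : Fin (n + 1))
    (z : Fin (n + 1) → ∀ j : Fin t.L, Fin (t.size j) → Fin (t.size j) → ℂ) : Prop :=
  ∀ j j', j ≠ j' → ∑ x, (z i j x x).re ≠ ∑ x, (z i j' x x).re

/-- The off-diagonal parameters of the blocks of the `i`-th entry do not vanish. -/
def NonvanishingOffDiagonal (i : Fin (n + 1))
    (z : Fin (n + 1) → ∀ j : Fin t.L, Fin (t.size j) → Fin (t.size j) → ℂ) : Prop :=
  ∀ j x y, x ≠ y → z i j x y ≠ 0

variable (t) in
/-- A connected set of parameters of tuples that generate the block algebra. -/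
def goodParams (i : Fin (n + 1)) : Set (t.Params n) :=
  {p | (∀ j, StrictMono (p.1 j)) ∧ NonvanishingOffDiagonal i p.2 ∧
    (SeparatedTraces i p.2 ∨ p.1 = t.standardDiagonal)}

/-- Each block is irreducible, by the distinct diagonal entries in entry `0` and the nonzero
off-diagonal ones in entry `i`. An intertwiner between different blocks would equate their traces,
which differ in entry `i` or, for the standard diagonal, in entry `0`. The double commutant theorem
concludes. -/
theorem unitalCstar_tuple {i : Fin (n + 1)} (hi : i ≠ 0) {p : t.Params n}
    (hp : p ∈ t.goodParams i) : SATuple.unitalCstar p.tuple = t.algebra := by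
  obtain ⟨hmono, hoff, hsep⟩ := hp
  have hb0 : ∀ j, p.blocks 0 j = diagonal (fun x => (p.1 j x : ℂ)) := fun j => if_pos rfl
  have hbi : ∀ j, p.blocks i j = hermitianOf (p.2 i j) := fun j => if_neg hi
  have hself : ∀ j (X : Mat (t.size j)), (∀ a, p.blocks a j * X = X * p.blocks a j) →
      ∃ z : ℂ, X = z • 1 := fun j X hX => by
    have h0 := hX 0
    have h1 := hX i
    rw [hb0] at h0
    rw [hbi] at h1
    exact exists_eq_smul_one (hmono j).injective (fun x y => hermitianOf_ne_zero (hoff j)) h0 h1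
  refine le_antisymm (SATuple.unitalCstar_le_iff.mpr fun k => t.blockMatrix_mem _) ?_
  rintro _ ⟨b, rfl⟩
  refine StarSubalgebra.mem_of_commute_commutant _ fun c hc => ?_
  refine t.commute_blockMatrix (fun a => p.blocks a) hself ?_ (fun a => ?_) b
  · intro j j' hj X hX
    by_contra hX0
    have h1 := hself j (X * Xᴴ) fun a => (intertwiner_mul_conjTranspose
      (p.conjTranspose_blocks a j) (p.conjTranspose_blocks a j') (hX a)).1
    have h2 := hself j' (Xᴴ * X) fun a => (intertwiner_mul_conjTranspose
      (p.conjTranspose_blocks a j) (p.conjTranspose_blocks a j') (hX a)).2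
    rcases hsep with hsep | hsep
    · have h3 := trace_eq_of_intertwiner hX0 h1 h2 (hX i)
      rw [hbi, hbi, trace_hermitianOf, trace_hermitianOf] at h3
      exact hsep j j' hj (by exact_mod_cast h3)
    · have h3 := trace_eq_of_intertwiner hX0 h1 h2 (hX 0)
      rw [hb0, hb0, trace_diagonal, trace_diagonal, hsep, ← Complex.ofReal_sum,
        ← Complex.ofReal_sum, sum_standardDiagonal, sum_standardDiagonal] at h3
      exact hj (Fin.ext (by exact_mod_cast h3))
  · exact hc _ (SATuple.apply_mem_unitalCstar p.tuple a)

/-- The set is a product of planes and punctured planes, and the complex plane remains connected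
without the origin. -/
theorem isPreconnected_nonvanishingOffDiagonal (i : Fin (n + 1)) :
    IsPreconnected {z : Fin (n + 1) → ∀ j : Fin t.L, Fin (t.size j) → Fin (t.size j) → ℂ |
      NonvanishingOffDiagonal i z} := by
  have h : {z : Fin (n + 1) → ∀ j : Fin t.L, Fin (t.size j) → Fin (t.size j) → ℂ |
      NonvanishingOffDiagonal i z} =
      Set.univ.pi fun a => Set.univ.pi fun _ => Set.univ.pi fun x => Set.univ.pi fun y =>
        if a = i ∧ x ≠ y then {(0 : ℂ)}ᶜ else Set.univ := by
    ext z
    simp only [Set.mem_ofPred_eq, Set.mem_univ_pi]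
    constructor
    · intro hz a j x y
      split_ifs with h
      · obtain ⟨rfl, hxy⟩ := h
        exact hz j x y hxy
      · trivial
    · intro hz j x y hxy
      have := hz i j x y
      rw [if_pos ⟨rfl, hxy⟩] at this
      exact this
  rw [h]
  refine isPreconnected_univ_pi fun a => isPreconnected_univ_pi fun j =>
    isPreconnected_univ_pi fun x => isPreconnected_univ_pi fun y => ?_
  split_ifs
  · exact (isConnected_compl_singleton_of_one_lt_rank (by simp) _).isPreconnected
  · exact isPreconnected_univ

theorem isPreconnected_strictMono :
    IsPreconnected {l : ∀ j : Fin t.L, Fin (t.size j) → ℝ | ∀ j, StrictMono (l j)} := by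
  refine Convex.isPreconnected fun l hl m hm r s hr hs hrs j x y hxy => ?_
  have h1 := hl j hxy
  have h2 := hm j hxy
  change r * l j x + s * m j x < r * l j y + s * m j y
  rcases hr.eq_or_lt with rfl | hr'
  · have : s = 1 := by linarith
    subst this
    linarith
  · nlinarith

variable (t n) in
theorem standard_mem_goodParams (i : Fin (n + 1)) :
    ((t.standardDiagonal, fun _ _ _ _ => 1) : t.Params n) ∈ t.goodParams i :=
  ⟨strictMono_standardDiagonal, fun _ _ _ _ => one_ne_zero, Or.inr rfl⟩

/-- While entry `i` separates the traces, the diagonal can move through a convex set to the standard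
one. Once it is standard, it separates the traces itself, and the other parameters may move freely
among the nonvanishing ones. -/
theorem isPreconnected_goodParams (i : Fin (n + 1)) : IsPreconnected (t.goodParams (n := n) i) := by
  have hQ : IsPreconnected ({t.standardDiagonal} ×ˢ
      {z : Fin (n + 1) → ∀ j : Fin t.L, Fin (t.size j) → Fin (t.size j) → ℂ |
        NonvanishingOffDiagonal i z}) :=
    isPreconnected_singleton.prod (isPreconnected_nonvanishingOffDiagonal i)
  refine isPreconnected_of_forall (t.standardDiagonal, fun _ _ _ _ => 1) fun p hp => ?_
  obtain ⟨hmono, hoff, hsep⟩ := hp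
  rcases hsep with hsep | hsep
  · refine ⟨{t.standardDiagonal} ×ˢ {z | NonvanishingOffDiagonal i z} ∪
      {l : ∀ j : Fin t.L, Fin (t.size j) → ℝ | ∀ j, StrictMono (l j)} ×ˢ {p.2}, ?_, Or.inl ⟨rfl, fun _ _ _ _ => one_ne_zero⟩,
      Or.inr ⟨hmono, rfl⟩, ?_⟩
    · rintro ⟨l, z⟩ (⟨h1, h2⟩ | ⟨h1, h2⟩)
      · rw [Set.mem_singleton_iff] at h1
        simp only at h1 h2
        subst h1
        exact ⟨strictMono_standardDiagonal, h2, Or.inr rfl⟩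
      · rw [Set.mem_singleton_iff] at h2
        simp only at h1 h2
        subst h2
        exact ⟨h1, hoff, Or.inl hsep⟩
    · exact hQ.union (t.standardDiagonal, p.2) ⟨rfl, hoff⟩ ⟨strictMono_standardDiagonal, rfl⟩
        (isPreconnected_strictMono.prod isPreconnected_singleton)
  · refine ⟨{t.standardDiagonal} ×ˢ {z | NonvanishingOffDiagonal i z}, ?_,
      ⟨rfl, fun _ _ _ _ => one_ne_zero⟩, ⟨hsep, hoff⟩, hQ⟩
    rintro ⟨l, z⟩ ⟨h1, h2⟩
    rw [Set.mem_singleton_iff] at h1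
    simp only at h1 h2
    subst h1
    exact ⟨strictMono_standardDiagonal, h2, Or.inr rfl⟩

theorem eventually_add_smul_ne_zero {E : Type*} [NormedAddCommGroup E] [NormedSpace ℝ E] (c : E)
    {k : E} (hk : k ≠ 0) : ∀ᶠ ε : ℝ in nhdsWithin 0 (Set.Ioi 0), c + ε • k ≠ 0 := by
  by_cases hc : c = 0
  · filter_upwards [self_mem_nhdsWithin] with ε hε
    rw [hc, zero_add]
    exact smul_ne_zero (ne_of_gt hε) hk
  · have h : ContinuousAt (fun ε : ℝ => c + ε • k) 0 := by fun_prop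
    refine (h.eventually_ne ?_).filter_mono nhdsWithin_le_nhds
    simpa using hc

/-- Perturb along `q`: adding `ε` times the standard diagonal makes increasing diagonals strictly
increasing, and shifts the trace of the `j`-th block of entry `i` by `ε j`. The conditions in entry
`i` are finitely many affine functions of `ε` that must not vanish, which holds for small `ε > 0`.
-/
theorem mem_closure_goodParams (i : Fin (n + 1)) {p : t.Params n} (hp : ∀ j, Monotone (p.1 j)) :
    p ∈ closure (t.goodParams i) := by
  let q : t.Params n := (t.standardDiagonal, fun _ j x y =>
    if x = y then (t.standardDiagonal j x : ℂ) else 1)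
  have hlim : Filter.Tendsto (fun ε : ℝ => p + ε • q) (nhdsWithin 0 (Set.Ioi 0)) (nhds p) := by
    have h : Filter.Tendsto (fun ε : ℝ => p + ε • q) (nhds 0) (nhds (p + (0 : ℝ) • q)) :=
      Continuous.tendsto (by fun_prop) 0
    rw [zero_smul, add_zero] at h
    exact h.mono_left nhdsWithin_le_nhds
  refine mem_closure_of_tendsto hlim ?_
  have h1 : ∀ᶠ ε : ℝ in nhdsWithin 0 (Set.Ioi 0), ∀ j (x y : Fin (t.size j)), x ≠ y →
      p.2 i j x y + ε • (1 : ℂ) ≠ 0 := by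
    refine Filter.eventually_all.mpr fun j => Filter.eventually_all.mpr fun x =>
      Filter.eventually_all.mpr fun y => ?_
    filter_upwards [eventually_add_smul_ne_zero (p.2 i j x y) one_ne_zero] with ε hε _ using hε
  have h2 : ∀ᶠ ε : ℝ in nhdsWithin 0 (Set.Ioi 0), ∀ j j' : Fin t.L, j ≠ j' →
      (∑ x, (p.2 i j x x).re - ∑ x, (p.2 i j' x x).re) + ε • ((j : ℝ) - (j' : ℝ)) ≠ 0 := by
    refine Filter.eventually_all.mpr fun j => Filter.eventually_all.mpr fun j' => ?_
    by_cases hj : j = j'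
    · exact Filter.Eventually.of_forall fun ε h => absurd hj h
    · have hk : (j : ℝ) - (j' : ℝ) ≠ 0 := fun h =>
        hj (Fin.ext (by exact_mod_cast sub_eq_zero.mp h))
      filter_upwards [eventually_add_smul_ne_zero _ hk] with ε hε _ using hε
  filter_upwards [h1, h2, self_mem_nhdsWithin] with ε hε1 hε2 hε
  refine ⟨fun j x y hxy => ?_, fun j x y hxy => ?_, Or.inl fun j j' hj h => ?_⟩
  · change p.1 j x + ε * t.standardDiagonal j x < p.1 j y + ε * t.standardDiagonal j y
    have h3 := hp j hxy.le
    have h4 := mul_lt_mul_of_pos_left (strictMono_standardDiagonal j hxy) hε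
    linarith
  · have h3 := hε1 j x y hxy
    change p.2 i j x y + ε • (if x = y then (t.standardDiagonal j x : ℂ) else 1) ≠ 0
    rwa [if_neg hxy]
  · have h3 : ∀ j, ∑ x, ((p + ε • q).2 i j x x).re = ∑ x, (p.2 i j x x).re + ε * j := fun j => by
      rw [← sum_standardDiagonal j, Finset.mul_sum, ← Finset.sum_add_distrib]
      refine Finset.sum_congr rfl fun x _ => ?_
      change (p.2 i j x x + ε • (if x = x then (t.standardDiagonal j x : ℂ) else 1)).re = _
      simp
    rw [h3, h3] at h
    apply hε2 j j' hj
    rw [smul_eq_mul]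
    linarith

/-- Every tuple in the stratum is conjugate to a tuple of block matrices the first of which is
diagonal with increasing diagonals of the blocks. -/
theorem exists_conj_tuple {a : SATuple d n} (ha : a ∈ typeStratum n t) :
    ∃ (w : Matrix.unitaryGroup (Fin d) ℂ) (p : t.Params n), (∀ j, Monotone (p.1 j)) ∧
      a = fun k => conjSA w (p.tuple k) := by
  obtain ⟨u, hu⟩ := unitarilyConj_iff.mp ha
  have hb : ∀ k, ∃ b : ∀ j : Fin t.L, Mat (t.size j),
      t.blockMatrix b = (u : Mat d)ᴴ * (a k : Mat d) * u := fun k => by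
    have : (u : Mat d)ᴴ * (a k : Mat d) * u ∈ t.algebra := by
      rw [← hu, conj_conjTranspose_conj]
      exact SATuple.apply_mem_unitalCstar a k
    exact this
  choose b hb using hb
  have hbH : ∀ k j, (b k j)ᴴ = b k j := fun k => by
    refine congrFun (t.blockMatrix_injective ?_)
    rw [← conjTranspose_blockMatrix, hb, conjTranspose_mul, conjTranspose_mul,
      conjTranspose_conjTranspose, ← Matrix.mul_assoc]
    exact congrArg (fun x => (u : Mat d)ᴴ * x * u) (a k).2.star_eq
  choose v l hl hvl using fun j => exists_unitary_diagonal_monotone (hbH 0 j)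
  -- Diagonalizing by a unitary inside the block algebra keeps all other entries in block form.
  have hV : t.blockMatrix (fun j => (v j : Mat (t.size j))) ∈ Matrix.unitaryGroup (Fin d) ℂ := by
    rw [Matrix.mem_unitaryGroup_iff, star_eq_conjTranspose, conjTranspose_blockMatrix,
      blockMatrix_mul, ← blockMatrix_one]
    exact congrArg _ (funext fun j => coe_mul_conjTranspose_self (v j))
  let p : t.Params n := (l, fun k j x y => ((v j : Mat (t.size j))ᴴ * b k j * v j) x y)
  have hp : ∀ k j, (v j : Mat (t.size j)) * p.blocks k j * (v j : Mat (t.size j))ᴴ = b k j := by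
    intro k j
    by_cases hk : k = 0
    · subst hk
      have : p.blocks 0 j = diagonal (fun x => (l j x : ℂ)) := if_pos rfl
      rw [this]
      exact (hvl j).symm
    · have h1 : p.blocks k j = hermitianOf fun x y =>
          ((v j : Mat (t.size j))ᴴ * b k j * v j) x y := if_neg hk
      rw [h1, hermitianOf_eq, conj_conjTranspose_conj]
      rw [conjTranspose_mul, conjTranspose_mul, conjTranspose_conjTranspose, hbH, Matrix.mul_assoc]
  refine ⟨u * ⟨_, hV⟩, p, hl, funext fun k => Subtype.ext ?_⟩
  rw [conjSA_mul, coe_conjSA, coe_conjSA]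
  change (a k : Mat d) = u * (t.blockMatrix (fun j => (v j : Mat (t.size j))) *
    t.blockMatrix (p.blocks k) * (t.blockMatrix (fun j => (v j : Mat (t.size j))))ᴴ) * (u : Mat d)ᴴ
  rw [conjTranspose_blockMatrix, blockMatrix_mul, blockMatrix_mul]
  have h1 : (fun j => (v j : Mat (t.size j)) * p.blocks k j * (v j : Mat (t.size j))ᴴ) = b k :=
    funext (hp k)
  rw [h1, hb, conj_conjTranspose_conj]

variable (t) in
-- The conjugates of the tuples with good parameters are the image of a connected product and lie in
-- the stratum. Their closure contains the whole stratum, by the normal form. The assumption `1 ≤ n`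
-- provides an entry besides the diagonalized one.
theorem isConnected_typeStratum (hn : 1 ≤ n) : IsConnected (typeStratum n t) := by
  let i : Fin (n + 1) := ⟨1, by omega⟩
  have hi : i ≠ 0 := fun h => by
    have := congrArg Fin.val h
    simp [i] at this
  let Φ : Matrix.unitaryGroup (Fin d) ℂ × t.Params n → SATuple d n := fun q k =>
    conjSA q.1 (q.2.tuple k)
  have hΦ : Continuous Φ := by
    refine continuous_pi fun k => Continuous.subtype_mk ?_ _
    have h1 : Continuous fun q : Matrix.unitaryGroup (Fin d) ℂ × t.Params n => (q.1 : Mat d) :=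
      continuous_subtype_val.comp continuous_fst
    have h2 : Continuous fun q : Matrix.unitaryGroup (Fin d) ℂ × t.Params n =>
        ((q.2.tuple k : selfAdjoint (Mat d)) : Mat d) :=
      continuous_subtype_val.comp
        ((continuous_apply k).comp (Params.continuous_tuple.comp continuous_snd))
    exact (h1.mul h2).mul (continuous_star.comp h1)
  have hpre : IsPreconnected (Φ '' (Set.univ ×ˢ t.goodParams i)) :=
    (isPreconnected_univ.prod (isPreconnected_goodParams i)).image _ hΦ.continuousOn
  have hsub : Φ '' (Set.univ ×ˢ t.goodParams i) ⊆ typeStratum n t := by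
    rintro _ ⟨⟨w, p⟩, ⟨-, hp⟩, rfl⟩
    change UnitarilyConj (SATuple.unitalCstar fun k => conjSA w (p.tuple k)) t.algebra
    rw [SATuple.unitalCstar_conjSA, unitalCstar_tuple hi hp]
    exact unitarilyConj_conjStarSubalgebra w _
  refine ⟨⟨_, hsub ⟨(1, _), ⟨trivial, t.standard_mem_goodParams n i⟩, rfl⟩⟩,
    hpre.subset_closure hsub fun a ha => ?_⟩
  obtain ⟨w, p, hp, rfl⟩ := exists_conj_tuple ha
  have h1 : (w, p) ∈ closure ((Set.univ : Set (Matrix.unitaryGroup (Fin d) ℂ)) ×ˢ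
      t.goodParams i) := by
    rw [closure_prod_eq, closure_univ]
    exact ⟨trivial, mem_closure_goodParams i hp⟩
  exact image_closure_subset_closure_image hΦ ⟨_, h1, rfl⟩

end BlockType

/-! ### Generating tuples -/

section generating

variable {d n : ℕ}

theorem mem_generatingTuples_iff (hd : 2 ≤ d) (a : SATuple d n) :
    a ∈ generatingTuples d n ↔ SATuple.unitalCstar a = ⊤ := by
  rw [← typeStratum_generic n hd, mem_typeStratum_generic]

theorem eq_top_iff_finrank_selfAdjointMem (A : StarSubalgebra ℂ (Mat d)) :
    A = ⊤ ↔ Module.finrank ℝ (selfAdjointMem A) = d ^ 2 := by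
  have htop : selfAdjointMem (⊤ : StarSubalgebra ℂ (Mat d)) = ⊤ := by
    ext x
    exact ⟨fun _ => trivial, fun _ => trivial⟩
  constructor
  · rintro rfl
    rw [htop, finrank_top, finrank_selfAdjoint]
  · intro h
    rw [← finrank_selfAdjoint] at h
    have h1 := Submodule.eq_top_of_finrank_eq h
    have h2 : ∀ x : selfAdjoint (Mat d), (x : Mat d) ∈ A := fun x => by
      rw [← mem_selfAdjointMem, h1]
      trivial
    refine eq_top_iff.mpr fun x _ => ?_
    rw [← realPart_add_I_smul_imaginaryPart x]
    exact add_mem (h2 _) (SMulMemClass.smul_mem _ (h2 _))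

theorem mem_generatingTuples_iff_of_mem_typeStratum (hd : 2 ≤ d) {t : BlockType d}
    {a : SATuple d n} (ha : a ∈ typeStratum n t) :
    a ∈ generatingTuples d n ↔ ∑ j, t.size j ^ 2 = d ^ 2 := by
  rw [mem_generatingTuples_iff hd, eq_top_iff_finrank_selfAdjointMem,
    UnitarilyConj.finrank_selfAdjointMem ha, t.finrank_selfAdjointMem_algebra]

theorem BlockType.Equivalent.sum_size_sq {s t : BlockType d} (h : s.Equivalent t) :
    ∑ j, s.size j ^ 2 = ∑ j, t.size j ^ 2 := by
  obtain ⟨σ, hσ⟩ := h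
  rw [← σ.sum_comp]
  exact Finset.sum_congr rfl fun j _ => by rw [(hσ j).1]

/-- Countability lets the Hausdorff dimension of the union of the nongeneric strata be a supremum.
-/
instance BlockType.countable (d : ℕ) : Countable (BlockType d) := by
  refine Function.Injective.countable
    (f := fun t : BlockType d => (⟨t.L, t.size, t.mult⟩ : Σ L, (Fin L → ℕ) × (Fin L → ℕ))) ?_
  rintro ⟨L, s, m, _, _, _, _⟩ ⟨L', s', m', _, _, _, _⟩ h
  simp only [Sigma.mk.injEq] at h
  obtain ⟨rfl, h⟩ := h
  simp only [heq_eq_eq, Prod.mk.injEq] at h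
  obtain ⟨rfl, rfl⟩ := h
  rfl

/-- Generation is a matter of dimension: `∑ d_j² = d²` holds for the generic type and fails for all
others by `sum_size_sq_le`. -/
theorem compl_generatingTuples (hd : 2 ≤ d) : (generatingTuples d n)ᶜ =
    ⋃ t : {t : BlockType d // ¬ t.Equivalent (BlockType.generic d hd)}, typeStratum n t.1 := by
  ext a
  rw [Set.mem_iUnion]
  constructor
  · intro ha
    obtain ⟨t, ht⟩ := exists_unitarilyConj_algebra (le_trans one_le_two hd) (SATuple.unitalCstar a)
    refine ⟨⟨t, fun h => ha ?_⟩, ht⟩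
    rw [mem_generatingTuples_iff_of_mem_typeStratum hd ht, h.sum_size_sq]
    change ∑ _j : Fin 1, d ^ 2 = d ^ 2
    simp
  · rintro ⟨⟨t, ht⟩, ha⟩ hgen
    have h1 := (mem_generatingTuples_iff_of_mem_typeStratum hd (t := t) ha).mp hgen
    have h2 := t.sum_size_sq_le hd ht
    omega

theorem mem_compl_generatingTuples_of_eq_smul (hd : 2 ≤ d) {a b : SATuple d n}
    (ha : a ∈ (generatingTuples d n)ᶜ) (c : ℂ) (hb : ∀ i, (b i : Mat d) = c • (a i : Mat d)) :
    b ∈ (generatingTuples d n)ᶜ := by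
  intro h
  apply ha
  rw [mem_generatingTuples_iff hd] at h ⊢
  rw [eq_top_iff, ← h, SATuple.unitalCstar_le_iff]
  intro i
  rw [hb]
  exact SMulMemClass.smul_mem _ (SATuple.apply_mem_unitalCstar a i)

/-- A single self-adjoint matrix does not generate `M_d`. -/
theorem generatingTuples_zero (hd : 2 ≤ d) : generatingTuples d 0 = ∅ := by
  rw [Set.eq_empty_iff_forall_notMem]
  intro a ha
  rw [mem_generatingTuples_iff hd] at ha
  have h1 : ∀ x : Mat d, (a 0 : Mat d) * x = x * a 0 := fun x =>
    SATuple.commute_unitalCstar (a := a) (fun i => by rw [Subsingleton.elim (α := Fin 1) i 0])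
      (by rw [ha]; trivial)
  have h2 : ∀ x y : Mat d, x * y = y * x := fun x y =>
    SATuple.commute_unitalCstar (a := a) (fun i => by rw [Subsingleton.elim (α := Fin 1) i 0, h1])
      (by rw [ha]; trivial)
  let i : Fin d := ⟨0, by omega⟩
  let j : Fin d := ⟨1, by omega⟩
  have hij : i ≠ j := fun h => by simpa [i, j] using congrArg Fin.val h
  have h3 := congrFun₂ (h2 (Matrix.single i j 1) (Matrix.single j i 1)) i i
  rw [Matrix.single_mul_single_same, Matrix.single_mul_single_same] at h3
  simp [hij.symm] at h3

end generating

/-! ### The density criterion -/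

theorem coveringDim_lt_zero_iff {X : Type*} [TopologicalSpace X] :
    coveringDim X < 0 ↔ IsEmpty X := by
  constructor
  · intro h
    by_contra hX
    rw [not_isEmpty_iff] at hX
    obtain ⟨x⟩ := hX
    refine absurd h (not_lt.mpr (le_sInf fun m hm => ?_))
    obtain ⟨𝓥, -, hcov, -, hcard⟩ := hm {Set.univ} (Set.finite_singleton _)
      (fun U hU => by rw [Set.mem_singleton_iff.mp hU]; exact isOpen_univ) (by simp)
    obtain ⟨V, hV, hxV⟩ := Set.mem_sUnion.mp (hcov.ge (Set.mem_univ x))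
    have h1 := hcard x
    cases m with
    | bot =>
      rw [WithBot.bot_add, le_bot_iff] at h1
      exact absurd h1 WithBot.coe_ne_bot
    | coe k => exact WithBot.coe_le_coe.mpr (zero_le (a := k))
  · intro hX
    refine lt_of_le_of_lt (sInf_le (a := ⊥) fun 𝓤 _ _ _ => ?_) (WithBot.bot_lt_coe 0)
    exact ⟨∅, by simp, Subsingleton.elim _ _, by simp, fun x => hX.elim x⟩

/-- The functions with values in the generating tuples are dense exactly on spaces of small
covering dimension. -/
theorem dense_generatingTuples_iff {d n : ℕ} (hd : 2 ≤ d) (X : Type*) [TopologicalSpace X]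
    [CompactSpace X] [T2Space X] :
    Dense {f : C(X, SATuple d n) | ∀ x, f x ∈ generatingTuples d n} ↔
      coveringDim X < ((2 * n * (d - 1) : ℕ) : WithBot ℕ∞) := by
  -- For `n = 0` there are no generators and the bound is `0`, so density holds exactly on the empty
  -- space.
  rcases Nat.eq_zero_or_pos n with rfl | hn
  · have h0 : ((2 * 0 * (d - 1) : ℕ) : WithBot ℕ∞) = 0 := by simp
    rw [h0, coveringDim_lt_zero_iff, generatingTuples_zero hd]
    constructor
    · intro h
      obtain ⟨f, hf⟩ := h.nonempty
      exact ⟨fun x => hf x⟩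
    · intro hX
      have : {f : C(X, SATuple d 0) | ∀ x, f x ∈ (∅ : Set (SATuple d 0))} = Set.univ :=
        Set.eq_univ_of_forall fun f x => hX.elim x
      rw [this]
      exact dense_univ
  have hm : 1 ≤ 2 * n * (d - 1) := by
    have : 0 < d - 1 := by omega
    exact Nat.mul_pos (by omega) this
  constructor
  · intro h
    -- This stratum has codimension exactly `2n(d-1)` and contains no generating tuple, so it
    -- obstructs.
    obtain ⟨k, hk, hS⟩ := exists_isSmoothSubmanifold_corner n hd
    refine coveringDim_lt_of_dense_ne_zero hm (hS.dense_ne_zero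
      ((BlockType.corner d hd).isConnected_typeStratum hn).nonempty
      (by rw [hk, finrank_saTuple]) (h.mono fun f hf x hx => ?_))
    have h1 := (mem_generatingTuples_iff_of_mem_typeStratum hd hx).mp (hf x)
    have h2 := BlockType.sum_size_sq_corner hd
    omega
  · intro h
    have hfin := finrank_saTuple d n
    have hpos : 0 < (n + 1) * d ^ 2 := by positivity
    -- General position needs one bound below the full dimension. As codimension exceeds `dim W` and
    -- dimensions are integers, `N`, one less than the full dimension, works for all strata and all
    -- `W`.
    obtain ⟨N, hN⟩ : ∃ N, N + 1 = (n + 1) * d ^ 2 := ⟨_, Nat.sub_add_cancel hpos⟩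
    have hD : (N : ENNReal) < Module.finrank ℝ (SATuple d n) := by
      rw [hfin, ← hN]
      exact Nat.cast_lt.mpr N.lt_succ_self
    have hdim : ∀ W : Submodule ℝ (SATuple d n), Module.finrank ℝ W < 2 * n * (d - 1) →
        dimH ((generatingTuples d n)ᶜ + (W : Set (SATuple d n))) ≤ N := fun W hW => by
      rw [compl_generatingTuples hd, Set.iUnion_add, dimH_iUnion]
      refine iSup_le fun t => ?_
      obtain ⟨k, hk, hS⟩ := exists_isSmoothSubmanifold_typeStratum n hd t.1 t.2
      refine (hS.dimH_add_submodule_le W).trans (Nat.cast_le.mpr ?_)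
      have h2 : k + 2 * n * (d - 1) ≤ (n + 1) * d ^ 2 := by
        zify [le_trans one_le_two hd]
        linarith
      omega
    have h1 := dense_avoiding_of_coveringDim_lt (V := SATuple d n) (Z := (generatingTuples d n)ᶜ)
      (m := 2 * n * (d - 1)) (D := N) ?_ ?_ ?_ h
    · simpa only [Set.mem_compl_iff, not_not] using h1
    · intro c a ha
      refine mem_compl_generatingTuples_of_eq_smul (n := n) (a := a) hd ha (c : ℂ) fun i => ?_
      exact (Complex.coe_smul c (a i : Mat d)).symm
    · exact hD
    · exact hdim

end

theorem lemma3 (d n : ℕ) (hd : 2 ≤ d) :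
    -- the strata of the various types are precisely the orbit-type strata of the action
    (∀ a : SATuple d n, ∃ t : BlockType d, a ∈ typeStratum n t) ∧
    (∀ (t : BlockType d) (a : SATuple d n), a ∈ typeStratum n t →
      typeStratum n t = orbitTypeStratum a) ∧
    -- the stratum of generic type consists of the generating tuples
    typeStratum n (BlockType.generic d hd) = generatingTuples d n ∧
    -- every other stratum is a submanifold of bounded dimension, connected for `n ≥ 1`
    (∀ t : BlockType d, ¬ t.Equivalent (BlockType.generic d hd) →
      (∃ k : ℕ, (k : ℤ) ≤ (n + 1) * d ^ 2 - 2 * n * (d - 1) ∧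
        IsSmoothSubmanifold k (typeStratum n t)) ∧
      (1 ≤ n → IsConnected (typeStratum n t))) ∧
    -- equality holds for the type of `M_{d-1} ⊕ ℂ`
    (1 ≤ n → (typeStratum n (BlockType.corner d hd)).Nonempty ∧
      ∃ k : ℕ, (k : ℤ) = (n + 1) * d ^ 2 - 2 * n * (d - 1) ∧
        IsSmoothSubmanifold k (typeStratum n (BlockType.corner d hd))) ∧
    -- density of the generating tuples
    (∀ (X : Type*) [TopologicalSpace X] [CompactSpace X] [T2Space X],
      Dense {f : C(X, SATuple d n) | ∀ x, f x ∈ generatingTuples d n} ↔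
        coveringDim X < ((2 * n * (d - 1) : ℕ) : WithBot ℕ∞)) := by
  refine ⟨fun a => exists_unitarilyConj_algebra (le_trans one_le_two hd) _,
    fun t a ha => typeStratum_eq_orbitTypeStratum ha, typeStratum_generic n hd,
    fun t ht => ⟨exists_isSmoothSubmanifold_typeStratum n hd t ht,
      fun hn => t.isConnected_typeStratum hn⟩,
    fun hn => ⟨((BlockType.corner d hd).isConnected_typeStratum hn).nonempty, ?_⟩,
    fun X _ _ _ => dense_generatingTuples_iff hd X⟩
  obtain ⟨k, hk, hS⟩ := exists_isSmoothSubmanifold_corner n hd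
  refine ⟨k, ?_, hS⟩
  zify [le_trans one_le_two hd] at hk
  linarith
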